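/- Let $N\ge 1$. For each $i\in\{1,\dots,N\}$ let a probability distribution on $\{0,1,2,\dots\}\times\{1,\dots,N\}$ be given, with generating functions $A_{ij}(z)=\mathbb E[z^{A_n}1_{\{J_{n+1}=j\}}\mid J_n=i]$, and let $B(z)=\mathbb E[z^{B}]$ be the generating function of a random variable $B\in\{1,2,\dots\}$ with $\mathbb E[B]<\infty$. Put $P_{ij}=A_{ij}(1)=\mathbb P(J_{n+1}=j\mid J_n=i)$, assumed irreducible with stationary distribution $\mathbb P(J=i)$; let $\alpha_{ij}=\mathbb E[A_n1_{\{J_{n+1}=j\}}\mid J_n=i]<\infty$, and assume $$\rho:=\sum_{i,j}\mathbb P(J=i)\,\alpha_{ij}<1 .$$ Let $(X_0,J_1)$ be arbitrary, let $(A_n,J_{n+1})_{n\ge1}$ be the semi-Markov sequence with these transition laws (given the past, $(A_n,J_{n+1})$ depends only on $J_n$), let $(B_n)_{n\ge1}$ be i.i.d. copies of $B$ independent of $X_0$ and of $(A_n,J_n)_{n\ge1}$, and let $$X_n=X_{n-1}-1+A_n\ \text{ if } X_{n-1}\ge1,\qquad X_n=A_n+B_n-1\ \text{ if } X_{n-1}=0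 .$$ Let $M(z)$ be the $N\times N$ matrix with diagonal entries $z-A_{ii}(z)$ and off-diagonal entries $-A_{ij}(z)$, $|z|\le1$. (1) *Steady state.* The Markov chain $(X_n,J_{n+1})$ has a stationary distribution $\mu$: if $(X_0,J_1)$ has law $\mu$, then so has $(X_n,J_{n+1})$ for every $n$. If the chain has an aperiodic state that is accessible from every state, then, for every law of $(X_0,J_1)$, the limits $f_j(z)=\lim_{n\to\infty}\mathbb E[z^{X_n}1_{\{J_{n+1}=j\}}]$ exist for $|z|\le1$, and $f_j(z)=\sum_x\mu(x,j)z^x$. (2) *Steady-state equations.* Suppose that the limits $f_j(z)=\lim_{n\to\infty}\mathbb E[z^{X_n}1_{\{J_{n+1}=j\}}]$ exist for all $j$ and all $|z|\le1$ (as they do for a stationary start). Then $f(z)=(f_1(z),\dots,f_N(z))^T$ satisfies, for $|z|\le 1$, $$M(z)^Tf(z)=b(z),\qquad b_j(z)=(B(z)-1)\sum_{i=1}^NA_{ij}(z)f_i(0),$$ hence $$f(z)=\frac{1}{\det M(z)^T}\bigl(\operatorname{cof}M(z)^T\bigr)^Tb(z)\quad\text{whenever }\det M(z)\ne0,$$ and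 the boundary values satisfy $$\sum_{i=1}^Nf_i(0)=\frac{1-\rho}{\mathbb E[B]}$$ together with the linear equations coming from the zeros of $\det M$ in the closed disc other than $z=1$: at a zero $\zeta$ of multiplicity $m$ with $|\zeta|<1$, every component of the numerator $(\operatorname{cof}M(z)^T)^Tb(z)$ vanishes at $\zeta$ together with its derivatives of order less than $m$; at a zero $\zeta\neq1$ with $|\zeta|=1$, every component of the numerator vanishes. (3) *Number of zeros.* $\det M(1)=0$; apart from $z=1$, $\det M$ has finitely many zeros in $|z|\le1$, and their number is exactly $N-1$, where zeros in $|z|<1$ are counted with multiplicity and zeros on $|z|=1$ are counted once. If for every $z\ne1$ with $|z|=1$ there are $i,j$ with $|A_{ij}(z)|<P_{ij}$, then there are no zeros with $|z|=1$, $z\ne1$, so that $\det M$ has exactly $N-1$ zeros, counted with multiplicity, in $|z|<1$. -/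

import Mathlib

open MeasureTheory Filter Topology
open scoped Matrix

namespace SMQueue

noncomputable section

/-!  The input of the model.  The `N` customer types are the elements of `Fin N`.
`κ i (k, j)` is the conditional probability `ℙ(A_n = k, J_{n+1} = j | J_n = i)` and
`β b = ℙ(B_n = b)`. -/

/-- The generating function `A_{ij}(z) = E[z^{A_n} 1{J_{n+1} = j} | J_n = i]`, for `|z| ≤ 1`. -/
def Agf {N : ℕ} (κ : Fin N → PMF (ℕ × Fin N)) (i j : Fin N) (z : ℂ) : ℂ :=
  ∑' k : ℕ, ((κ i (k, j)).toReal : ℂ) * z ^ k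

/-- The batch-size generating function `B(z) = E[z^B]`, for `|z| ≤ 1`. -/
def Bgf (β : PMF ℕ) (z : ℂ) : ℂ :=
  ∑' b : ℕ, ((β b).toReal : ℂ) * z ^ b

/-- The transition matrix `P_{ij} = ℙ(J_{n+1} = j | J_n = i)`. -/
def transitionMatrix {N : ℕ} (κ : Fin N → PMF (ℕ × Fin N)) : Matrix (Fin N) (Fin N) ℝ :=
  Matrix.of fun i j => ∑' k : ℕ, (κ i (k, j)).toReal

/-- `α_{ij} = E[A_n 1{J_{n+1} = j} | J_n = i]`. -/
def alpha {N : ℕ} (κ : Fin N → PMF (ℕ × Fin N)) (i j : Fin N) : ℝ :=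
  ∑' k : ℕ, (k : ℝ) * (κ i (k, j)).toReal

/-- `E[B]`. -/
def meanBatch (β : PMF ℕ) : ℝ :=
  ∑' b : ℕ, (b : ℝ) * (β b).toReal

/-- `π` is a stationary probability vector of the chain `J_n`. -/
structure IsStationaryVector {N : ℕ} (κ : Fin N → PMF (ℕ × Fin N)) (π : Fin N → ℝ) : Prop where
  nonneg : ∀ i, 0 ≤ π i
  sum_eq_one : ∑ i, π i = 1
  balance : ∀ j, π j = ∑ i, π i * transitionMatrix κ i j

/-- The load `ρ = E[A] = ∑_i ∑_j ℙ(J = i) α_{ij}`, where `π i = ℙ(J = i)`. -/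
def load {N : ℕ} (κ : Fin N → PMF (ℕ × Fin N)) (π : Fin N → ℝ) : ℝ :=
  ∑ i, ∑ j, π i * alpha κ i j

/-- The matrix `M(z)`, with entries `z - A_{ii}(z)` on the diagonal and `-A_{ij}(z)` off it. -/
def Mmat {N : ℕ} (κ : Fin N → PMF (ℕ × Fin N)) (z : ℂ) : Matrix (Fin N) (Fin N) ℂ :=
  Matrix.of fun i j => if i = j then z - Agf κ i i z else -Agf κ i j z

/-- The right-hand side `b(z)`, as a linear function of the vector `x` of boundary values
`x i = f_i(0)`: its `j`-th entry is `(B(z) - 1) ∑_i A_{ij}(z) x_i`. -/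
def bvec {N : ℕ} (κ : Fin N → PMF (ℕ × Fin N)) (β : PMF ℕ) (x : Fin N → ℂ) (z : ℂ) :
    Fin N → ℂ :=
  fun j => (Bgf β z - 1) * ∑ i, Agf κ i j z * x i

/-- The numerator `(cof M(z)ᵀ)ᵀ b(z)`, as a linear function of the boundary values `x`.
(Mathlib's `adjugate` is the transpose of the cofactor matrix.) -/
def numerator {N : ℕ} (κ : Fin N → PMF (ℕ × Fin N)) (β : PMF ℕ) (x : Fin N → ℂ) (z : ℂ) :
    Fin N → ℂ :=
  ((Mmat κ z)ᵀ).adjugate *ᵥ bvec κ β x z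

/-- The zeros of `det M` in the open unit disc. -/
def interiorZeros {N : ℕ} (κ : Fin N → PMF (ℕ × Fin N)) : Set ℂ :=
  {ζ | ‖ζ‖ < 1 ∧ (Mmat κ ζ).det = 0}

/-- The zeros of `det M` on the unit circle, apart from the point `1`. -/
def circleZeros {N : ℕ} (κ : Fin N → PMF (ℕ × Fin N)) : Set ℂ :=
  {ζ | ‖ζ‖ = 1 ∧ ζ ≠ 1 ∧ (Mmat κ ζ).det = 0}

/-- The multiplicity of `ζ`, `|ζ| < 1`, as a zero of `det M`. -/
def zeroMult {N : ℕ} (κ : Fin N → PMF (ℕ × Fin N)) (ζ : ℂ) : ℕ :=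
  analyticOrderNatAt (fun z => (Mmat κ z).det) ζ

/-- The queueing process with input `κ`, `β` on a probability space `(Ω, ℙ)`.
`J n`, `A n` and `B n` are used for `n ≥ 1` only, `X n` for `n ≥ 0`; the joint law of
`(X_0, J_1)` is arbitrary.  The field `law` gives all finite-dimensional distributions:
given `(X_0, J_1)`, the sequence `(A_n, J_{n+1})`, `n ≥ 1`, is semi-Markov with kernel `κ`, and
the `B_n` are i.i.d. with law `β` and independent of everything else. -/
structure IsQueue {N : ℕ} (κ : Fin N → PMF (ℕ × Fin N)) (β : PMF ℕ)
    {Ω : Type*} [MeasurableSpace Ω] (ℙ : Measure Ω)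
    (X A B : ℕ → Ω → ℕ) (J : ℕ → Ω → Fin N) : Prop where
  measurable_X_zero : Measurable (X 0)
  measurable_A : ∀ n, Measurable (A n)
  measurable_B : ∀ n, Measurable (B n)
  measurable_J : ∀ n, Measurable (J n)
  law : ∀ (n x : ℕ) (j : ℕ → Fin N) (k b : ℕ → ℕ),
    ℙ {ω | X 0 ω = x ∧ J 1 ω = j 1 ∧
        ∀ m ∈ Finset.Icc 1 n, A m ω = k m ∧ J (m + 1) ω = j (m + 1) ∧ B m ω = b m} =
      ℙ {ω | X 0 ω = x ∧ J 1 ω = j 1} *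
        ∏ m ∈ Finset.Icc 1 n, (κ (j m) (k m, j (m + 1)) * β (b m))
  recurrence : ∀ n ω, X (n + 1) ω =
    if 1 ≤ X n ω then X n ω - 1 + A (n + 1) ω else A (n + 1) ω + B (n + 1) ω - 1

/-- `E[z^{X_n} 1{J_{n+1} = j}]`. -/
def jointGF {N : ℕ} {Ω : Type*} [MeasurableSpace Ω] (ℙ : Measure Ω)
    (X : ℕ → Ω → ℕ) (J : ℕ → Ω → Fin N) (n : ℕ) (j : Fin N) (z : ℂ) : ℂ :=
  ∫ ω, (if J (n + 1) ω = j then z ^ X n ω else 0) ∂ℙ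

/-- The one-step transition law of the Markov chain `(X_n, J_{n+1})`. -/
def step {N : ℕ} (κ : Fin N → PMF (ℕ × Fin N)) (β : PMF ℕ) (s : ℕ × Fin N) :
    PMF (ℕ × Fin N) :=
  if 1 ≤ s.1 then (κ s.2).map fun a => (s.1 - 1 + a.1, a.2)
  else (κ s.2).bind fun a => β.map fun b => (a.1 + b - 1, a.2)

/-- The `n`-step transition law of the Markov chain `(X_n, J_{n+1})`. -/
def stepN {N : ℕ} (κ : Fin N → PMF (ℕ × Fin N)) (β : PMF ℕ) : ℕ → ℕ × Fin N → PMF (ℕ × Fin N)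
  | 0, s => PMF.pure s
  | n + 1, s => (stepN κ β n s).bind (step κ β)

/-- Some state of the chain `(X_n, J_{n+1})` is accessible from every state and is aperiodic
(returns to it are possible in every sufficiently large number of steps). -/
def HasAperiodicState {N : ℕ} (κ : Fin N → PMF (ℕ × Fin N)) (β : PMF ℕ) : Prop :=
  ∃ s₀ : ℕ × Fin N, (∀ s, ∃ n, s₀ ∈ (stepN κ β n s).support) ∧
    ∃ m, ∀ n ≥ m, s₀ ∈ (stepN κ β n s₀).support

end

end SMQueue

namespace SMQueue

noncomputable section

/-! ### Generating functions of nonnegative summable sequences -/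

/-! Zeros. Deform `M(z)` to `z - t A(z)` with `0 ≤ t ≤ 1`. A null vector at a point with `t < |z| ≤
1` would violate the maximum principle for `P` (`detFam_ne_zero`). So for `t < 1` a circle of radius
between `t` and `1` encloses as many zeros as at `t = 0`, where the determinant is `z ^ N`
(`zeroCount_eq_of_homotopy`). Only first moments are assumed, so `A` need not continue past the unit
circle: the argument principle is used on circles of radius `< 1` only, and the passage `t → 1`
relies on the derivative being continuous up to the boundary. At `(t, z) = (1, 1)` that derivative
is a positive multiple of `1 - ρ` (`exists_detFamDeriv_one`). Hence for `t` just below `1` exactly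
one zero lies near `1`; it is real, simple and inside the disc. At any other zero `ζ` on the circle,
equality in the triangle inequality makes `A(ζ z)` diagonally similar to `ζ A(z)`, so the whole
family is symmetric under rotation by `ζ` (`detFam_mul`) and the picture at `1` repeats at `ζ`. Each
circle zero therefore uses up exactly one of the `N` zeros (`zeros_detFam`).

Steady state. Solving a Poisson equation for the type process gives a potential `x + h(i)` whose
mean falls by `1 - ρ` per step, apart from a gain `E[B]` at level `0`. Summing, level `0` is
occupied with long-run frequency at least `(1 - ρ) / E[B]` (`exists_occupation_bound`). A cluster
point of the time averages is a sub-probability solving the steady-state equations in the open disc.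
Expanding these at `z = 1` shows that its mass `γ` and its weight `Q` at level `0` satisfy `E[B] Q =
γ (1 - ρ)`; the occupation bound then forces `γ = 1`, so no mass escapes (`mass_eq`).

Convergence. The asymptotic oscillation of the chain between two starting points is subharmonic for
the product chain, hence constant along its transitions under the product of stationary laws.
Aperiodicity joins such pairs to the diagonal, where it is zero. This settles the aperiodic state;
uniform accessibility of that state, again from the occupation bound, settles all others
(`tendsto_expect_stepN`).

Equations. One step of the chain is linear in generating functions, and the equations pass to the
limit. Multiplying by the adjugate gives numerator `= det M · f`, so the numerator inherits the
zeros of `det M`. The boundary sum comes from `mass_eq` once more. -/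

/-- The generating function of a real sequence. -/
def genFun (a : ℕ → ℝ) (z : ℂ) : ℂ := ∑' k : ℕ, (a k : ℂ) * z ^ k

/-- The formal derivative of the generating function of a real sequence. -/
def genFunDeriv (a : ℕ → ℝ) (z : ℂ) : ℂ := ∑' k : ℕ, (a k : ℂ) * (k * z ^ (k - 1))

section GenFun

variable {a : ℕ → ℝ}

lemma norm_genFun_term_le (ha : ∀ k, 0 ≤ a k) {z : ℂ} (hz : ‖z‖ ≤ 1) (k : ℕ) :
    ‖(a k : ℂ) * z ^ k‖ ≤ a k := by
  rw [norm_mul, norm_pow, Complex.norm_real, Real.norm_of_nonneg (ha k)]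
  exact mul_le_of_le_one_right (ha k) (pow_le_one₀ (norm_nonneg _) hz)

lemma norm_genFunDeriv_term_le (ha : ∀ k, 0 ≤ a k) {z : ℂ} (hz : ‖z‖ ≤ 1) (k : ℕ) :
    ‖(a k : ℂ) * (k * z ^ (k - 1))‖ ≤ k * a k := by
  rw [norm_mul, norm_mul, norm_pow, Complex.norm_real, Real.norm_of_nonneg (ha k),
    Complex.norm_natCast, mul_comm (k : ℝ) (a k)]
  exact mul_le_mul_of_nonneg_left (mul_le_of_le_one_right (Nat.cast_nonneg k)
    (pow_le_one₀ (norm_nonneg _) hz)) (ha k)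

lemma summable_genFun (ha : ∀ k, 0 ≤ a k) (hs : Summable a) {z : ℂ} (hz : ‖z‖ ≤ 1) :
    Summable fun k => (a k : ℂ) * z ^ k :=
  .of_norm_bounded hs (norm_genFun_term_le ha hz)

lemma norm_genFun_le (ha : ∀ k, 0 ≤ a k) (hs : Summable a) {z : ℂ} (hz : ‖z‖ ≤ 1) :
    ‖genFun a z‖ ≤ ∑' k, a k :=
  tsum_of_norm_bounded hs.hasSum (norm_genFun_term_le ha hz)

lemma genFun_one : genFun a 1 = ((∑' k, a k : ℝ) : ℂ) := by
  simp [genFun, Complex.ofReal_tsum]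

lemma genFun_zero : genFun a 0 = a 0 := by
  rw [genFun, tsum_eq_single 0] <;> simp +contextual

lemma genFunDeriv_one : genFunDeriv a 1 = ((∑' k : ℕ, (k : ℝ) * a k : ℝ) : ℂ) := by
  simp [genFunDeriv, mul_comm, Complex.ofReal_tsum]

lemma continuousOn_genFun (ha : ∀ k, 0 ≤ a k) (hs : Summable a) :
    ContinuousOn (genFun a) (Metric.closedBall 0 1) :=
  continuousOn_tsum (fun k => by fun_prop) hs
    fun k z hz => norm_genFun_term_le ha (by simpa using hz) k

lemma continuousOn_genFunDeriv (ha : ∀ k, 0 ≤ a k) (hm : Summable fun k : ℕ => (k : ℝ) * a k) :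
    ContinuousOn (genFunDeriv a) (Metric.closedBall 0 1) :=
  continuousOn_tsum (fun k => by fun_prop) hm
    fun k z hz => norm_genFunDeriv_term_le ha (by simpa using hz) k

lemma differentiableOn_genFun (ha : ∀ k, 0 ≤ a k) (hs : Summable a) :
    DifferentiableOn ℂ (genFun a) (Metric.ball 0 1) :=
  Complex.differentiableOn_tsum_of_summable_norm hs (fun k => by fun_prop) Metric.isOpen_ball
    fun k z hz => norm_genFun_term_le ha (by simpa using (mem_ball_zero_iff.1 hz).le) k

lemma hasDerivAt_genFun (ha : ∀ k, 0 ≤ a k) (hs : Summable a)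
    (hm : Summable fun k : ℕ => (k : ℝ) * a k) {z : ℂ} (hz : ‖z‖ < 1) :
    HasDerivAt (genFun a) (genFunDeriv a z) z := by
  refine hasDerivAt_tsum_of_isPreconnected (t := Metric.ball (0 : ℂ) 1) (y₀ := z) hm
    Metric.isOpen_ball (convex_ball 0 1).isPreconnected
    (fun k w _ => (hasDerivAt_pow k w).const_mul _)
    (fun k w hw => norm_genFunDeriv_term_le ha (mem_ball_zero_iff.1 hw).le k)
    (mem_ball_zero_iff.2 hz) (summable_genFun ha hs hz.le) (mem_ball_zero_iff.2 hz)

lemma tendsto_genFun_one (ha : ∀ k, 0 ≤ a k) (hs : Summable a) :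
    Tendsto (fun x : ℝ => genFun a x) (𝓝[<] 1) (𝓝 ((∑' k, a k : ℝ) : ℂ)) := by
  rw [← genFun_one]
  have h := continuousOn_genFun ha hs 1 (by simp)
  refine h.tendsto.comp (tendsto_nhdsWithin_iff.2 ⟨?_, ?_⟩)
  · exact (Complex.continuous_ofReal.tendsto' 1 1 (by simp)).mono_left nhdsWithin_le_nhds
  · filter_upwards [Ioo_mem_nhdsLT (zero_lt_one' ℝ)] with x hx
    simp [abs_of_pos hx.1, hx.2.le]

/-- The quotient equals `∑ a_k (1 + x + ⋯ + x^(k-1))`, with terms dominated by `k a_k`. A finite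
first moment thus gives the one-sided derivative at `1` by dominated convergence. -/
lemma tendsto_genFun_slope_one (ha : ∀ k, 0 ≤ a k) (hs : Summable a)
    (hm : Summable fun k : ℕ => (k : ℝ) * a k) :
    Tendsto (fun x : ℝ => (genFun a 1 - genFun a x) / (1 - x)) (𝓝[<] 1)
      (𝓝 ((∑' k : ℕ, (k : ℝ) * a k : ℝ) : ℂ)) := by
  have key : ∀ᶠ x : ℝ in 𝓝[<] 1, ∑' k : ℕ, (a k : ℂ) * ∑ i ∈ Finset.range k, (x : ℂ) ^ i =
      (genFun a 1 - genFun a x) / (1 - x) := by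
    filter_upwards [Ioo_mem_nhdsLT (zero_lt_one' ℝ)] with x hx
    have hx1 : (x : ℂ) ≠ 1 := by exact_mod_cast hx.2.ne
    have h1 : ‖(x : ℂ)‖ ≤ 1 := by simp [abs_of_pos hx.1, hx.2.le]
    rw [genFun, genFun, ← (summable_genFun ha hs (z := 1) (by simp)).tsum_sub
      (summable_genFun ha hs h1), ← tsum_div_const]
    refine tsum_congr fun k => ?_
    rw [geom_sum_eq hx1]
    have h2 : (x : ℂ) - 1 ≠ 0 := sub_ne_zero.2 hx1
    have h3 : 1 - (x : ℂ) ≠ 0 := sub_ne_zero.2 hx1.symm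
    field_simp
    ring
  refine Tendsto.congr' key ?_
  rw [Complex.ofReal_tsum]
  refine tendsto_tsum_of_dominated_convergence hm (fun k => ?_) ?_
  · have : Continuous fun x : ℝ => (a k : ℂ) * ∑ i ∈ Finset.range k, (x : ℂ) ^ i := by fun_prop
    refine (this.tendsto' 1 _ ?_).mono_left nhdsWithin_le_nhds
    simp [mul_comm]
  · filter_upwards [Ioo_mem_nhdsLT (zero_lt_one' ℝ)] with x hx k
    rw [norm_mul, Complex.norm_real, Real.norm_of_nonneg (ha k), mul_comm]
    refine mul_le_mul_of_nonneg_right ((norm_sum_le _ _).trans ?_) (ha k)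
    calc ∑ i ∈ Finset.range k, ‖(x : ℂ) ^ i‖ ≤ ∑ i ∈ Finset.range k, (1 : ℝ) := by
          refine Finset.sum_le_sum fun i _ => ?_
          rw [norm_pow, Complex.norm_real, Real.norm_of_nonneg hx.1.le]
          exact pow_le_one₀ hx.1.le hx.2.le
      _ = k := by simp

end GenFun

/-! ### Basic facts on the input of the queue -/

lemma summable_toReal {α : Type*} (p : PMF α) : Summable fun s => (p s).toReal :=
  ENNReal.summable_toReal p.tsum_coe_ne_top

lemma tsum_toReal {α : Type*} (p : PMF α) : ∑' s, (p s).toReal = 1 := by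
  rw [← ENNReal.tsum_toReal_eq fun s => p.apply_ne_top s, p.tsum_coe, ENNReal.toReal_one]

section Input

variable {N : ℕ} (κ : Fin N → PMF (ℕ × Fin N))

lemma summable_kernel (i j : Fin N) : Summable fun k : ℕ => (κ i (k, j)).toReal :=
  (summable_toReal (κ i)).comp_injective (Prod.mk_left_injective j)

lemma summable_slice (p : PMF (ℕ × Fin N)) (j : Fin N) : Summable fun k : ℕ => (p (k, j)).toReal :=
  (summable_toReal p).comp_injective (Prod.mk_left_injective j)

lemma Agf_eq_genFun (i j : Fin N) : Agf κ i j = genFun fun k => (κ i (k, j)).toReal := rfl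

lemma Bgf_eq_genFun (β : PMF ℕ) : Bgf β = genFun fun k => (β k).toReal := rfl

lemma transitionMatrix_apply (i j : Fin N) :
    transitionMatrix κ i j = ∑' k : ℕ, (κ i (k, j)).toReal := rfl

lemma transitionMatrix_nonneg (i j : Fin N) : 0 ≤ transitionMatrix κ i j :=
  tsum_nonneg fun _ => ENNReal.toReal_nonneg

lemma tsum_prod_fin {E : Type*} [NormedAddCommGroup E] [CompleteSpace E] {f : ℕ × Fin N → E}
    (hf : Summable f) :
    ∑' s, f s = ∑ j, ∑' k, f (k, j) := by
  have h : Summable fun c : Fin N × ℕ => f (Equiv.prodComm (Fin N) ℕ c) :=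
    (Equiv.prodComm (Fin N) ℕ).summable_iff.2 hf
  rw [← (Equiv.prodComm (Fin N) ℕ).tsum_eq, h.tsum_prod'
    fun j => hf.comp_injective (Prod.mk_left_injective j), tsum_fintype]
  rfl

lemma sum_transitionMatrix (i : Fin N) : ∑ j, transitionMatrix κ i j = 1 := by
  rw [← tsum_toReal (κ i), tsum_prod_fin (summable_toReal (κ i))]
  rfl

lemma Agf_one (i j : Fin N) : Agf κ i j 1 = transitionMatrix κ i j := genFun_one

lemma norm_Agf_le (i j : Fin N) {z : ℂ} (hz : ‖z‖ ≤ 1) : ‖Agf κ i j z‖ ≤ transitionMatrix κ i j :=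
  norm_genFun_le (fun _ => ENNReal.toReal_nonneg) (summable_kernel κ i j) hz

lemma Bgf_one (β : PMF ℕ) : Bgf β 1 = 1 := by
  rw [Bgf_eq_genFun, genFun_one, tsum_toReal, Complex.ofReal_one]

end Input

end

end SMQueue

namespace SMQueue

noncomputable section

/-! ### Irreducible stochastic matrices -/

section Stochastic

/-- Maximum principle: at a maximiser `m` of `u` the inequality reads `u m ≤ t * u m`. -/
lemma eq_zero_of_le_mul_sum {n : Type*} [Fintype n] {P : Matrix n n ℝ} (hP : ∀ i j, 0 ≤ P i j)
    (hrow : ∀ i, ∑ j, P i j ≤ 1) {t : ℝ}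
    (ht0 : 0 ≤ t) (ht : t < 1) {u : n → ℝ} (hu0 : ∀ i, 0 ≤ u i)
    (hu : ∀ i, u i ≤ t * ∑ j, P i j * u j) (i : n) : u i = 0 := by
  have : Nonempty n := ⟨i⟩
  obtain ⟨m, hm⟩ := Finite.exists_max u
  have h1 : u m ≤ t * u m := by
    refine (hu m).trans (mul_le_mul_of_nonneg_left ?_ ht0)
    calc ∑ j, P m j * u j ≤ ∑ j, P m j * u m :=
          Finset.sum_le_sum fun j _ => mul_le_mul_of_nonneg_left (hm j) (hP m j)
      _ ≤ u m := by
          rw [← Finset.sum_mul]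
          exact mul_le_of_le_one_left (hu0 m) (hrow m)
  have h2 : u m = 0 := le_antisymm (by nlinarith [hu0 m]) (hu0 m)
  exact le_antisymm ((hm i).trans h2.le) (hu0 i)

variable {n : Type*} [Fintype n] [DecidableEq n] {P : Matrix n n ℝ}

lemma pow_mulVec_one (hrow : ∀ i, ∑ j, P i j = 1) (k : ℕ) (i : n) : ∑ j, (P ^ k) i j = 1 := by
  have h1 : P *ᵥ 1 = 1 := by ext i; simp [Matrix.mulVec, dotProduct, hrow]
  have : (P ^ k) *ᵥ 1 = 1 := by
    induction k with
    | zero => simp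
    | succ k ih => rw [pow_succ, ← Matrix.mulVec_mulVec, h1, ih]
  simpa [Matrix.mulVec, dotProduct] using congrFun this i

/-- A bounded subharmonic function of a finite irreducible Markov chain is constant. -/
lemma subharmonic_const (hP : P.IsIrreducible) (hrow : ∀ i, ∑ j, P i j = 1) {u : n → ℝ}
    (hu : ∀ i, u i ≤ ∑ j, P i j * u j) (i j : n) : u i = u j := by
  have hpow : ∀ k i, u i ≤ ∑ j, (P ^ k) i j * u j := by
    intro k
    induction k with
    | zero => intro i; simp [Matrix.one_apply]
    | succ k ih =>
      intro i
      refine (ih i).trans ?_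
      have h0 := Matrix.pow_apply_nonneg hP.nonneg k
      calc ∑ j, (P ^ k) i j * u j ≤ ∑ j, (P ^ k) i j * ∑ l, P j l * u l :=
            Finset.sum_le_sum fun j _ => mul_le_mul_of_nonneg_left (hu j) (h0 i j)
        _ = ∑ l, (P ^ (k + 1)) i l * u l := by
            simp only [pow_succ, Matrix.mul_apply, Finset.mul_sum, Finset.sum_mul]
            rw [Finset.sum_comm]
            simp only [mul_assoc]
  have : Nonempty n := ⟨i⟩
  obtain ⟨m, hm⟩ := Finite.exists_max u
  suffices H : ∀ l, u l = u m by rw [H i, H j]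
  intro l
  -- Some power of `P` charges `l` from the maximiser `m`; a deficit at `l` would pull the mean of
  -- `u` strictly below its maximum.
  obtain ⟨k, -, hk⟩ := (Matrix.isIrreducible_iff_exists_pow_pos hP.nonneg).1 hP m l
  refine le_antisymm (hm l) (le_of_not_gt fun hlt => ?_)
  have h0 := Matrix.pow_apply_nonneg hP.nonneg k
  have : ∑ j, (P ^ k) m j * u j < ∑ j, (P ^ k) m j * u m :=
    Finset.sum_lt_sum (fun j _ => mul_le_mul_of_nonneg_left (hm j) (h0 m j))
      ⟨l, Finset.mem_univ _, mul_lt_mul_of_pos_left hlt hk⟩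
  rw [← Finset.sum_mul, pow_mulVec_one hrow, one_mul] at this
  exact (hpow k m).not_gt this

lemma const_of_mulVec_eq (hP : P.IsIrreducible) (hrow : ∀ i, ∑ j, P i j = 1) {v : n → ℝ}
    (hv : P *ᵥ v = v) (i j : n) : v i = v j :=
  subharmonic_const hP hrow (fun i => (congrFun hv i).ge) i j

variable {π : n → ℝ}

lemma mulVec_sub_dotProduct (hπ : π ᵥ* P = π) (v : n → ℝ) : π ⬝ᵥ ((1 - P) *ᵥ v) = 0 := by
  rw [Matrix.dotProduct_mulVec, Matrix.vecMul_sub, hπ, Matrix.vecMul_one, sub_self,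
    zero_dotProduct]

/-- A constant vector in the range of `1 - P` is zero, and its preimage is constant. -/
lemma const_of_sub_mulVec_eq_const (hP : P.IsIrreducible) (hrow : ∀ i, ∑ j, P i j = 1)
    (hπ : π ᵥ* P = π) (hπ1 : ∑ i, π i = 1) {v : n → ℝ} {c : ℝ}
    (hv : (1 - P) *ᵥ v = fun _ => c) : c = 0 ∧ ∀ i j, v i = v j := by
  have hc : c = 0 := by
    have := mulVec_sub_dotProduct hπ v
    rw [hv] at this
    simpa [dotProduct, ← Finset.sum_mul, hπ1] using this
  refine ⟨hc, const_of_mulVec_eq hP hrow ?_⟩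
  have : v - P *ᵥ v = 0 := by
    rw [← Matrix.one_mulVec v, Matrix.mulVec_mulVec, mul_one, ← Matrix.sub_mulVec, hv, hc]
    rfl
  exact (sub_eq_zero.1 this).symm

/-- The rank one perturbation `1 - P + 𝟙 𝟙ᵀ` of the singular matrix `1 - P` is invertible. -/
lemma det_sub_add_ones_ne_zero (hP : P.IsIrreducible) (hrow : ∀ i, ∑ j, P i j = 1)
    (hπ : π ᵥ* P = π) (hπ1 : ∑ i, π i = 1) : (1 - P + Matrix.of fun _ _ => 1).det ≠ 0 := by
  intro h
  obtain ⟨v, hv0, hv⟩ := Matrix.exists_mulVec_eq_zero_iff.2 h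
  have h1 : (1 - P) *ᵥ v = fun _ => -∑ j, v j := by
    rw [Matrix.add_mulVec, add_eq_zero_iff_eq_neg] at hv
    rw [hv]
    ext i
    simp [Matrix.mulVec, dotProduct]
  obtain ⟨hs, hc⟩ := const_of_sub_mulVec_eq_const hP hrow hπ hπ1 h1
  apply hv0
  ext i
  have : ∑ j, v j = Fintype.card n * v i := by
    rw [Finset.sum_congr rfl fun j _ => hc j i]; simp
  rw [neg_eq_zero, this, mul_eq_zero] at hs
  have : Nonempty n := ⟨i⟩
  simpa using hs

/-- Subtracting `(∑ w) π` leaves an invariant vector of total mass zero. It is killed by `1 - P` and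
by the matrix of ones, hence by their invertible sum. -/
lemma eq_smul_of_vecMul_eq (hP : P.IsIrreducible) (hrow : ∀ i, ∑ j, P i j = 1)
    (hπ : π ᵥ* P = π) (hπ1 : ∑ i, π i = 1) {w : n → ℝ} (hw : w ᵥ* P = w) (j : n) :
    w j = (∑ i, w i) * π j := by
  set w₀ : n → ℝ := w - (∑ i, w i) • π
  have h1 : w₀ ᵥ* (1 - P + Matrix.of fun _ _ => 1) = 0 := by
    have h2 : w₀ ᵥ* P = w₀ := by rw [Matrix.sub_vecMul, Matrix.smul_vecMul, hw, hπ]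
    rw [Matrix.vecMul_add, Matrix.vecMul_sub, h2, Matrix.vecMul_one, sub_self, zero_add]
    ext i
    simp [Matrix.vecMul, dotProduct, w₀, ← Finset.mul_sum, hπ1]
  have h2 := Matrix.eq_zero_of_vecMul_eq_zero (det_sub_add_ones_ne_zero hP hrow hπ hπ1) h1
  have := congrFun h2 j
  simpa [w₀, sub_eq_zero] using this

/-- Solvability of the Poisson equation. -/
lemma exists_poisson (hP : P.IsIrreducible) (hrow : ∀ i, ∑ j, P i j = 1)
    (hπ : π ᵥ* P = π) (hπ1 : ∑ i, π i = 1) {r : n → ℝ} (hr : π ⬝ᵥ r = 0) :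
    ∃ h : n → ℝ, (∀ i, 0 ≤ h i) ∧ ∀ i, h i = ∑ j, P i j * h j + r i := by
  set K : Matrix n n ℝ := 1 - P + Matrix.of fun _ _ => 1
  have hK : IsUnit K.det := (det_sub_add_ones_ne_zero hP hrow hπ hπ1).isUnit
  set g := K⁻¹ *ᵥ r
  have hg : K *ᵥ g = r := by
    rw [Matrix.mulVec_mulVec, Matrix.mul_nonsing_inv _ hK, Matrix.one_mulVec]
  have hsum : (Matrix.of fun _ _ => (1 : ℝ) : Matrix n n ℝ) *ᵥ g = fun _ => ∑ j, g j := by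
    ext i; simp [Matrix.mulVec, dotProduct]
  -- Pairing `K g = r` with `π` removes the `1 - P` part; so the rank one term of `K` does not act
  -- on `g`, and `g` solves the equation itself.
  have h0 : ∑ j, g j = 0 := by
    have h1 : π ⬝ᵥ (K *ᵥ g) = ∑ j, g j := by
      rw [Matrix.add_mulVec, dotProduct_add, mulVec_sub_dotProduct hπ, zero_add, hsum]
      simp [dotProduct, ← Finset.sum_mul, hπ1]
    rw [← h1, hg, hr]
  have hg' : ∀ i, g i = ∑ j, P i j * g j + r i := by
    intro i
    have h1 := congrFun hg i
    rw [Matrix.add_mulVec, hsum, h0, Matrix.sub_mulVec, Matrix.one_mulVec] at h1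
    simp only [Pi.add_apply, Pi.sub_apply, Matrix.mulVec, dotProduct] at h1
    linarith
  -- Adding a constant preserves the equation, since the rows of `P` sum to `1`, and makes the
  -- solution nonnegative.
  refine ⟨fun i => g i + ∑ l, |g l|, fun i => ?_, fun i => ?_⟩
  · have := Finset.single_le_sum (fun l _ => abs_nonneg (g l)) (Finset.mem_univ i)
    have := neg_abs_le (g i)
    linarith
  · simp only [mul_add, Finset.sum_add_distrib, ← Finset.sum_mul, hrow]
    rw [hg' i]
    ring

/-- A continuous function on `[0, 1]` without zeros keeps its sign. -/
lemma pos_of_ne_zero_of_pos {g : ℝ → ℝ} {b : ℝ} (hg : ContinuousOn g (Set.Icc 0 b))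
    (hb : 0 ≤ b) (h0 : 0 < g 0) (hne : ∀ t ∈ Set.Icc 0 b, g t ≠ 0) : 0 < g b := by
  by_contra! h
  obtain ⟨t, ht, ht0⟩ := intermediate_value_Icc' hb hg ⟨h, h0.le⟩
  exact hne t ht ht0

lemma eq_zero_of_sub_smul_mulVec_eq_zero (hP : ∀ i j, 0 ≤ P i j) (hrow : ∀ i, ∑ j, P i j = 1)
    {t : ℝ} (ht0 : 0 ≤ t) (ht : t < 1) {v : n → ℝ} (hv : (1 - t • P) *ᵥ v = 0) : v = 0 := by
  rw [Matrix.sub_mulVec, Matrix.one_mulVec, sub_eq_zero, Matrix.smul_mulVec] at hv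
  have h := eq_zero_of_le_mul_sum hP (fun i => (hrow i).le) ht0 ht (u := fun i => |v i|)
    (fun i => abs_nonneg _) fun i => ?_
  · ext i
    exact abs_eq_zero.1 (h i)
  · have : v i = t * ∑ j, P i j * v j := congrFun hv i
    rw [this, abs_mul, abs_of_nonneg ht0]
    refine mul_le_mul_of_nonneg_left ((Finset.abs_sum_le_sum_abs _ _).trans
      (Finset.sum_le_sum fun j _ => ?_)) ht0
    rw [abs_mul, abs_of_nonneg (hP i j)]

/-- The determinant is `1` at parameter `0` and has no zero up to `t < 1`, where `t P` is a strict
contraction in the maximum norm. -/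
lemma det_sub_smul_pos (hP : ∀ i j, 0 ≤ P i j) (hrow : ∀ i, ∑ j, P i j = 1)
    {t : ℝ} (ht0 : 0 ≤ t) (ht : t < 1) : 0 < (1 - t • P).det := by
  refine pos_of_ne_zero_of_pos (g := fun t => (1 - t • P).det)
    (by fun_prop) ht0 (by simp) fun s hs h => ?_
  obtain ⟨v, hv0, hv⟩ := Matrix.exists_mulVec_eq_zero_iff.2 h
  exact hv0 (eq_zero_of_sub_smul_mulVec_eq_zero hP hrow hs.1 (hs.2.trans_lt ht) hv)

/-- Lets a null vector of the modified matrix be read as a solution of `A y = -x_i b` with `y_i =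
0`. -/
lemma updateCol_mulVec (A : Matrix n n ℝ) (i : n) (b x : n → ℝ) :
    A.updateCol i b *ᵥ x = A *ᵥ (Function.update x i 0) + x i • b := by
  ext l
  have h : ∀ j, A.updateCol i b l j * x j =
      A l j * Function.update x i 0 j + if j = i then x i * b l else 0 := by
    intro j
    rcases eq_or_ne j i with rfl | hj
    · simp [mul_comm]
    · simp [hj]
  simp [Matrix.mulVec, dotProduct, h, Finset.sum_add_distrib]

/-- Replacing a column of `1 - P` by the vector `𝟙` yields a matrix of positive determinant. -/
lemma det_updateCol_pos (hP : P.IsIrreducible) (hrow : ∀ i, ∑ j, P i j = 1)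
    (hπ : π ᵥ* P = π) (hπ1 : ∑ i, π i = 1) (i : n) : 0 < ((1 - P).updateCol i 1).det := by
  -- Deform from `t = 0`, where the determinant is `1`. It must be nonzero on all of `[0, 1]`, the
  -- endpoint `t = 1` included.
  have := pos_of_ne_zero_of_pos (g := fun t : ℝ => ((1 - t • P).updateCol i 1).det) (b := 1)
    (by fun_prop) zero_le_one ?_ ?_
  · simpa using this
  · simp only [zero_smul, sub_zero]
    rw [← Matrix.cramer_apply, Matrix.cramer_one]
    simp
  · intro t ht h
    obtain ⟨x, hx0, hx⟩ := Matrix.exists_mulVec_eq_zero_iff.2 h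
    rw [updateCol_mulVec] at hx
    set y := Function.update x i 0
    have hyi : y i = 0 := by simp [y]
    suffices H : y = 0 ∧ x i = 0 by
      apply hx0
      rw [← Function.update_eq_self i x, H.2]
      exact H.1
    rcases eq_or_lt_of_le ht.2 with rfl | ht1
    · rw [one_smul] at hx
      obtain ⟨hc, hy⟩ := const_of_sub_mulVec_eq_const hP hrow hπ hπ1 (v := y) (c := -x i) (by
        rw [eq_neg_of_add_eq_zero_left hx]; ext l; simp)
      exact ⟨funext fun l => (hy l i).trans hyi, neg_eq_zero.1 hc⟩
    -- Since `(1 - t P) 𝟙 = (1 - t) 𝟙`, a constant shift absorbs the extra column. The kernel is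
    -- trivial, and coordinate `i`, where `y` vanishes, then yields `x i = 0`.
    · have h1 : (1 - t • P) *ᵥ (y + (x i / (1 - t)) • 1) = 0 := by
        rw [Matrix.mulVec_add, Matrix.mulVec_smul, ← hx]
        congr 1
        have h2 : (1 - t • P) *ᵥ (1 : n → ℝ) = (1 - t) • 1 := by
          ext l
          rw [Matrix.sub_mulVec, Matrix.one_mulVec, Matrix.smul_mulVec]
          simp [Matrix.mulVec, dotProduct, hrow]
        rw [h2, smul_smul, div_mul_cancel₀ _ (by linarith)]
      have h2 := eq_zero_of_sub_smul_mulVec_eq_zero hP.nonneg hrow ht.1 ht1 h1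
      have h3 : x i / (1 - t) = 0 := by simpa [hyi] using congrFun h2 i
      rw [h3, zero_smul, add_zero] at h2
      refine ⟨h2, ?_⟩
      rcases div_eq_zero_iff.1 h3 with h | h
      · exact h
      · linarith

lemma det_one_sub_eq_zero [Nonempty n] (hrow : ∀ i, ∑ j, P i j = 1) : (1 - P).det = 0 := by
  refine Matrix.exists_mulVec_eq_zero_iff.1 ⟨1, one_ne_zero, ?_⟩
  ext i
  rw [Matrix.sub_mulVec, Matrix.one_mulVec]
  simp [Matrix.mulVec, dotProduct, hrow]

/-- The adjugate of `1 - P` is a positive multiple of `𝟙 πᵀ`. -/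
lemma exists_adjugate_eq [Nonempty n] (hP : P.IsIrreducible) (hrow : ∀ i, ∑ j, P i j = 1)
    (hπ : π ᵥ* P = π) (hπ1 : ∑ i, π i = 1) :
    ∃ a : ℝ, 0 < a ∧ ∀ i j, (1 - P).adjugate i j = a * π j := by
  set C := (1 - P).adjugate
  have hdet := det_one_sub_eq_zero hrow
  -- By Cramer's rule the row sums of the adjugate are the determinants with one column replaced by
  -- `𝟙`.
  have hsum : ∀ i, 0 < ∑ j, C i j := fun i => by
    have := det_updateCol_pos hP hrow hπ hπ1 i
    rw [← Matrix.cramer_apply, Matrix.cramer_eq_adjugate_mulVec] at this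
    simpa [Matrix.mulVec, dotProduct] using this
  -- As `det (1 - P) = 0`, the adjugate is annihilated by `1 - P` on both sides: its rows are
  -- invariant, its columns harmonic.
  have hrowC : ∀ i j, C i j = (∑ l, C i l) * π j := fun i =>
    eq_smul_of_vecMul_eq hP hrow hπ hπ1 <| by
      have h := Matrix.adjugate_mul (1 - P)
      rw [hdet, zero_smul, mul_sub, mul_one, sub_eq_zero] at h
      ext j
      exact (congrFun (congrFun h i) j).symm
  have hcolC : ∀ j i i', C i j = C i' j := fun j =>
    const_of_mulVec_eq hP hrow (v := fun i => C i j) <| by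
      have h := Matrix.mul_adjugate (1 - P)
      rw [hdet, zero_smul, sub_mul, one_mul, sub_eq_zero] at h
      ext i
      exact (congrFun (congrFun h i) j).symm
  obtain ⟨i₀⟩ := ‹Nonempty n›
  exact ⟨∑ l, C i₀ l, hsum i₀, fun i j => by rw [hcolC j i i₀, ← hrowC]⟩

end Stochastic

end

end SMQueue

namespace SMQueue

noncomputable section

/-! ### Counting zeros of analytic functions -/

/-- The zeros of `f` in the open disc of radius `r` about `0`. -/
def zerosIn (f : ℂ → ℂ) (r : ℝ) : Set ℂ := {z | ‖z‖ < r ∧ f z = 0}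

/-- The number of zeros of `f` in the open disc of radius `r`, counted with multiplicity. -/
def zeroCount (f : ℂ → ℂ) (r : ℝ) : ℕ := ∑ᶠ ζ ∈ zerosIn f r, analyticOrderNatAt f ζ

/-- The disc is connected, so non-vanishing at the single boundary point `r` excludes infinite order
everywhere. -/
lemma AnalyticOnNhd.order_ne_top {f : ℂ → ℂ} {r : ℝ} (hr : 0 < r)
    (hf : AnalyticOnNhd ℂ f (Metric.closedBall 0 r)) (h0 : ∀ z : ℂ, ‖z‖ = r → f z ≠ 0)
    {z : ℂ} (hz : ‖z‖ ≤ r) : analyticOrderAt f z ≠ ⊤ := by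
  have hr' : ‖(r : ℂ)‖ = r := by simp [abs_of_pos hr]
  refine hf.analyticOrderAt_ne_top_of_isPreconnected (x := (r : ℂ))
    (convex_closedBall 0 r).isPreconnected (by simp [abs_of_pos hr]) (by simpa using hz) ?_
  have := (hf r (by simp [abs_of_pos hr])).analyticOrderAt_eq_zero.2 (h0 _ hr')
  simp [this]

/-- Infinitely many zeros would accumulate in the compact closed disc and force infinite order at
the accumulation point. -/
lemma finite_zerosIn {f : ℂ → ℂ} {r : ℝ} (hr : 0 < r)
    (hf : AnalyticOnNhd ℂ f (Metric.closedBall 0 r)) (h0 : ∀ z : ℂ, ‖z‖ = r → f z ≠ 0) :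
    (zerosIn f r).Finite := by
  by_contra hinf
  obtain ⟨z, hz, hacc⟩ := Set.Infinite.exists_accPt_of_subset_isCompact hinf
    (isCompact_closedBall (0 : ℂ) r) (fun z hz => by simpa using hz.1.le)
  refine AnalyticOnNhd.order_ne_top hr hf h0 (mem_closedBall_zero_iff.1 hz) ?_
  rw [analyticOrderAt_eq_top, ← (hf z hz).frequently_zero_iff_eventually_zero]
  rw [accPt_iff_frequently_nhdsNE] at hacc
  exact hacc.mono fun w hw => hw.2

/-- Division of an analytic function by the full power of `z - ζ` at a zero `ζ`. -/
lemma exists_eq_pow_mul {f : ℂ → ℂ} {s : Set ℂ} (hf : AnalyticOnNhd ℂ f s) {ζ : ℂ} (hζ : ζ ∈ s)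
    (htop : analyticOrderAt f ζ ≠ ⊤) :
    ∃ g : ℂ → ℂ, AnalyticOnNhd ℂ g s ∧ g ζ ≠ 0 ∧
      ∀ z, f z = (z - ζ) ^ analyticOrderNatAt f ζ * g z := by
  obtain ⟨g₀, hg₀, hg₀ζ, hfg⟩ := (hf ζ hζ).analyticOrderAt_ne_top.1 htop
  set m := analyticOrderNatAt f ζ
  -- The quotient is singular only at `ζ`; the value of the local factor `g₀` fills the removable
  -- singularity.
  refine ⟨Function.update (fun z => f z / (z - ζ) ^ m) ζ (g₀ ζ), fun z hz => ?_, by simpa, ?_⟩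
  · rcases eq_or_ne z ζ with rfl | hne
    · refine hg₀.congr ?_
      filter_upwards [hfg] with w hw
      rcases eq_or_ne w z with rfl | hwz
      · simp
      · have : (w - z) ^ m ≠ 0 := pow_ne_zero _ (sub_ne_zero.2 hwz)
        simp only [Function.update_of_ne hwz, hw, smul_eq_mul]
        field_simp
    · have h1 : AnalyticAt ℂ (fun z => f z / (z - ζ) ^ m) z :=
        (hf z hz).div (by fun_prop) (pow_ne_zero _ (sub_ne_zero.2 hne))
      refine h1.congr ?_
      filter_upwards [isOpen_ne.mem_nhds hne] with w hw
      rw [Function.update_of_ne hw]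
  · intro z
    rcases eq_or_ne z ζ with rfl | hne
    · simpa using hfg.self_of_nhds
    · have : (z - ζ) ^ m ≠ 0 := pow_ne_zero _ (sub_ne_zero.2 hne)
      rw [Function.update_of_ne hne]
      field_simp

lemma circleIntegral_logDeriv_of_ne_zero {f : ℂ → ℂ} {r : ℝ} (hr : 0 < r)
    (hf : AnalyticOnNhd ℂ f (Metric.closedBall 0 r)) (h0 : ∀ z : ℂ, ‖z‖ ≤ r → f z ≠ 0) :
    (∮ z in C(0, r), deriv f z / f z) = 0 := by
  have han : AnalyticOnNhd ℂ (fun z => deriv f z / f z) (Metric.closedBall 0 r) :=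
    fun z hz => (hf z hz).deriv.div (hf z hz) (h0 z (by simpa using hz))
  exact Complex.circleIntegral_eq_zero_of_differentiable_on_off_countable hr.le
    Set.countable_empty han.continuousOn
    fun z hz => (han z (Metric.ball_subset_closedBall hz.1)).differentiableAt

/-- The **argument principle** on a disc. -/
theorem circleIntegral_logDeriv_eq {r : ℝ} (hr : 0 < r) {f : ℂ → ℂ}
    (hf : AnalyticOnNhd ℂ f (Metric.closedBall 0 r)) (h0 : ∀ z : ℂ, ‖z‖ = r → f z ≠ 0) :
    (∮ z in C(0, r), deriv f z / f z) = 2 * Real.pi * Complex.I * zeroCount f r := by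
  obtain ⟨S, hS⟩ := (finite_zerosIn hr hf h0).exists_finset_coe
  -- Each step divides out one zero with its full multiplicity `m`, which contributes `m / (z - ζ)`
  -- to the logarithmic derivative.
  induction S using Finset.induction_on generalizing f with
  | empty =>
    have hne : ∀ z : ℂ, ‖z‖ ≤ r → f z ≠ 0 := by
      intro z hz hfz
      rcases hz.eq_or_lt with h | h
      · exact h0 z h hfz
      · have : z ∈ zerosIn f r := ⟨h, hfz⟩
        rw [← hS] at this
        simp at this
    rw [circleIntegral_logDeriv_of_ne_zero hr hf hne, zeroCount, ← hS]
    simp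
  | insert ζ S hζS ih =>
    have hζ : ζ ∈ zerosIn f r := by rw [← hS]; simp
    have hζr : ζ ∈ Metric.closedBall (0 : ℂ) r := by simpa using hζ.1.le
    obtain ⟨g, hg, hgζ, hfg⟩ := exists_eq_pow_mul hf hζr
      (AnalyticOnNhd.order_ne_top hr hf h0 hζ.1.le)
    set m := analyticOrderNatAt f ζ
    have hm : m ≠ 0 := by
      intro hm0
      have := hfg ζ
      rw [hm0, pow_zero, one_mul, hζ.2] at this
      exact hgζ this.symm
    have hg0 : ∀ z : ℂ, ‖z‖ = r → g z ≠ 0 := fun z hz hgz => h0 z hz (by rw [hfg, hgz, mul_zero])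
    have hzeros : (S : Set ℂ) = zerosIn g r := by
      ext z
      have h1 : z ∈ zerosIn f r ↔ z = ζ ∨ z ∈ S := by rw [← hS]; simp
      rcases eq_or_ne z ζ with rfl | hne
      · simp [hζS, zerosIn, hgζ]
      · have h2 : z ∈ zerosIn f r ↔ z ∈ zerosIn g r := by
          simp [zerosIn, hfg, sub_eq_zero, hne]
        rw [← h2, h1]
        simp [hne]
    have hord : ∀ z ∈ S, analyticOrderNatAt f z = analyticOrderNatAt g z := by
      intro z hz
      have hzg : z ∈ zerosIn g r := by rw [← hzeros]; exact hz
      have hne : z ≠ ζ := fun h => hζS (h ▸ hz)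
      have hzr : z ∈ Metric.closedBall (0 : ℂ) r := by simpa using hzg.1.le
      have hpow : AnalyticAt ℂ (fun w : ℂ => (w - ζ) ^ m) z := by fun_prop
      have : f = (fun w => (w - ζ) ^ m) * g := funext hfg
      rw [analyticOrderNatAt, this, analyticOrderAt_mul hpow (hg z hzr),
        hpow.analyticOrderAt_eq_zero.2 (pow_ne_zero _ (sub_ne_zero.2 hne)), zero_add]
      rfl
    have hcount : zeroCount f r = m + zeroCount g r := by
      rw [zeroCount, zeroCount, ← hS, ← hzeros, finsum_mem_coe_finset, finsum_mem_coe_finset,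
        Finset.sum_insert hζS, Finset.sum_congr rfl hord]
    have hint : (∮ z in C(0, r), deriv f z / f z) =
        ∮ z in C(0, r), ((m : ℂ) * (z - ζ)⁻¹ + deriv g z / g z) := by
      refine circleIntegral.integral_congr hr.le fun z hz => ?_
      have hzr : ‖z‖ = r := by simpa using hz
      have hne : z - ζ ≠ 0 := by
        intro h
        rw [sub_eq_zero] at h
        exact hζ.1.ne (h ▸ hzr)
      have hgz := hg0 z hzr
      have hd : HasDerivAt f (m * (z - ζ) ^ (m - 1) * g z + (z - ζ) ^ m * deriv g z) z := by
        have h1 := (((hasDerivAt_id z).sub_const ζ).pow m).mul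
          (hg z (by simpa using hzr.le)).differentiableAt.hasDerivAt
        rw [show f = (fun w => (w - ζ) ^ m) * g from funext hfg]
        simpa using! h1
      simp only [hd.deriv, hfg z]
      obtain ⟨k, hk⟩ := Nat.exists_eq_succ_of_ne_zero hm
      rw [hk, Nat.succ_sub_one, pow_succ]
      field_simp
    have hcont : ContinuousOn (fun z => deriv g z / g z) (Metric.sphere 0 r) := fun z hz =>
      ((hg z (Metric.sphere_subset_closedBall hz)).deriv.div
        (hg z (Metric.sphere_subset_closedBall hz)) (hg0 z (by simpa using hz))).continuousAt
        |>.continuousWithinAt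
    have hcont' : ContinuousOn (fun z : ℂ => (m : ℂ) * (z - ζ)⁻¹) (Metric.sphere 0 r) := by
      refine continuousOn_const.mul (ContinuousOn.inv₀ (by fun_prop) fun z hz h => ?_)
      rw [sub_eq_zero] at h
      exact hζ.1.ne (h ▸ (by simpa using hz))
    rw [hint, circleIntegral.integral_add (hcont'.circleIntegrable hr.le)
      (hcont.circleIntegrable hr.le), circleIntegral.integral_const_mul,
      circleIntegral.integral_sub_inv_of_mem_ball (by simpa using hζ.1), ih hg hg0 hzeros, hcount]
    push_cast
    ring

/-- The number of zeros in a disc is constant along a homotopy without zeros on the circle. -/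
theorem zeroCount_eq_of_homotopy {r : ℝ} (hr : 0 < r) {F F' : ℝ → ℂ → ℂ} {a b : ℝ} (hab : a ≤ b)
    (hF : ∀ t, AnalyticOnNhd ℂ (F t) (Metric.closedBall 0 r))
    (hF' : ∀ t z, ‖z‖ = r → HasDerivAt (F t) (F' t z) z)
    (hc : Continuous fun p : ℝ × ℝ => F p.1 (circleMap 0 r p.2))
    (hc' : Continuous fun p : ℝ × ℝ => F' p.1 (circleMap 0 r p.2))
    (h0 : ∀ t ∈ Set.Icc a b, ∀ z : ℂ, ‖z‖ = r → F t z ≠ 0) :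
    zeroCount (F a) r = zeroCount (F b) r := by
  have hnorm : ∀ θ, ‖circleMap 0 r θ‖ = r := fun θ => by simp [abs_of_pos hr]
  -- Projecting `t` to `[a, b]` keeps the denominator nonzero for every real `t`, so that the
  -- integral is continuous on the whole line.
  set I : ℝ → ℂ := fun t => ∫ θ in (0 : ℝ)..2 * Real.pi,
    deriv (circleMap 0 r) θ • (F' (Set.projIcc a b hab t) (circleMap 0 r θ) /
      F (Set.projIcc a b hab t) (circleMap 0 r θ)) with hI
  have hIcont : Continuous I := by
    refine intervalIntegral.continuous_parametric_intervalIntegral_of_continuous' ?_ _ _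
    have hp : Continuous fun p : ℝ × ℝ => ((Set.projIcc a b hab p.1 : ℝ), p.2) := by fun_prop
    have hd : Continuous fun p : ℝ × ℝ => deriv (circleMap 0 r) p.2 := by
      simp only [deriv_circleMap]; fun_prop
    exact hd.smul ((hc'.comp hp).div (hc.comp hp) fun p => h0 _ (Subtype.prop _) _ (hnorm _))
  have hIeq : ∀ t ∈ Set.Icc a b, I t = 2 * Real.pi * Complex.I * zeroCount (F t) r := by
    intro t ht
    rw [← circleIntegral_logDeriv_eq hr (hF t) (h0 t ht), circleIntegral, hI]
    simp only [Set.projIcc_of_mem hab ht]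
    refine intervalIntegral.integral_congr fun θ _ => ?_
    simp only [(hF' t _ (hnorm θ)).deriv]
  have h2 : (2 * Real.pi * Complex.I : ℂ) ≠ 0 := Complex.two_pi_I_ne_zero
  have hcont : ContinuousOn (fun t => ((zeroCount (F t) r : ℝ))) (Set.Icc a b) := by
    have h3 : Continuous fun t => (I t / (2 * Real.pi * Complex.I)).re :=
      Complex.continuous_re.comp (hIcont.div_const _)
    refine h3.continuousOn.congr fun t ht => ?_
    simp only [hIeq t ht, mul_div_cancel_left₀ _ h2, Complex.natCast_re]
  -- The count is continuous into the discrete space `ℕ`, hence constant on an interval.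
  have h4 : ContinuousOn (fun t => zeroCount (F t) r) (Set.Icc a b) :=
    Nat.isClosedEmbedding_coe_real.isEmbedding.isInducing.continuousOn_iff.2 hcont
  exact isPreconnected_Icc.constant h4 (Set.left_mem_Icc.2 hab) (Set.right_mem_Icc.2 hab)

end

end SMQueue

namespace SMQueue

noncomputable section

/-! ### The family `det (z - t A(z))` -/

section Family

variable {N : ℕ} (κ : Fin N → PMF (ℕ × Fin N))

/-- The matrix `A(z)`. -/
def Amat (z : ℂ) : Matrix (Fin N) (Fin N) ℂ := Matrix.of fun i j => Agf κ i j z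

/-- The matrix `A'(z)`. -/
def AmatDeriv (z : ℂ) : Matrix (Fin N) (Fin N) ℂ :=
  Matrix.of fun i j => genFunDeriv (fun k => (κ i (k, j)).toReal) z

/-- The function `det (z - t A(z))`. -/
def detFam (t : ℝ) (z : ℂ) : ℂ := (z • (1 : Matrix (Fin N) (Fin N) ℂ) - (t : ℂ) • Amat κ z).det

/-- The derivative of `det (z - t A(z))` in `z`. -/
def detFamDeriv (t : ℝ) (z : ℂ) : ℂ :=
  ∑ i, ((z • (1 : Matrix (Fin N) (Fin N) ℂ) - (t : ℂ) • Amat κ z).adjugate *ᵥ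
    fun l => ((1 : Matrix (Fin N) (Fin N) ℂ) - (t : ℂ) • AmatDeriv κ z) l i) i

lemma Mmat_eq (z : ℂ) : Mmat κ z = z • (1 : Matrix (Fin N) (Fin N) ℂ) - Amat κ z := by
  ext i j
  rcases eq_or_ne i j with rfl | h
  · simp [Mmat, Amat]
  · simp [Mmat, Amat, h]

lemma det_Mmat (z : ℂ) : (Mmat κ z).det = detFam κ 1 z := by
  rw [Mmat_eq, detFam, Complex.ofReal_one, one_smul]

/-- **Jacobi's formula** for the derivative of a determinant. -/
lemma hasDerivAt_det {n : Type*} [Fintype n] [DecidableEq n] {M : ℂ → Matrix n n ℂ}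
    {M' : Matrix n n ℂ} {z : ℂ} (h : ∀ i j, HasDerivAt (fun w => M w i j) (M' i j) z) :
    HasDerivAt (fun w => (M w).det) (∑ i, ((M z).adjugate *ᵥ fun l => M' l i) i) z := by
  have h1 : ∀ i, ((M z).adjugate *ᵥ fun l => M' l i) i =
      ∑ σ : Equiv.Perm n, ((Equiv.Perm.sign σ : ℤ) : ℂ) *
        ((∏ j ∈ Finset.univ.erase i, M z (σ j) j) * M' (σ i) i) := by
    intro i
    rw [← Matrix.cramer_eq_adjugate_mulVec, Matrix.cramer_apply, Matrix.det_apply']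
    refine Finset.sum_congr rfl fun σ _ => ?_
    rw [← Finset.prod_erase_mul _ _ (Finset.mem_univ i)]
    simp only [Matrix.updateCol_self]
    congr 2
    exact Finset.prod_congr rfl fun j hj => by rw [Matrix.updateCol_ne (Finset.ne_of_mem_erase hj)]
  simp only [Matrix.det_apply', h1]
  rw [Finset.sum_comm]
  refine HasDerivAt.fun_sum fun σ _ => ?_
  rw [← Finset.mul_sum]
  refine HasDerivAt.const_mul _ ?_
  have := HasDerivAt.fun_finsetProd (u := Finset.univ) (x := z)
    (f := fun j w => M w (σ j) j) (f' := fun j => M' (σ j) j) fun j _ => h (σ j) j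
  simpa [smul_eq_mul] using this

variable {κ}

lemma hasDerivAt_detFam (hα : ∀ i j, Summable fun k : ℕ => (k : ℝ) * (κ i (k, j)).toReal)
    (t : ℝ) {z : ℂ} (hz : ‖z‖ < 1) :
    HasDerivAt (detFam κ t) (detFamDeriv κ t z) z := by
  refine hasDerivAt_det fun i j => ?_
  have h1 := hasDerivAt_genFun (fun _ => ENNReal.toReal_nonneg) (summable_kernel κ i j) (hα i j) hz
  simpa [Amat, AmatDeriv, Agf_eq_genFun] using
    ((hasDerivAt_id z).mul_const ((1 : Matrix (Fin N) (Fin N) ℂ) i j)).fun_sub (h1.const_mul (t : ℂ))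

lemma analyticOnNhd_detFam (t : ℝ) : AnalyticOnNhd ℂ (detFam κ t) (Metric.ball 0 1) := by
  refine DifferentiableOn.analyticOnNhd ?_ Metric.isOpen_ball
  have h : ∀ i j, DifferentiableOn ℂ (Agf κ i j) (Metric.ball 0 1) := fun i j =>
    differentiableOn_genFun (fun _ => ENNReal.toReal_nonneg) (summable_kernel κ i j)
  unfold detFam
  simp only [Matrix.det_apply', Amat, Matrix.sub_apply, Matrix.smul_apply, Matrix.of_apply,
    smul_eq_mul]
  intro z hz
  exact DifferentiableWithinAt.fun_sum fun σ _ => (DifferentiableWithinAt.fun_finsetProd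
    fun i _ => ((differentiableWithinAt_id.mul_const _).sub
      ((h _ _ z hz).const_mul _))).const_mul _

lemma continuousOn_Amat : ContinuousOn (Amat κ) (Metric.closedBall 0 1) :=
  continuousOn_pi.2 fun i => continuousOn_pi.2 fun j =>
    continuousOn_genFun (fun _ => ENNReal.toReal_nonneg) (summable_kernel κ i j)

lemma continuousOn_AmatDeriv
    (hα : ∀ i j, Summable fun k : ℕ => (k : ℝ) * (κ i (k, j)).toReal) :
    ContinuousOn (AmatDeriv κ) (Metric.closedBall 0 1) :=
  continuousOn_pi.2 fun i => continuousOn_pi.2 fun j =>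
    continuousOn_genFunDeriv (fun _ => ENNReal.toReal_nonneg) (hα i j)

lemma continuousOn_detFam :
    ContinuousOn (fun p : ℝ × ℂ => detFam κ p.1 p.2) (Set.univ ×ˢ Metric.closedBall 0 1) := by
  have hA : ContinuousOn (fun p : ℝ × ℂ => Amat κ p.2) (Set.univ ×ˢ Metric.closedBall 0 1) :=
    continuousOn_Amat.comp continuousOn_snd fun p hp => hp.2
  have hdet : Continuous fun M : Matrix (Fin N) (Fin N) ℂ => M.det := by fun_prop
  exact hdet.comp_continuousOn (by fun_prop)

/-- The first moments enter here: they make the derivative extend continuously to the closed disc,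
although the derivative relation is proved only inside. -/
lemma continuousOn_detFamDeriv
    (hα : ∀ i j, Summable fun k : ℕ => (k : ℝ) * (κ i (k, j)).toReal) :
    ContinuousOn (fun p : ℝ × ℂ => detFamDeriv κ p.1 p.2)
      (Set.univ ×ˢ Metric.closedBall 0 1) := by
  have hA : ContinuousOn (fun p : ℝ × ℂ => Amat κ p.2) (Set.univ ×ˢ Metric.closedBall 0 1) :=
    continuousOn_Amat.comp continuousOn_snd fun p hp => hp.2
  have hA' : ContinuousOn (fun p : ℝ × ℂ => AmatDeriv κ p.2)
      (Set.univ ×ˢ Metric.closedBall 0 1) :=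
    (continuousOn_AmatDeriv hα).comp continuousOn_snd fun p hp => hp.2
  have hadj : Continuous fun M : Matrix (Fin N) (Fin N) ℂ × Matrix (Fin N) (Fin N) ℂ =>
      ∑ i, (M.1.adjugate *ᵥ fun l => M.2 l i) i := by
    simp only [Matrix.mulVec, dotProduct]
    fun_prop
  exact hadj.comp_continuousOn (f := fun p : ℝ × ℂ =>
    (p.2 • (1 : Matrix (Fin N) (Fin N) ℂ) - (p.1 : ℂ) • Amat κ p.2,
      (1 : Matrix (Fin N) (Fin N) ℂ) - (p.1 : ℂ) • AmatDeriv κ p.2)) (by fun_prop)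

lemma exists_eigenvector {t : ℝ} {z : ℂ} (h : detFam κ t z = 0) :
    ∃ v : Fin N → ℂ, v ≠ 0 ∧ ∀ i, z * v i = t * ∑ j, Agf κ i j z * v j := by
  obtain ⟨v, hv0, hv⟩ := Matrix.exists_mulVec_eq_zero_iff.2 h
  refine ⟨v, hv0, fun i => ?_⟩
  rw [Matrix.sub_mulVec, Matrix.smul_mulVec, Matrix.smul_mulVec, Matrix.one_mulVec,
    sub_eq_zero] at hv
  simpa [Matrix.mulVec, dotProduct, Amat] using congrFun hv i

/-- For `t = 1` and `|z| = 1` this makes the moduli subharmonic for `P`, hence constant; for `t <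
|z|` it makes them vanish. -/
lemma norm_eigenvector_le {t : ℝ} (ht : 0 ≤ t) {z : ℂ} (hz : ‖z‖ ≤ 1) {v : Fin N → ℂ}
    (hv : ∀ i, z * v i = t * ∑ j, Agf κ i j z * v j) (i : Fin N) :
    ‖z‖ * ‖v i‖ ≤ t * ∑ j, transitionMatrix κ i j * ‖v j‖ := by
  rw [← norm_mul, hv, norm_mul, Complex.norm_real, Real.norm_of_nonneg ht]
  refine mul_le_mul_of_nonneg_left ((norm_sum_le _ _).trans (Finset.sum_le_sum fun j _ => ?_)) ht
  rw [norm_mul]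
  exact mul_le_mul_of_nonneg_right (norm_Agf_le κ i j hz) (norm_nonneg _)

lemma detFam_ne_zero {t : ℝ} (ht : 0 ≤ t) {z : ℂ} (hz : ‖z‖ ≤ 1) (htz : t < ‖z‖) :
    detFam κ t z ≠ 0 := by
  intro h
  obtain ⟨v, hv0, hv⟩ := exists_eigenvector h
  have hz0 : 0 < ‖z‖ := ht.trans_lt htz
  refine hv0 (funext fun i => norm_eq_zero.1 ?_)
  refine eq_zero_of_le_mul_sum (P := transitionMatrix κ) (transitionMatrix_nonneg κ)
    (fun i => (sum_transitionMatrix κ i).le) (t := t / ‖z‖) (by positivity)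
    ((div_lt_one hz0).2 htz) (u := fun i => ‖v i‖) (fun i => norm_nonneg _) (fun i => ?_) i
  rw [div_mul_eq_mul_div, le_div_iff₀ hz0, mul_comm]
  exact norm_eigenvector_le ht hz hv i

/-- A weighted mean of vectors on a circle which lies on the circle is trivial. -/
lemma eq_of_mean_eq {α : Type*} {p : α → ℝ} (hp : ∀ s, 0 ≤ p s) (hp1 : HasSum p 1)
    {u : α → ℂ} {w : ℂ} (hu : ∀ s, ‖u s‖ = ‖w‖) (hw : HasSum (fun s => (p s : ℂ) * u s) w)
    {s : α} (hs : p s ≠ 0) : u s = w := by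
  have hre : ∀ s, ((starRingEnd ℂ) w * u s).re ≤ ‖w‖ ^ 2 := fun s => by
    refine (Complex.re_le_norm _).trans ?_
    rw [norm_mul, RCLike.norm_conj, hu s, sq]
  -- These nonnegative terms measure the loss in Cauchy-Schwarz; their sum is zero, so each one is.
  have h1 : HasSum (fun s => p s * (‖w‖ ^ 2 - ((starRingEnd ℂ) w * u s).re)) 0 := by
    have h2 := Complex.hasSum_re (hw.mul_left ((starRingEnd ℂ) w))
    have h3 := (hp1.mul_right (‖w‖ ^ 2)).sub h2
    have h4 : ((starRingEnd ℂ) w * w).re = ‖w‖ ^ 2 := by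
      rw [mul_comm, Complex.mul_conj, Complex.normSq_eq_norm_sq, Complex.ofReal_re]
    rw [h4, one_mul, sub_self] at h3
    refine h3.congr_fun fun s => ?_
    rw [mul_left_comm, Complex.re_ofReal_mul, mul_sub]
  rw [hasSum_zero_iff_of_nonneg fun s => mul_nonneg (hp s) (sub_nonneg.2 (hre s))] at h1
  have h5 : ‖w‖ ^ 2 - ((starRingEnd ℂ) w * u s).re = 0 :=
    (mul_eq_zero.1 (congrFun h1 s)).resolve_left hs
  have h6 : Complex.normSq (u s - w) = 0 := by
    rw [Complex.normSq_sub, Complex.normSq_eq_norm_sq, Complex.normSq_eq_norm_sq, hu s,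
      mul_comm (u s)]
    linarith
  exact sub_eq_zero.1 (Complex.normSq_eq_zero.1 h6)

/-- At a zero `ζ` of `det M` on the unit circle, `A(ζ z)` is diagonally similar to `ζ A(z)`. -/
lemma exists_diagonal_similarity (hirr : (transitionMatrix κ).IsIrreducible) {ζ : ℂ}
    (hζ : ‖ζ‖ = 1) (h : detFam κ 1 ζ = 0) :
    ∃ d : Fin N → ℂ, (∀ i, d i ≠ 0) ∧
      ∀ i j z, Agf κ i j (ζ * z) = ζ * (d i * Agf κ i j z * (d j)⁻¹) := by
  obtain ⟨v, hv0, hv⟩ := exists_eigenvector h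
  have hconst : ∀ i j, ‖v i‖ = ‖v j‖ :=
    subharmonic_const hirr (sum_transitionMatrix κ) fun i => by
      simpa [hζ] using norm_eigenvector_le zero_le_one hζ.le hv i
  have hne : ∀ i, v i ≠ 0 := fun i hi => hv0 <| funext fun j =>
    norm_eq_zero.1 (by rw [hconst j i, hi, norm_zero])
  -- Row `i` exhibits `ζ v_i` as a mean of the numbers `ζ^k v_j`, all of the same modulus, so they
  -- agree with it on the support of `κ i`. The similarity is then given by the eigenvector `v`
  -- itself.
  have hkey : ∀ i k j, (κ i (k, j)).toReal ≠ 0 → ζ ^ k * v j = ζ * v i := by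
    intro i k j hk
    have hsum : Summable fun s : ℕ × Fin N => ((κ i s).toReal : ℂ) * (ζ ^ s.1 * v s.2) := by
      refine .of_norm_bounded ((summable_toReal (κ i)).mul_right ‖v i‖) fun s => ?_
      rw [norm_mul, norm_mul, norm_pow, hζ, one_pow, one_mul, Complex.norm_real,
        Real.norm_of_nonneg ENNReal.toReal_nonneg, hconst s.2 i]
    refine eq_of_mean_eq (p := fun s => (κ i s).toReal) (u := fun s => ζ ^ s.1 * v s.2)
      (s := (k, j)) (fun s => ENNReal.toReal_nonneg) ?_ (fun s => ?_) ?_ hk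
    · exact tsum_toReal (κ i) ▸ (summable_toReal (κ i)).hasSum
    · simp [hζ, hconst s.2 i]
    · have := hsum.hasSum
      rw [tsum_prod_fin hsum] at this
      rw [hv i, Complex.ofReal_one, one_mul]
      convert this using 1
      refine Finset.sum_congr rfl fun j _ => ?_
      rw [Agf, ← tsum_mul_right]
      exact tsum_congr fun k => mul_assoc _ _ _
  refine ⟨v, hne, fun i j z => ?_⟩
  rw [Agf, Agf, ← tsum_mul_left, ← tsum_mul_right, ← tsum_mul_left]
  refine tsum_congr fun k => ?_
  by_cases hk : (κ i (k, j)).toReal = 0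
  · simp [hk]
  · have h1 := hkey i k j hk
    have hj := hne j
    rw [mul_pow]
    field_simp
    linear_combination (((κ i (k, j)).toReal : ℂ) * z ^ k) * h1

/-- The diagonal similarity cancels in the determinant and the scalar `ζ` contributes `ζ^N`. This
holds for every `t`, which transports the local analysis at `1` to every zero on the circle. -/
lemma detFam_mul (hirr : (transitionMatrix κ).IsIrreducible) {ζ : ℂ}
    (hζ : ‖ζ‖ = 1) (h : detFam κ 1 ζ = 0) (t : ℝ) (z : ℂ) :
    detFam κ t (ζ * z) = ζ ^ N * detFam κ t z := by
  obtain ⟨d, hd, hA⟩ := exists_diagonal_similarity hirr hζ h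
  have hmat : (ζ * z) • (1 : Matrix (Fin N) (Fin N) ℂ) - (t : ℂ) • Amat κ (ζ * z) =
      ζ • (Matrix.diagonal d * (z • (1 : Matrix (Fin N) (Fin N) ℂ) - (t : ℂ) • Amat κ z) *
        Matrix.diagonal fun i => (d i)⁻¹) := by
    ext i j
    have hi := hd i
    have hj := hd j
    rw [Matrix.smul_apply, Matrix.mul_diagonal, Matrix.diagonal_mul]
    simp only [Matrix.sub_apply, Matrix.smul_apply, Amat, Matrix.of_apply, hA, smul_eq_mul]
    rcases eq_or_ne i j with rfl | hij
    · simp only [Matrix.one_apply_eq]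
      field_simp
    · simp only [Matrix.one_apply_ne hij]
      ring
  have hprod : (∏ i, d i) * ∏ i, (d i)⁻¹ = 1 := by
    rw [← Finset.prod_mul_distrib]
    exact Finset.prod_eq_one fun i _ => mul_inv_cancel₀ (hd i)
  rw [detFam, hmat, Matrix.det_smul, Matrix.det_mul, Matrix.det_mul, Matrix.det_diagonal,
    Matrix.det_diagonal, Fintype.card_fin, detFam]
  linear_combination (ζ ^ N * (z • (1 : Matrix (Fin N) (Fin N) ℂ) - (t : ℂ) • Amat κ z).det) * hprod

end Family

end

end SMQueue

namespace SMQueue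

noncomputable section

/-! ### The number of zeros of `det M` in the closed disc -/

section Zeros

variable {N : ℕ} {κ : Fin N → PMF (ℕ × Fin N)}

lemma IsStationaryVector.vecMul {π : Fin N → ℝ} (hπ : IsStationaryVector κ π) :
    π ᵥ* transitionMatrix κ = π := funext fun j => (hπ.balance j).symm

lemma IsStationaryVector.nonempty {π : Fin N → ℝ} (hπ : IsStationaryVector κ π) :
    Nonempty (Fin N) := by
  by_contra h
  rw [not_nonempty_iff] at h
  have := hπ.sum_eq_one
  simp at this

/-- Jacobi's formula, with adjugate `a 𝟙 πᵀ`, gives `∑ a π_l (δ_li - α_li) = a (1 - ρ)`. Stability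
is what makes it positive. -/
lemma exists_detFamDeriv_one (hirr : (transitionMatrix κ).IsIrreducible) {π : Fin N → ℝ}
    (hπ : IsStationaryVector κ π) (hρ : load κ π < 1) :
    ∃ c : ℝ, 0 < c ∧ detFamDeriv κ 1 1 = c := by
  have := hπ.nonempty
  obtain ⟨a, ha, hadj⟩ := exists_adjugate_eq hirr (sum_transitionMatrix κ) hπ.vecMul hπ.sum_eq_one
  refine ⟨a * (1 - load κ π), mul_pos ha (by linarith), ?_⟩
  have h1 : (1 : ℂ) • (1 : Matrix (Fin N) (Fin N) ℂ) - ((1 : ℝ) : ℂ) • Amat κ 1 =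
      Complex.ofRealHom.mapMatrix (1 - transitionMatrix κ) := by
    rw [map_sub, map_one, one_smul, Complex.ofReal_one, one_smul]
    congr 1
    ext i j
    exact Agf_one κ i j
  have h2 : ∀ l i, ((1 : Matrix (Fin N) (Fin N) ℂ) - ((1 : ℝ) : ℂ) • AmatDeriv κ 1) l i =
      (((1 : Matrix (Fin N) (Fin N) ℝ) l i - alpha κ l i : ℝ) : ℂ) := by
    intro l i
    simp only [Matrix.sub_apply, Complex.ofReal_one, one_smul, AmatDeriv, Matrix.of_apply,
      genFunDeriv_one, Complex.ofReal_sub, alpha]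
    congr 1
    rcases eq_or_ne l i with rfl | h <;> simp [*]
  have h3 : ∑ i, ∑ l, a * π l * ((1 : Matrix (Fin N) (Fin N) ℝ) l i - alpha κ l i) =
      a * (1 - load κ π) := by
    rw [Finset.sum_comm]
    simp only [mul_sub, Finset.sum_sub_distrib, Matrix.one_apply, mul_ite, mul_one, mul_zero,
      Finset.sum_ite_eq, Finset.mem_univ, if_true, load, Finset.mul_sum, ← mul_assoc]
    rw [← Finset.mul_sum, hπ.sum_eq_one, mul_one]
  rw [detFamDeriv, h1, ← RingHom.map_adjugate, ← h3, Complex.ofReal_sum]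
  refine Finset.sum_congr rfl fun i _ => ?_
  rw [Matrix.mulVec, dotProduct, Complex.ofReal_sum]
  refine Finset.sum_congr rfl fun l _ => ?_
  rw [h2, RingHom.mapMatrix_apply, Matrix.map_apply, hadj]
  simp

/-- Allows a zero on the real axis to be located by the intermediate value theorem. -/
lemma detFam_im {t x : ℝ} : (detFam κ t x).im = 0 := by
  have h : (x : ℂ) • (1 : Matrix (Fin N) (Fin N) ℂ) - (t : ℂ) • Amat κ x =
      Complex.ofRealHom.mapMatrix (x • (1 : Matrix (Fin N) (Fin N) ℝ) -
        t • Matrix.of fun i j => ∑' k : ℕ, (κ i (k, j)).toReal * x ^ k) := by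
    ext i j
    rcases eq_or_ne i j with rfl | hij
    · simp [Amat, Agf, Complex.ofReal_tsum]
    · simp [Amat, Agf, Complex.ofReal_tsum, hij]
  rw [detFam, h, ← RingHom.map_det]
  exact Complex.ofReal_im _

lemma detFam_one_right (t : ℝ) : detFam κ t 1 = ((1 - t • transitionMatrix κ).det : ℝ) := by
  have h1 : (1 : ℂ) • (1 : Matrix (Fin N) (Fin N) ℂ) - (t : ℂ) • Amat κ 1 =
      Complex.ofRealHom.mapMatrix (1 - t • transitionMatrix κ) := by
    ext i j
    rcases eq_or_ne i j with rfl | hij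
    · simp [Amat, Agf_one]
    · simp [Amat, Agf_one, hij]
  rw [detFam, h1, ← RingHom.map_det]
  rfl

lemma detFam_one_one [Nonempty (Fin N)] : detFam κ 1 1 = 0 := by
  rw [detFam_one_right, one_smul, det_one_sub_eq_zero (sum_transitionMatrix κ), Complex.ofReal_zero]

/-- Near `(1, 1)` the family is a small perturbation of a linear function with slope `c`. -/
lemma exists_linear_approx (hα : ∀ i j, Summable fun k : ℕ => (k : ℝ) * (κ i (k, j)).toReal)
    {c : ℝ} (hc : 0 < c) (hc1 : detFamDeriv κ 1 1 = c) :
    ∃ δ : ℝ, 0 < δ ∧ δ < 1 ∧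
      (∀ t : ℝ, 1 - δ < t → t ≤ 1 → ∀ z w : ℂ, ‖z‖ ≤ 1 → ‖w‖ ≤ 1 → ‖z - 1‖ < δ → ‖w - 1‖ < δ →
        ‖detFam κ t z - detFam κ t w - c * (z - w)‖ ≤ c / 2 * ‖z - w‖) ∧
      ∀ t : ℝ, 1 - δ < t → t ≤ 1 → ∀ z : ℂ, ‖z‖ < 1 → ‖z - 1‖ < δ → detFamDeriv κ t z ≠ 0 := by
  have h1 := (continuousOn_detFamDeriv hα) (1, 1) (by simp)
  rw [Metric.continuousWithinAt_iff] at h1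
  obtain ⟨δ₀, hδ₀, H⟩ := h1 (c / 2) (by positivity)
  have H' : ∀ t : ℝ, 1 - δ₀ < t → t ≤ 1 → ∀ z : ℂ, ‖z‖ ≤ 1 → ‖z - 1‖ < δ₀ →
      ‖detFamDeriv κ t z - c‖ < c / 2 := by
    intro t ht ht1 z hz hz1
    have := @H (t, z) (by simpa using hz) (by
      rw [Prod.dist_eq, max_lt_iff]
      refine ⟨?_, by simpa [dist_eq_norm] using hz1⟩
      rw [Real.dist_eq, abs_lt]
      constructor <;> simp only <;> linarith)
    rw [dist_eq_norm] at this
    simpa [hc1] using this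
  refine ⟨min δ₀ (1 / 2), by positivity, by linarith [min_le_right δ₀ (1 / 2)], ?_, ?_⟩
  · intro t ht ht1 z w hz hw hz1 hw1
    have htδ : 1 - δ₀ < t := by linarith [min_le_left δ₀ (1 / 2)]
    -- The mean value inequality applies on this convex set of interior points; boundary points are
    -- reached afterwards along radii `x z`, `x → 1`.
    set s : Set ℂ := Metric.ball 0 1 ∩ Metric.ball 1 (min δ₀ (1 / 2))
    have hs : Convex ℝ s := (convex_ball _ _).inter (convex_ball _ _)
    have key : ∀ z ∈ s, ∀ w ∈ s,
        ‖detFam κ t z - detFam κ t w - c * (z - w)‖ ≤ c / 2 * ‖z - w‖ := by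
      intro z hz w hw
      have := hs.norm_image_sub_le_of_norm_hasDerivWithin_le (𝕜 := ℂ) (C := c / 2)
        (f := fun z => detFam κ t z - c * z) (f' := fun z => detFamDeriv κ t z - c)
        (fun x hx => ?_) (fun x hx => ?_) hw hz
      · refine le_trans (le_of_eq ?_) this
        congr 1
        ring
      · have hx1 : ‖x‖ < 1 := by simpa using hx.1
        simpa using! ((hasDerivAt_detFam hα t hx1).fun_sub
          ((hasDerivAt_id x).const_mul (c : ℂ))).hasDerivWithinAt
      · have hx2 : ‖x - 1‖ < δ₀ := by
          have := hx.2
          rw [mem_ball_iff_norm] at this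
          exact this.trans_le (min_le_left _ _)
        exact (H' t htδ ht1 x (by simpa using (mem_ball_zero_iff.1 hx.1).le) hx2).le
    have hlim : ∀ z : ℂ, Tendsto (fun x : ℝ => (x : ℂ) * z) (𝓝[<] 1) (𝓝 z) := fun z => by
      have : Continuous fun x : ℝ => (x : ℂ) * z := by fun_prop
      exact (this.tendsto' 1 z (by simp)).mono_left nhdsWithin_le_nhds
    have hball : ∀ z : ℂ, ‖z‖ ≤ 1 → ∀ᶠ x : ℝ in 𝓝[<] 1, ‖(x : ℂ) * z‖ < 1 := fun z hz => by
      filter_upwards [Ioo_mem_nhdsLT (zero_lt_one' ℝ)] with x hx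
      rw [norm_mul, Complex.norm_real, Real.norm_of_nonneg hx.1.le]
      exact (mul_le_of_le_one_right hx.1.le hz).trans_lt hx.2
    have hmem : ∀ z : ℂ, ‖z‖ ≤ 1 → ‖z - 1‖ < min δ₀ (1 / 2) →
        ∀ᶠ x : ℝ in 𝓝[<] 1, (x : ℂ) * z ∈ s := fun z hz hz1 => by
      have := (hlim z).eventually (Metric.isOpen_ball.mem_nhds (mem_ball_iff_norm.2 hz1))
      filter_upwards [this, hball z hz] with x hx hx'
      exact ⟨by simpa using hx', hx⟩
    have hdet : ∀ z : ℂ, ‖z‖ ≤ 1 →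
        Tendsto (fun x : ℝ => detFam κ t ((x : ℂ) * z)) (𝓝[<] 1) (𝓝 (detFam κ t z)) := by
      intro z hz
      have h2 : ContinuousOn (detFam κ t) (Metric.closedBall 0 1) :=
        continuousOn_detFam.comp (f := fun z => (t, z)) (by fun_prop) fun z hz => ⟨trivial, hz⟩
      refine (h2 z (by simpa using hz)).tendsto.comp (tendsto_nhdsWithin_iff.2 ⟨hlim z, ?_⟩)
      filter_upwards [hball z hz] with x hx
      simpa using hx.le
    refine le_of_tendsto_of_tendsto
      (((hdet z hz).sub (hdet w hw)).sub (((hlim z).sub (hlim w)).const_mul (c : ℂ))).norm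
      (((hlim z).sub (hlim w)).norm.const_mul (c / 2)) ?_
    filter_upwards [hmem z hz hz1, hmem w hw hw1] with x hx hx'
    exact key _ hx _ hx'
  · intro t ht ht1 z hz hz1 h0
    have := H' t (by linarith [min_le_left δ₀ (1 / 2)]) ht1 z hz.le
      (hz1.trans_le (min_le_left _ _))
    rw [h0, zero_sub, norm_neg, Complex.norm_real, Real.norm_of_nonneg hc.le] at this
    linarith

lemma zeroCount_homotopy (hα : ∀ i j, Summable fun k : ℕ => (k : ℝ) * (κ i (k, j)).toReal)
    {r : ℝ} (hr : 0 < r) (hr1 : r < 1) {a b : ℝ} (hab : a ≤ b)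
    (h0 : ∀ t ∈ Set.Icc a b, ∀ z : ℂ, ‖z‖ = r → detFam κ t z ≠ 0) :
    zeroCount (detFam κ a) r = zeroCount (detFam κ b) r := by
  have hmaps : ∀ p : ℝ × ℝ, (p.1, circleMap 0 r p.2) ∈
      (Set.univ : Set ℝ) ×ˢ Metric.closedBall (0 : ℂ) 1 := fun p =>
    ⟨trivial, by simp [abs_of_pos hr, hr1.le]⟩
  have hc : Continuous fun p : ℝ × ℝ => detFam κ p.1 (circleMap 0 r p.2) :=
    continuousOn_detFam.comp_continuous (f := fun p : ℝ × ℝ => (p.1, circleMap 0 r p.2))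
      (by fun_prop) hmaps
  have hc' : Continuous fun p : ℝ × ℝ => detFamDeriv κ p.1 (circleMap 0 r p.2) :=
    (continuousOn_detFamDeriv hα).comp_continuous (f := fun p : ℝ × ℝ => (p.1, circleMap 0 r p.2))
      (by fun_prop) hmaps
  exact zeroCount_eq_of_homotopy hr hab
    (fun t => (analyticOnNhd_detFam t).mono (Metric.closedBall_subset_ball hr1))
    (fun t z hz => hasDerivAt_detFam hα t (hz.trans_lt hr1)) hc hc' h0

lemma zeroCount_detFam_zero (hN : N ≠ 0) {r : ℝ} (hr : 0 < r) :
    zeroCount (detFam κ 0) r = N := by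
  have h : detFam κ 0 = fun z => (z - 0) ^ N := by
    ext z
    simp [detFam]
  have hz : zerosIn (detFam κ 0) r = {0} := by
    ext z
    simp only [zerosIn, h, sub_zero, pow_eq_zero_iff hN, Set.mem_ofPred_eq, Set.mem_singleton_iff]
    exact ⟨fun h => h.2, fun h => ⟨by simp [h, hr], h⟩⟩
  rw [zeroCount, hz, finsum_mem_singleton, analyticOrderNatAt, h]
  have := analyticOrderAt_centeredMonomial (𝕜 := ℂ) (z₀ := 0) (n := N)
  rw [show (fun z : ℂ => (z - 0) ^ N) = ((· - 0) ^ N) from rfl, this]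
  rfl

/-- Away from the zeros on the circle, zeros of the family with `t` near `1` stay away from the
circle. -/
lemma exists_zero_free_annulus {G : Set ℂ} (hG : ∀ ζ, ζ ∈ G ↔ ‖ζ‖ = 1 ∧ detFam κ 1 ζ = 0)
    {δ : ℝ} (hδ : 0 < δ) :
    ∃ ε : ℝ, 0 < ε ∧ ε < 1 ∧ ∀ t : ℝ, 1 - ε < t → t ≤ 1 → ∀ z : ℂ, 1 - ε < ‖z‖ → ‖z‖ ≤ 1 →
      detFam κ t z = 0 → ∃ ζ ∈ G, ‖z - ζ‖ < δ := by
  set Z : Set (ℝ × ℂ) := ((Set.Icc 0 1 : Set ℝ) ×ˢ (Metric.closedBall (0 : ℂ) 1 ∩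
    {z | ∀ ζ ∈ G, δ ≤ ‖z - ζ‖})) ∩ (fun p : ℝ × ℂ => detFam κ p.1 p.2) ⁻¹' {0}
  have hcl : IsClosed {z : ℂ | ∀ ζ ∈ G, δ ≤ ‖z - ζ‖} := by
    simp only [Set.ofPred_forall]
    exact isClosed_biInter fun ζ _ => isClosed_le continuous_const (by fun_prop)
  have hcp : IsCompact ((Set.Icc 0 1 : Set ℝ) ×ˢ (Metric.closedBall (0 : ℂ) 1 ∩
      {z | ∀ ζ ∈ G, δ ≤ ‖z - ζ‖})) :=
    isCompact_Icc.prod ((isCompact_closedBall _ _).inter_right hcl)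
  have hZ : IsCompact Z := by
    refine hcp.of_isClosed_subset ?_ Set.inter_subset_left
    exact (continuousOn_detFam.mono fun p hp => ⟨trivial, hp.2.1⟩).preimage_isClosed_of_isClosed
      hcp.isClosed isClosed_singleton
  -- `Z` collects the zeros `(t, z)` far from `G`. None has both `t = 1` and `|z| = 1`, and
  -- compactness of `Z` makes the gap uniform.
  have hpos : ∀ p ∈ Z, 0 < max (1 - p.1) (1 - ‖p.2‖) := by
    rintro ⟨t, z⟩ ⟨⟨ht, hz, hzG⟩, h0⟩
    by_contra! hle
    obtain ⟨h1, h2⟩ := max_le_iff.1 hle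
    have hz1 : ‖z‖ = 1 := le_antisymm (by simpa using hz) (by simpa using h2)
    have ht1 : t = 1 := le_antisymm ht.2 (by simpa using h1)
    have := hzG z ((hG z).2 ⟨hz1, by simpa [ht1] using h0⟩)
    simp at this
    linarith
  obtain ⟨m, hm, hmZ⟩ : ∃ m : ℝ, 0 < m ∧ ∀ p ∈ Z, m ≤ max (1 - p.1) (1 - ‖p.2‖) := by
    rcases Z.eq_empty_or_nonempty with h | h
    · exact ⟨1, one_pos, by simp [h]⟩
    · obtain ⟨p, hp, hmin⟩ := hZ.exists_isMinOn h (f := fun p => max (1 - p.1) (1 - ‖p.2‖))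
        (by fun_prop)
      exact ⟨_, hpos p hp, fun q hq => hmin hq⟩
  refine ⟨min m (1 / 2), by positivity, by linarith [min_le_right m (1 / 2)], ?_⟩
  intro t ht ht1 z hz hz1 h0
  by_contra! hfar
  have h2 := hmZ (t, z) ⟨⟨⟨by linarith [min_le_right m (1 / 2)], ht1⟩, by simpa using hz1, hfar⟩, h0⟩
  have h3 := min_le_left m (1 / 2)
  rcases le_max_iff.1 h2 with h | h <;> simp only at h <;> linarith

/-- Zeros in the disc, counted with multiplicity, and zeros on the circle, counted once,
are `N` in number. -/
theorem zeros_detFam (hα : ∀ i j, Summable fun k : ℕ => (k : ℝ) * (κ i (k, j)).toReal)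
    (hirr : (transitionMatrix κ).IsIrreducible) {π : Fin N → ℝ}
    (hπ : IsStationaryVector κ π) (hρ : load κ π < 1) :
    {ζ | ‖ζ‖ = 1 ∧ detFam κ 1 ζ = 0}.Finite ∧ (zerosIn (detFam κ 1) 1).Finite ∧
      zeroCount (detFam κ 1) 1 + {ζ | ‖ζ‖ = 1 ∧ detFam κ 1 ζ = 0}.ncard = N := by
  have hne := hπ.nonempty
  have hN : N ≠ 0 := fun h => by subst h; exact hne.elim Fin.elim0
  obtain ⟨c, hc, hc1⟩ := exists_detFamDeriv_one hirr hπ hρ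
  obtain ⟨δ, hδ, hδ1, hlin, hder⟩ := exists_linear_approx hα hc hc1
  set G : Set ℂ := {ζ | ‖ζ‖ = 1 ∧ detFam κ 1 ζ = 0} with hG
  have hGmem : ∀ ζ, ζ ∈ G ↔ ‖ζ‖ = 1 ∧ detFam κ 1 ζ = 0 := fun ζ => Iff.rfl
  -- Two zeros near `1` would satisfy `c |z - w| ≤ (c / 2) |z - w|`.
  have hinj : ∀ t : ℝ, 1 - δ < t → t ≤ 1 → ∀ z w : ℂ, ‖z‖ ≤ 1 → ‖w‖ ≤ 1 → ‖z - 1‖ < δ →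
      ‖w - 1‖ < δ → detFam κ t z = 0 → detFam κ t w = 0 → z = w := by
    intro t ht ht1 z w hz hw hz1 hw1 h0z h0w
    have := hlin t ht ht1 z w hz hw hz1 hw1
    rw [h0z, h0w, sub_zero, zero_sub, norm_neg, norm_mul, Complex.norm_real,
      Real.norm_of_nonneg hc.le] at this
    rw [← sub_eq_zero, ← norm_eq_zero]
    nlinarith [norm_nonneg (z - w)]
  have hrot : ∀ ζ ∈ G, ∀ z : ℂ, ∃ w : ℂ, z = ζ * w ∧ ‖w‖ = ‖z‖ ∧ ‖w - 1‖ = ‖z - ζ‖ ∧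
      ∀ t, detFam κ t z = ζ ^ N * detFam κ t w := by
    intro ζ hζ z
    have hζ0 : ζ ≠ 0 := fun h => by simp [h, hG] at hζ
    have hz : z = ζ * (ζ⁻¹ * z) := by rw [mul_inv_cancel_left₀ hζ0]
    refine ⟨ζ⁻¹ * z, hz, by simp [hζ.1], ?_, fun t => ?_⟩
    · rw [show ζ⁻¹ * z - 1 = ζ⁻¹ * (z - ζ) by field_simp, norm_mul, norm_inv, hζ.1, inv_one, one_mul]
    · conv_lhs => rw [hz]
      exact detFam_mul hirr hζ.1 hζ.2 t _
  have hζN : ∀ ζ ∈ G, ζ ^ N ≠ 0 := fun ζ hζ => pow_ne_zero _ fun h => by simp [h, hG] at hζ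
  -- the zeros on the circle are `δ`-separated
  have hsep : ∀ ζ ∈ G, ∀ ζ' ∈ G, ‖ζ' - ζ‖ < δ → ζ' = ζ := by
    intro ζ hζ ζ' hζ' hlt
    obtain ⟨w, hw, hw1, hw2, hw3⟩ := hrot ζ hζ ζ'
    have h0 : detFam κ 1 w = 0 :=
      (mul_eq_zero.1 ((hw3 1).symm.trans hζ'.2)).resolve_left (hζN ζ hζ)
    have := hinj 1 (by linarith) le_rfl w 1 (by rw [hw1, hζ'.1]) (by simp) (by rwa [hw2])
      (by simpa using hδ) h0 detFam_one_one
    rw [hw, this, mul_one]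
  have hGfin : G.Finite := by
    by_contra hinf
    obtain ⟨z, -, hacc⟩ := Set.Infinite.exists_accPt_of_subset_isCompact hinf
      (isCompact_closedBall (0 : ℂ) 1) (fun z hz => by simp [hz.1])
    rw [accPt_iff_nhds] at hacc
    obtain ⟨ζ, ⟨hζz, hζ⟩, hne1⟩ := hacc _ (Metric.ball_mem_nhds z (half_pos hδ))
    have hpos : 0 < ‖ζ - z‖ := norm_pos_iff.2 (sub_ne_zero.2 hne1)
    obtain ⟨ζ', ⟨hζz', hζ'⟩, hne2⟩ := hacc _ (Metric.ball_mem_nhds z hpos)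
    rw [mem_ball_iff_norm] at hζz hζz'
    have h1 : ζ' = ζ := hsep ζ hζ ζ' hζ' <| by
      calc ‖ζ' - ζ‖ = ‖(ζ' - z) - (ζ - z)‖ := by rw [sub_sub_sub_cancel_right]
        _ ≤ ‖ζ' - z‖ + ‖ζ - z‖ := norm_sub_le _ _
        _ < δ := by linarith
    rw [h1] at hζz'
    exact lt_irrefl _ hζz'
  obtain ⟨ε, hε, hε1, hann⟩ := exists_zero_free_annulus hGmem hδ
  -- With this choice the annulus `1 - η ≤ |z| ≤ 1` is covered by the compactness bound `ε`, and the
  -- real points of `[1 - η, 1]` lie in the region of linear approximation.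
  set η := min δ ε / 2 with hη
  have hη0 : 0 < η := by positivity
  have hηδ : η < δ := by rw [hη]; linarith [min_le_left δ ε]
  have hηε : η < ε := by rw [hη]; linarith [min_le_right δ ε]
  set r₀ := 1 - η with hr₀
  have hr₀pos : 0 < r₀ := by linarith
  have hr₀1 : r₀ < 1 := by linarith
  have hnr₀ : ‖(r₀ : ℂ)‖ ≤ 1 := by simp [abs_of_pos hr₀pos, hr₀1.le]
  have hr₀sub : (r₀ : ℂ) - 1 = ((-η : ℝ) : ℂ) := by rw [hr₀]; push_cast; ring
  -- the sign of the family at `r₀`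
  have hneg : (detFam κ 1 r₀).re < 0 := by
    have h1 := hlin 1 (by linarith) le_rfl r₀ 1 hnr₀ (by simp)
      (by rw [hr₀sub]; simpa [abs_of_pos hη0] using hηδ) (by simpa using hδ)
    rw [detFam_one_one, sub_zero, hr₀sub, Complex.norm_real, norm_neg,
      Real.norm_of_nonneg hη0.le] at h1
    have h2 := (Complex.re_le_norm _).trans h1
    rw [Complex.sub_re, ← Complex.ofReal_mul, Complex.ofReal_re] at h2
    have := mul_pos hc hη0
    linarith
  have hcontt : ∀ z : ℂ, ‖z‖ ≤ 1 → Continuous fun t => (detFam κ t z).re := fun z hz =>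
    Complex.continuous_re.comp (continuousOn_detFam.comp_continuous (f := fun t => (t, z))
      (by fun_prop) fun t => ⟨trivial, by simpa using hz⟩)
  obtain ⟨τ, hτ1, hτ⟩ : ∃ τ < 1, ∀ t : ℝ, τ ≤ t → t ≤ 1 → (detFam κ t r₀).re < 0 := by
    have := (hcontt r₀ hnr₀).continuousAt (x := 1) |>.eventually (gt_mem_nhds hneg)
    obtain ⟨e, he, hball⟩ := Metric.eventually_nhds_iff.1 this
    refine ⟨1 - e / 2, by linarith, fun t ht ht1 => hball ?_⟩
    rw [Real.dist_eq, abs_lt]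
    constructor <;> linarith
  -- `τ` keeps the family negative at `r₀`; `r₀` keeps `t` above both `1 - δ` and `1 - ε`.
  set t₀ := max τ (r₀ : ℝ) with ht₀
  have ht₀1 : t₀ < 1 := max_lt hτ1 hr₀1
  have ht₀r : r₀ ≤ t₀ := le_max_right _ _
  -- the zero near `1`
  have hroot : ∀ t : ℝ, t₀ ≤ t → t < 1 → ∃ x : ℝ, r₀ < x ∧ x < 1 ∧ detFam κ t x = 0 := by
    intro t ht ht1
    have hpos : 0 < (detFam κ t (1 : ℝ)).re := by
      rw [Complex.ofReal_one, detFam_one_right, Complex.ofReal_re]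
      exact det_sub_smul_pos (transitionMatrix_nonneg κ) (sum_transitionMatrix κ)
        (by linarith) ht1
    have hcx : ContinuousOn (fun x : ℝ => (detFam κ t x).re) (Set.Icc r₀ 1) := by
      refine Complex.continuous_re.comp_continuousOn (continuousOn_detFam.comp
        (f := fun x : ℝ => (t, (x : ℂ))) (by fun_prop) fun x hx => ⟨trivial, ?_⟩)
      simp [abs_of_nonneg (hr₀pos.le.trans hx.1), hx.2]
    obtain ⟨x, hx, hx0⟩ := intermediate_value_Ioo hr₀1.le hcx
      ⟨hτ t ((le_max_left _ _).trans ht) ht1.le, hpos⟩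
    exact ⟨x, hx.1, hx.2, Complex.ext hx0 detFam_im⟩
  -- zeros near the circle are rotations of zeros near `1`
  have hnear : ∀ t : ℝ, t₀ ≤ t → t ≤ 1 → ∀ z : ℂ, r₀ ≤ ‖z‖ → ‖z‖ ≤ 1 → detFam κ t z = 0 →
      ∃ ζ ∈ G, ∃ w : ℂ, z = ζ * w ∧ ‖w‖ = ‖z‖ ∧ ‖w - 1‖ < δ ∧ detFam κ t w = 0 := by
    intro t ht ht1 z hz hz1 h0
    obtain ⟨ζ, hζ, hlt⟩ := hann t (by linarith) ht1 z (by linarith) hz1 h0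
    obtain ⟨w, hw, hw1, hw2, hw3⟩ := hrot ζ hζ z
    exact ⟨ζ, hζ, w, hw, hw1, by rwa [hw2],
      (mul_eq_zero.1 ((hw3 t).symm.trans h0)).resolve_left (hζN ζ hζ)⟩
  have hreal : ∀ x : ℝ, r₀ < x → x < 1 → ‖(x : ℂ)‖ = x ∧ ‖(x : ℂ) - 1‖ < δ := by
    intro x hx hx1
    refine ⟨by simp [abs_of_pos (hr₀pos.trans hx)], ?_⟩
    rw [← Complex.ofReal_one, ← Complex.ofReal_sub, Complex.norm_real, Real.norm_eq_abs, abs_lt]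
    constructor <;> linarith
  have hnear_eq : ∀ t : ℝ, t₀ ≤ t → t < 1 → ∀ x : ℝ, r₀ < x → x < 1 → detFam κ t x = 0 →
      ∀ z : ℂ, r₀ ≤ ‖z‖ → ‖z‖ ≤ 1 → detFam κ t z = 0 → ∃ ζ ∈ G, z = ζ * x := by
    intro t ht ht1 x hx hx1 hx0 z hz hz1 h0
    obtain ⟨ζ, hζ, w, hw, hw1, hw2, hw3⟩ := hnear t ht ht1.le z hz hz1 h0
    have := hinj t (by linarith) ht1.le w x (by rw [hw1]; exact hz1)
      ((hreal x hx hx1).1.trans_le hx1.le)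
      hw2 (hreal x hx hx1).2 hw3 hx0
    exact ⟨ζ, hζ, by rw [hw, this]⟩
  -- At `t = 1` the unique zero near `1` is `1` itself, so rotation produces only points on the
  -- circle.
  have hnear_one : ∀ z : ℂ, r₀ ≤ ‖z‖ → ‖z‖ ≤ 1 → detFam κ 1 z = 0 → ‖z‖ = 1 := by
    intro z hz hz1 h0
    obtain ⟨ζ, hζ, w, hw, hw1, hw2, hw3⟩ := hnear 1 ht₀1.le le_rfl z hz hz1 h0
    have := hinj 1 (by linarith) le_rfl w 1 (by rw [hw1]; exact hz1) (by simp)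
      hw2 (by simpa using hδ) hw3 detFam_one_one
    rw [← hw1, this, norm_one]
  have hint : zerosIn (detFam κ 1) 1 = zerosIn (detFam κ 1) r₀ := by
    ext z
    refine ⟨fun h => ⟨lt_of_not_ge fun hge => ?_, h.2⟩, fun h => ⟨h.1.trans hr₀1, h.2⟩⟩
    exact h.1.ne (hnear_one z hge h.1.le h.2)
  -- Zeros in the annulus have modulus `x > r₀` if `t < 1`, and modulus `1` if `t = 1`; none crosses
  -- the inner circle.
  have hsphere : ∀ t ∈ Set.Icc t₀ 1, ∀ z : ℂ, ‖z‖ = r₀ → detFam κ t z ≠ 0 := by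
    intro t ht z hz h0
    rcases ht.2.eq_or_lt with rfl | ht1
    · have := hnear_one z hz.ge (by linarith) h0
      linarith
    · obtain ⟨x, hx, hx1, hx0⟩ := hroot t ht.1 ht1
      obtain ⟨ζ, hζ, hzx⟩ := hnear_eq t ht.1 ht1 x hx hx1 hx0 z hz.ge (by linarith) h0
      rw [hzx, norm_mul, hζ.1, one_mul, (hreal x hx hx1).1] at hz
      linarith
  refine ⟨hGfin, ?_, ?_⟩
  · rw [hint]
    exact finite_zerosIn hr₀pos ((analyticOnNhd_detFam 1).mono (Metric.closedBall_subset_ball hr₀1))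
      (hsphere 1 ⟨ht₀1.le, le_rfl⟩)
  obtain ⟨x, hx, hx1, hx0⟩ := hroot t₀ le_rfl ht₀1
  -- Exceeding `t₀` makes the homotopy from `t = 0` free of zeros on this circle; exceeding `x`
  -- makes the disc contain the zero near each point of `G`.
  set r₁ := (max t₀ x + 1) / 2 with hr₁
  have hmax : max t₀ x < 1 := max_lt ht₀1 hx1
  have hr₁1 : r₁ < 1 := by linarith
  have hr₁t : t₀ < r₁ := by linarith [le_max_left t₀ x]
  have hr₁x : x < r₁ := by linarith [le_max_right t₀ x]
  have hr₁pos : 0 < r₁ := by linarith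
  have hcount₁ : zeroCount (detFam κ t₀) r₁ = N := by
    rw [← zeroCount_homotopy hα hr₁pos hr₁1 (a := 0) (by linarith) fun t ht z hz =>
      detFam_ne_zero ht.1 (by linarith) (by rw [hz]; linarith [ht.2]),
      zeroCount_detFam_zero hN hr₁pos]
  have hcount₀ : zeroCount (detFam κ t₀) r₀ = zeroCount (detFam κ 1) r₀ :=
    zeroCount_homotopy hα hr₀pos hr₀1 ht₀1.le hsphere
  have hx_ne : (x : ℂ) ≠ 0 := by
    have : x ≠ 0 := by linarith
    exact_mod_cast this
  have hzero_rot : ∀ ζ ∈ G, detFam κ t₀ (ζ * x) = 0 := fun ζ hζ => by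
    rw [detFam_mul hirr hζ.1 hζ.2, hx0, mul_zero]
  have hnorm_rot : ∀ ζ ∈ G, ‖ζ * x‖ = x := fun ζ hζ => by
    rw [norm_mul, hζ.1, one_mul, (hreal x hx hx1).1]
  have hunion : zerosIn (detFam κ t₀) r₁ =
      zerosIn (detFam κ t₀) r₀ ∪ (fun ζ => ζ * (x : ℂ)) '' G := by
    ext z
    constructor
    · rintro ⟨hz, h0⟩
      rcases lt_or_ge ‖z‖ r₀ with h | h
      · exact Or.inl ⟨h, h0⟩
      · obtain ⟨ζ, hζ, hzx⟩ := hnear_eq t₀ le_rfl ht₀1 x hx hx1 hx0 z h (by linarith) h0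
        exact Or.inr ⟨ζ, hζ, hzx.symm⟩
    · rintro (⟨hz, h0⟩ | ⟨ζ, hζ, rfl⟩)
      · exact ⟨by linarith, h0⟩
      · exact ⟨by simp only [hnorm_rot ζ hζ]; exact hr₁x, hzero_rot ζ hζ⟩
  have hdisj : Disjoint (zerosIn (detFam κ t₀) r₀) ((fun ζ => ζ * (x : ℂ)) '' G) := by
    rw [Set.disjoint_left]
    rintro z ⟨hz, -⟩ ⟨ζ, hζ, rfl⟩
    simp only [hnorm_rot ζ hζ] at hz
    linarith
  -- Differentiating the rotation identity at `x` reduces simplicity at `ζ x` to the nonzero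
  -- derivative at `x`.
  have hord : ∀ z ∈ (fun ζ => ζ * (x : ℂ)) '' G, analyticOrderNatAt (detFam κ t₀) z = 1 := by
    rintro z ⟨ζ, hζ, rfl⟩
    simp only
    have hlt : ‖ζ * (x : ℂ)‖ < 1 := by rw [hnorm_rot ζ hζ]; exact hx1
    have hζ0 : ζ ≠ 0 := fun h => by simp [h, hG] at hζ
    have hd1 := (hasDerivAt_detFam hα t₀ hlt).comp (x : ℂ) ((hasDerivAt_id (x : ℂ)).const_mul ζ)
    have hd2 := (hasDerivAt_detFam hα t₀ (z := x) (by rw [(hreal x hx hx1).1]; exact hx1)).const_mul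
      (ζ ^ N)
    have hfun : detFam κ t₀ ∘ HMul.hMul ζ = fun y => ζ ^ N * detFam κ t₀ y :=
      funext fun y => detFam_mul hirr hζ.1 hζ.2 t₀ y
    rw [hfun] at hd1
    have heq := hd1.unique hd2
    have hne' : detFamDeriv κ t₀ (ζ * x) ≠ 0 := by
      intro h
      rw [h, zero_mul] at heq
      exact mul_ne_zero (hζN ζ hζ) (hder t₀ (by linarith) ht₀1.le x
        (by rw [(hreal x hx hx1).1]; exact hx1) (hreal x hx hx1).2) heq.symm
    rw [analyticOrderNatAt, (analyticOnNhd_detFam t₀ _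
      (by simpa using hlt)).analyticOrderAt_eq_one_of_zero_deriv_ne_zero (hzero_rot ζ hζ)
      (by rwa [(hasDerivAt_detFam hα t₀ hlt).deriv])]
    rfl
  have hfin₀ : (zerosIn (detFam κ t₀) r₀).Finite :=
    finite_zerosIn hr₀pos ((analyticOnNhd_detFam t₀).mono (Metric.closedBall_subset_ball hr₀1))
      (hsphere t₀ ⟨le_rfl, ht₀1.le⟩)
  have hsplit : zeroCount (detFam κ t₀) r₁ = zeroCount (detFam κ t₀) r₀ + G.ncard := by
    rw [zeroCount, hunion, finsum_mem_union hdisj hfin₀ (hGfin.image _), zeroCount,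
      finsum_mem_congr rfl hord, ← Set.ncard_image_of_injective G (mul_left_injective₀ hx_ne)]
    congr 1
    exact finsum_one
  have h1 : zeroCount (detFam κ 1) 1 = zeroCount (detFam κ 1) r₀ := by
    rw [zeroCount, hint, zeroCount]
  rw [h1, ← hcount₀, ← hsplit, hcount₁]

lemma interiorZeros_eq : interiorZeros κ = zerosIn (detFam κ 1) 1 := by
  ext z
  simp [interiorZeros, zerosIn, det_Mmat]

lemma det_Mmat_one [Nonempty (Fin N)] : (Mmat κ 1).det = 0 := by
  rw [det_Mmat, detFam_one_one]

/-- The null vector has constant modulus, so each row sum of `|A_ij(ζ)|` is at least `1`, the row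
sum of `P`; the entrywise bounds must then all be equalities. -/
lemma norm_Agf_eq_of_mem_circleZeros (hirr : (transitionMatrix κ).IsIrreducible) {ζ : ℂ}
    (hζ : ζ ∈ circleZeros κ) (i j : Fin N) : ‖Agf κ i j ζ‖ = transitionMatrix κ i j := by
  obtain ⟨h1, -, h0⟩ := hζ
  rw [det_Mmat] at h0
  obtain ⟨w, hw0, hw⟩ := exists_eigenvector h0
  have hle : ∀ l m, ‖Agf κ l m ζ‖ ≤ transitionMatrix κ l m := fun l m => norm_Agf_le κ l m h1.le
  have hconst : ∀ i j, ‖w i‖ = ‖w j‖ :=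
    subharmonic_const hirr (sum_transitionMatrix κ) fun i => by
      simpa [h1] using norm_eigenvector_le zero_le_one h1.le hw i
  have hpos : 0 < ‖w i‖ := norm_pos_iff.2 fun hi => hw0 <| funext fun j =>
    norm_eq_zero.1 (by rw [hconst j i, hi, norm_zero])
  have hsum : ∑ j, transitionMatrix κ i j ≤ ∑ j, ‖Agf κ i j ζ‖ := by
    have h2 : ‖w i‖ ≤ ∑ j, ‖Agf κ i j ζ‖ * ‖w i‖ := by
      calc ‖w i‖ = ‖∑ j, Agf κ i j ζ * w j‖ := by
            rw [← one_mul (∑ j, _), ← Complex.ofReal_one, ← hw i, norm_mul, h1, one_mul]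
        _ ≤ ∑ j, ‖Agf κ i j ζ * w j‖ := norm_sum_le _ _
        _ = ∑ j, ‖Agf κ i j ζ‖ * ‖w i‖ := Finset.sum_congr rfl fun j _ => by
            rw [norm_mul, hconst j i]
    rw [← Finset.sum_mul] at h2
    rw [sum_transitionMatrix]
    exact le_of_mul_le_mul_right (by rwa [one_mul]) hpos
  exact (Finset.sum_eq_sum_iff_of_le fun j _ => hle i j).1
    (le_antisymm (Finset.sum_le_sum fun j _ => hle i j) hsum) j (Finset.mem_univ _)

/-- The number of zeros of `det M` in the closed unit disc, apart from the point `1`. -/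
theorem zeros_det_Mmat (hα : ∀ i j, Summable fun k : ℕ => (k : ℝ) * (κ i (k, j)).toReal)
    (hirr : (transitionMatrix κ).IsIrreducible) {π : Fin N → ℝ}
    (hπ : IsStationaryVector κ π) (hρ : load κ π < 1) :
    (interiorZeros κ).Finite ∧ (circleZeros κ).Finite ∧
      (∑ᶠ ζ ∈ interiorZeros κ, zeroMult κ ζ) + (circleZeros κ).ncard = N - 1 := by
  have := hπ.nonempty
  obtain ⟨h1, h2, h3⟩ := zeros_detFam hα hirr hπ hρ
  set G : Set ℂ := {ζ | ‖ζ‖ = 1 ∧ detFam κ 1 ζ = 0}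
  have hG : circleZeros κ = G \ {1} := by
    ext z
    simp only [circleZeros, det_Mmat, G, Set.mem_ofPred_eq, Set.mem_sdiff, Set.mem_singleton_iff]
    tauto
  have hone : (1 : ℂ) ∈ G := ⟨norm_one, detFam_one_one⟩
  refine ⟨interiorZeros_eq ▸ h2, hG ▸ h1.subset Set.sdiff_subset, ?_⟩
  rw [hG, Set.ncard_sdiff_singleton_of_mem hone, interiorZeros_eq]
  have h4 : (∑ᶠ ζ ∈ zerosIn (detFam κ 1) 1, zeroMult κ ζ) = zeroCount (detFam κ 1) 1 := by
    rw [zeroCount]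
    simp only [zeroMult, det_Mmat]
  -- Since `1 ∈ G`, the truncated subtractions of `1` are genuine.
  have h5 := (Set.ncard_pos h1).2 ⟨1, hone⟩
  rw [h4]
  omega

end Zeros

end

end SMQueue

open scoped ENNReal

namespace SMQueue

noncomputable section

/-! ### Expectations under a probability mass function -/

section Expect

variable {α γ : Type*}

/-- The expectation of a complex function under a probability mass function. -/
def expect (p : PMF α) (g : α → ℂ) : ℂ := ∑' s, ((p s).toReal : ℂ) * g s

variable {g : α → ℂ} {C : ℝ}

lemma norm_expect_term_le (p : PMF α) (hg : ∀ s, ‖g s‖ ≤ C) (s : α) :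
    ‖((p s).toReal : ℂ) * g s‖ ≤ (p s).toReal * C := by
  rw [norm_mul, Complex.norm_real, Real.norm_of_nonneg ENNReal.toReal_nonneg]
  exact mul_le_mul_of_nonneg_left (hg s) ENNReal.toReal_nonneg

lemma summable_expect (p : PMF α) (hg : ∀ s, ‖g s‖ ≤ C) :
    Summable fun s => ((p s).toReal : ℂ) * g s :=
  .of_norm_bounded ((summable_toReal p).mul_right C) (norm_expect_term_le p hg)

lemma norm_expect_le (p : PMF α) (hg : ∀ s, ‖g s‖ ≤ C) : ‖expect p g‖ ≤ C := by
  refine (tsum_of_norm_bounded ((summable_toReal p).mul_right C).hasSum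
    (norm_expect_term_le p hg)).trans_eq ?_
  rw [tsum_mul_right, tsum_toReal, one_mul]

lemma expect_bind (p : PMF γ) (f : γ → PMF α) (hg : ∀ s, ‖g s‖ ≤ C) :
    expect (p.bind f) g = expect p fun s => expect (f s) g := by
  have hnn : 0 ≤ fun q : γ × α => (p q.1).toReal * (f q.1 q.2).toReal := fun q =>
    mul_nonneg ENNReal.toReal_nonneg ENNReal.toReal_nonneg
  have hsum : Summable fun q : γ × α => (p q.1).toReal * (f q.1 q.2).toReal := by
    rw [summable_prod_of_nonneg hnn]
    constructor
    · intro s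
      exact (summable_toReal (f s)).mul_left (p s).toReal
    · simp only [tsum_mul_left, tsum_toReal, mul_one]
      exact summable_toReal p
  have hsum' : Summable fun q : γ × α =>
      ((p q.1).toReal : ℂ) * (((f q.1 q.2).toReal : ℂ) * g q.2) := by
    refine .of_norm_bounded (hsum.mul_right C) fun q => ?_
    rw [norm_mul, Complex.norm_real, Real.norm_of_nonneg ENNReal.toReal_nonneg, mul_assoc]
    exact mul_le_mul_of_nonneg_left (norm_expect_term_le (f q.1) hg q.2) ENNReal.toReal_nonneg
  have h1 : ∀ s, ((p.bind f s).toReal : ℂ) * g s =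
      ∑' t, ((p t).toReal : ℂ) * (((f t s).toReal : ℂ) * g s) := by
    intro s
    rw [PMF.bind_apply, ENNReal.tsum_toReal_eq fun t =>
      ENNReal.mul_ne_top (p.apply_ne_top t) ((f t).apply_ne_top s), Complex.ofReal_tsum,
      ← tsum_mul_right]
    refine tsum_congr fun t => ?_
    rw [ENNReal.toReal_mul, Complex.ofReal_mul, mul_assoc]
  simp only [expect, h1, ← tsum_mul_left]
  exact (Summable.tsum_comm (f := fun t s => ((p t).toReal : ℂ) * (((f t s).toReal : ℂ) * g s))
    hsum')

lemma expect_pure (a : α) (g : α → ℂ) : expect (PMF.pure a) g = g a := by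
  classical
  rw [expect, tsum_eq_single a]
  · simp
  · intro b hb
    simp [hb]

lemma expect_map (p : PMF γ) (h : γ → α) (hg : ∀ s, ‖g s‖ ≤ C) :
    expect (p.map h) g = expect p fun s => g (h s) := by
  rw [PMF.map, expect_bind p _ hg]
  simp only [Function.comp_apply, expect_pure]

lemma expect_const_mul (p : PMF α) (c : ℂ) (g : α → ℂ) :
    expect p (fun s => c * g s) = c * expect p g := by
  rw [expect, expect, ← tsum_mul_left]
  exact tsum_congr fun s => mul_left_comm _ _ _

lemma expect_add (p : PMF α) {g' : α → ℂ} {C' : ℝ} (hg : ∀ s, ‖g s‖ ≤ C) (hg' : ∀ s, ‖g' s‖ ≤ C') :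
    expect p (fun s => g s + g' s) = expect p g + expect p g' := by
  rw [expect, expect, expect, ← (summable_expect p hg).tsum_add (summable_expect p hg')]
  exact tsum_congr fun s => mul_add _ _ _

lemma expect_sub (p : PMF α) {g' : α → ℂ} {C' : ℝ} (hg : ∀ s, ‖g s‖ ≤ C) (hg' : ∀ s, ‖g' s‖ ≤ C') :
    expect p (fun s => g s - g' s) = expect p g - expect p g' := by
  rw [expect, expect, expect, ← (summable_expect p hg).tsum_sub (summable_expect p hg')]
  exact tsum_congr fun s => mul_sub _ _ _

lemma expect_sum {ι : Type*} (S : Finset ι) (p : PMF α) {G : ι → α → ℂ}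
    (hG : ∀ i s, ‖G i s‖ ≤ C) :
    expect p (fun s => ∑ i ∈ S, G i s) = ∑ i ∈ S, expect p (G i) := by
  simp only [expect, Finset.mul_sum]
  exact Summable.tsum_finsetSum fun i _ => summable_expect p (hG i)

lemma expect_const (p : PMF α) (c : ℂ) : expect p (fun _ => c) = c := by
  rw [expect, tsum_mul_right, ← Complex.ofReal_tsum, tsum_toReal, Complex.ofReal_one, one_mul]

lemma expect_indicator [DecidableEq α] (p : PMF α) (a : α) :
    expect p (fun s => if s = a then 1 else 0) = (p a).toReal := by
  rw [expect, tsum_eq_single a]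
  · simp
  · intro b hb
    simp [hb]

end Expect

/-! ### Generating functions of the law of the chain -/

section Chain

variable {N : ℕ} {κ : Fin N → PMF (ℕ × Fin N)} {β : PMF ℕ}

/-- The function `(x, i) ↦ z ^ x 1{i = j}`. -/
def testFun (j : Fin N) (z : ℂ) (s : ℕ × Fin N) : ℂ := if s.2 = j then z ^ s.1 else 0

lemma norm_testFun_le (j : Fin N) {z : ℂ} (hz : ‖z‖ ≤ 1) (s : ℕ × Fin N) :
    ‖testFun j z s‖ ≤ 1 := by
  unfold testFun
  split_ifs
  · rw [norm_pow]; exact pow_le_one₀ (norm_nonneg _) hz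
  · simp

/-- The generating function `∑ₓ p(x, j) zˣ`. -/
def lawGF (p : PMF (ℕ × Fin N)) (j : Fin N) : ℂ → ℂ := genFun fun x => (p (x, j)).toReal

lemma expect_testFun (p : PMF (ℕ × Fin N)) (j : Fin N) {z : ℂ} (hz : ‖z‖ ≤ 1) :
    expect p (testFun j z) = lawGF p j z := by
  rw [expect, tsum_prod_fin (summable_expect p (norm_testFun_le j hz)), Finset.sum_eq_single j]
  · simp [testFun, lawGF, genFun]
  · intro i _ hij
    simp [testFun, hij]
  · simp

lemma lawGF_kernel (i j : Fin N) (z : ℂ) : lawGF (κ i) j z = Agf κ i j z := rfl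

lemma lawGF_zero (p : PMF (ℕ × Fin N)) (j : Fin N) : lawGF p j 0 = (p (0, j)).toReal := genFun_zero

lemma norm_Bgf_le (β : PMF ℕ) {z : ℂ} (hz : ‖z‖ ≤ 1) : ‖Bgf β z‖ ≤ 1 :=
  (norm_genFun_le (fun _ => ENNReal.toReal_nonneg) (summable_toReal β) hz).trans_eq (tsum_toReal β)

/-- The factor `z` cancels the departure in both branches of the recursion. At level `0` this needs
`b ≥ 1`, otherwise the natural subtraction would truncate. The indicator term replaces `1` by `B(z)`
there. -/
lemma mul_expect_step (hβ0 : β 0 = 0) (s : ℕ × Fin N) (j : Fin N) {z : ℂ} (hz : ‖z‖ ≤ 1) :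
    z * expect (step κ β s) (testFun j z) =
      ∑ i, Agf κ i j z * (testFun i z s + (Bgf β z - 1) * if s = (0, i) then 1 else 0) := by
  obtain ⟨x, i⟩ := s
  rw [Finset.sum_eq_single i (fun l _ hl => by simp [testFun, hl.symm]) (by simp)]
  rcases Nat.eq_zero_or_pos x with rfl | hx
  · have h1 : ∀ a : ℕ × Fin N, z * expect (β.map fun b => (a.1 + b - 1, a.2)) (testFun j z) =
        Bgf β z * testFun j z a := by
      intro a
      rw [expect_map _ _ (norm_testFun_le j hz), ← expect_const_mul, mul_comm, Bgf, expect,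
        ← tsum_mul_left]
      refine tsum_congr fun b => ?_
      rcases Nat.eq_zero_or_pos b with rfl | hb
      · simp [hβ0]
      · simp only [testFun]
        split_ifs
        · rw [← pow_succ', show a.1 + b - 1 + 1 = a.1 + b by omega, pow_add]
          ring
        · simp
    have h2 : step κ β (0, i) = (κ i).bind fun a => β.map fun b => (a.1 + b - 1, a.2) := by
      simp [step]
    rw [h2, expect_bind _ _ (norm_testFun_le j hz), ← expect_const_mul]
    simp only [h1]
    rw [expect_const_mul, expect_testFun _ _ hz, lawGF_kernel]
    simp [testFun, mul_comm]
  · have h2 : step κ β (x, i) = (κ i).map fun a => (x - 1 + a.1, a.2) := by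
      simp [step, Nat.one_le_iff_ne_zero, hx.ne']
    have h3 : ∀ a : ℕ × Fin N, z * testFun j z (x - 1 + a.1, a.2) = z ^ x * testFun j z a := by
      intro a
      simp only [testFun]
      split_ifs
      · rw [← pow_succ', ← pow_add]
        congr 1
        omega
      · simp
    rw [h2, expect_map _ _ (norm_testFun_le j hz), ← expect_const_mul]
    simp only [h3]
    rw [expect_const_mul, expect_testFun _ _ hz, lawGF_kernel]
    simp [testFun, hx.ne', mul_comm]

/-- One step of the chain in terms of generating functions. -/
lemma mul_lawGF_bind_step (hβ0 : β 0 = 0) (p : PMF (ℕ × Fin N)) (j : Fin N) {z : ℂ}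
    (hz : ‖z‖ ≤ 1) :
    z * lawGF (p.bind (step κ β)) j z =
      ∑ i, Agf κ i j z * (lawGF p i z + (Bgf β z - 1) * (p (0, i)).toReal) := by
  have hind : ∀ (a s : ℕ × Fin N), ‖(if s = a then 1 else 0 : ℂ)‖ ≤ 1 := by
    intro a s; split_ifs <;> simp
  have hind' : ∀ (a s : ℕ × Fin N), ‖(Bgf β z - 1) * (if s = a then 1 else 0 : ℂ)‖ ≤ 2 := by
    intro a s
    rw [norm_mul]
    have h1 : ‖Bgf β z - 1‖ ≤ 2 := (norm_sub_le _ _).trans (by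
      rw [norm_one]; linarith [norm_Bgf_le β hz])
    nlinarith [hind a s, norm_nonneg (Bgf β z - 1)]
  have hterm : ∀ i s, ‖Agf κ i j z *
      (testFun i z s + (Bgf β z - 1) * if s = (0, i) then 1 else 0)‖ ≤ 3 := by
    intro i s
    rw [norm_mul]
    have h1 : ‖Agf κ i j z‖ ≤ 1 := (norm_Agf_le κ i j hz).trans <| by
      rw [← sum_transitionMatrix κ i]
      exact Finset.single_le_sum (fun l _ => transitionMatrix_nonneg κ i l) (Finset.mem_univ j)
    have h2 : ‖testFun i z s + (Bgf β z - 1) * if s = (0, i) then 1 else 0‖ ≤ 3 :=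
      (norm_add_le _ _).trans (by linarith [norm_testFun_le i hz s, hind' (0, i) s])
    nlinarith [norm_nonneg (Agf κ i j z),
      norm_nonneg (testFun i z s + (Bgf β z - 1) * if s = (0, i) then 1 else 0)]
  rw [← expect_testFun _ _ hz, expect_bind _ _ (norm_testFun_le j hz), ← expect_const_mul]
  simp only [mul_expect_step hβ0 _ j hz]
  rw [expect_sum _ _ hterm]
  refine Finset.sum_congr rfl fun i _ => ?_
  rw [expect_const_mul, expect_add _ (norm_testFun_le i hz) (hind' (0, i)), expect_const_mul,
    expect_testFun _ _ hz, expect_indicator]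

lemma stepN_succ' (n : ℕ) (p : PMF (ℕ × Fin N)) :
    p.bind (stepN κ β (n + 1)) = (p.bind (stepN κ β n)).bind (step κ β) := by
  rw [PMF.bind_bind]
  rfl

lemma bind_stepN_zero (p : PMF (ℕ × Fin N)) : p.bind (stepN κ β 0) = p := PMF.bind_pure p

lemma stepN_add (m n : ℕ) (s : ℕ × Fin N) :
    stepN κ β (m + n) s = (stepN κ β m s).bind (stepN κ β n) := by
  induction n with
  | zero => rw [bind_stepN_zero, add_zero]
  | succ n ih => rw [stepN_succ', ← ih]; rfl

lemma bind_stepN_of_stationary {μ : PMF (ℕ × Fin N)} (hμ : μ.bind (step κ β) = μ) (n : ℕ) :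
    μ.bind (stepN κ β n) = μ := by
  induction n with
  | zero => exact bind_stepN_zero μ
  | succ n ih => rw [stepN_succ', ih, hμ]

/-! ### The drift of the chain -/

lemma lintegral_bind {α γ : Type*} (p : PMF γ) (f : γ → PMF α) (V : α → ℝ≥0∞) :
    ∑' t, p.bind f t * V t = ∑' s, p s * ∑' t, f s t * V t := by
  simp only [PMF.bind_apply, ← ENNReal.tsum_mul_right, ← ENNReal.tsum_mul_left]
  rw [ENNReal.tsum_comm]
  simp only [mul_assoc]

lemma lintegral_pure {α : Type*} (a : α) (V : α → ℝ≥0∞) : ∑' t, PMF.pure a t * V t = V a := by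
  classical
  rw [tsum_eq_single a]
  · simp
  · intro b hb
    simp [hb]

lemma lintegral_map {α γ : Type*} (p : PMF γ) (h : γ → α) (V : α → ℝ≥0∞) :
    ∑' t, p.map h t * V t = ∑' s, p s * V (h s) := by
  rw [PMF.map, lintegral_bind]
  simp only [Function.comp_apply, lintegral_pure]

lemma lintegral_const_add {α : Type*} (p : PMF α) (c : ℝ≥0∞) (V : α → ℝ≥0∞) :
    ∑' s, p s * (c + V s) = c + ∑' s, p s * V s := by
  simp only [mul_add]
  rw [ENNReal.tsum_add, ENNReal.tsum_mul_right, p.tsum_coe, one_mul]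

lemma tsum_prod_fin_ennreal (f : ℕ × Fin N → ℝ≥0∞) : ∑' s, f s = ∑ j, ∑' k, f (k, j) := by
  rw [← (Equiv.prodComm (Fin N) ℕ).tsum_eq, ENNReal.tsum_prod', tsum_fintype]
  rfl

lemma alpha_nonneg (i j : Fin N) : 0 ≤ alpha κ i j :=
  tsum_nonneg fun _ => mul_nonneg (Nat.cast_nonneg _) ENNReal.toReal_nonneg

lemma tsum_natCast_mul_eq {p : ℕ → ℝ≥0∞} (hp : ∀ k, p k ≠ ⊤)
    (hs : Summable fun k : ℕ => (k : ℝ) * (p k).toReal) :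
    ∑' k : ℕ, p k * (k : ℝ≥0∞) = ENNReal.ofReal (∑' k : ℕ, (k : ℝ) * (p k).toReal) := by
  rw [ENNReal.ofReal_tsum_of_nonneg
    (fun k => mul_nonneg (Nat.cast_nonneg _) ENNReal.toReal_nonneg) hs]
  refine tsum_congr fun k => ?_
  rw [ENNReal.ofReal_mul (Nat.cast_nonneg _), ENNReal.ofReal_natCast, ENNReal.ofReal_toReal (hp k),
    mul_comm]

/-- The mean of `a + h(j)` under `κ i`. -/
lemma tsum_kernel_potential (hα : ∀ i j, Summable fun k : ℕ => (k : ℝ) * (κ i (k, j)).toReal)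
    {h : Fin N → ℝ} (hh : ∀ j, 0 ≤ h j) (i : Fin N) :
    ∑' a, κ i a * ((a.1 : ℝ≥0∞) + ENNReal.ofReal (h a.2)) =
      ENNReal.ofReal (∑ j, alpha κ i j + ∑ j, transitionMatrix κ i j * h j) := by
  rw [ENNReal.ofReal_add (Finset.sum_nonneg fun j _ => alpha_nonneg i j)
    (Finset.sum_nonneg fun j _ => mul_nonneg (transitionMatrix_nonneg κ i j) (hh j)),
    ENNReal.ofReal_sum_of_nonneg fun j _ => alpha_nonneg i j,
    ENNReal.ofReal_sum_of_nonneg fun j _ => mul_nonneg (transitionMatrix_nonneg κ i j) (hh j),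
    ← Finset.sum_add_distrib, tsum_prod_fin_ennreal]
  refine Finset.sum_congr rfl fun j _ => ?_
  simp only [mul_add]
  rw [ENNReal.tsum_add, tsum_natCast_mul_eq (fun k => (κ i).apply_ne_top _) (hα i j),
    ENNReal.tsum_mul_right, ENNReal.ofReal_mul (transitionMatrix_nonneg κ i j),
    transitionMatrix_apply, ENNReal.ofReal_tsum_of_nonneg (fun _ => ENNReal.toReal_nonneg)
      (summable_kernel κ i j)]
  simp only [ENNReal.ofReal_toReal ((κ i).apply_ne_top _)]
  rfl

lemma meanBatch_nonneg : 0 ≤ meanBatch β :=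
  tsum_nonneg fun _ => mul_nonneg (Nat.cast_nonneg _) ENNReal.toReal_nonneg

/-- The drift of the potential `x + h(i)` in one step of the chain. -/
lemma drift_step (hβ0 : β 0 = 0) (hβ : Summable fun b : ℕ => (b : ℝ) * (β b).toReal)
    (hα : ∀ i j, Summable fun k : ℕ => (k : ℝ) * (κ i (k, j)).toReal) {ρ : ℝ} (hρ : ρ < 1)
    {h : Fin N → ℝ} (hh : ∀ j, 0 ≤ h j)
    (hpoisson : ∀ i, h i = ∑ j, transitionMatrix κ i j * h j + (∑ j, alpha κ i j - ρ))
    (s : ℕ × Fin N) :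
    ∑' t, step κ β s t * ((t.1 : ℝ≥0∞) + ENNReal.ofReal (h t.2)) + ENNReal.ofReal (1 - ρ) =
      ((s.1 : ℝ≥0∞) + ENNReal.ofReal (h s.2)) +
        ENNReal.ofReal (meanBatch β) * if s.1 = 0 then 1 else 0 := by
  obtain ⟨x, i⟩ := s
  -- The Poisson equation in additive form, which avoids subtraction in `ℝ≥0∞`.
  have hmean : ∑' a, κ i a * ((a.1 : ℝ≥0∞) + ENNReal.ofReal (h a.2)) + ENNReal.ofReal (1 - ρ) =
      1 + ENNReal.ofReal (h i) := by
    rw [tsum_kernel_potential hα hh, ← ENNReal.ofReal_add _ (by linarith), ← ENNReal.ofReal_one,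
      ← ENNReal.ofReal_add zero_le_one (hh i)]
    · congr 1
      linarith [hpoisson i]
    · exact add_nonneg (Finset.sum_nonneg fun j _ => alpha_nonneg i j)
        (Finset.sum_nonneg fun j _ => mul_nonneg (transitionMatrix_nonneg κ i j) (hh j))
  rcases Nat.eq_zero_or_pos x with rfl | hx
  · have h2 : step κ β (0, i) = (κ i).bind fun a => β.map fun b => (a.1 + b - 1, a.2) := by
      simp [step]
    have hB : ∀ a : ℕ × Fin N, 1 + ∑' b, β b * (((a.1 + b - 1 : ℕ) : ℝ≥0∞) +
        ENNReal.ofReal (h a.2)) = ENNReal.ofReal (meanBatch β) +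
          ((a.1 : ℝ≥0∞) + ENNReal.ofReal (h a.2)) := by
      intro a
      rw [← lintegral_const_add, meanBatch, ← tsum_natCast_mul_eq (fun b => β.apply_ne_top b) hβ,
        add_comm, ← lintegral_const_add]
      refine tsum_congr fun b => ?_
      rcases Nat.eq_zero_or_pos b with rfl | hb
      · simp [hβ0]
      · congr 1
        have : (1 : ℝ≥0∞) + ((a.1 + b - 1 : ℕ) : ℝ≥0∞) = a.1 + b := by
          norm_cast
          omega
        rw [← add_assoc, this]
        ring
    have h3 : 1 + ∑' t, step κ β (0, i) t * ((t.1 : ℝ≥0∞) + ENNReal.ofReal (h t.2)) =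
        ENNReal.ofReal (meanBatch β) +
          ∑' a, κ i a * ((a.1 : ℝ≥0∞) + ENNReal.ofReal (h a.2)) := by
      rw [h2, lintegral_bind]
      simp only [lintegral_map]
      rw [← lintegral_const_add, ← lintegral_const_add]
      simp only [hB]
    have h4 := ENNReal.add_right_inj (a := 1) ENNReal.one_ne_top |>.1 (show
      1 + (∑' t, step κ β (0, i) t * ((t.1 : ℝ≥0∞) + ENNReal.ofReal (h t.2)) +
        ENNReal.ofReal (1 - ρ)) = 1 + (ENNReal.ofReal (h i) + ENNReal.ofReal (meanBatch β)) by
        rw [← add_assoc, h3, add_assoc, hmean]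
        ring)
    rw [h4]
    simp
  · have h2 : step κ β (x, i) = (κ i).map fun a => (x - 1 + a.1, a.2) := by
      simp [step, Nat.one_le_iff_ne_zero, hx.ne']
    have hx' : (x : ℝ≥0∞) = ((x - 1 : ℕ) : ℝ≥0∞) + 1 := by
      norm_cast
      omega
    rw [h2, lintegral_map]
    simp only [Nat.cast_add, add_assoc, hx.ne', if_false, mul_zero, add_zero]
    rw [lintegral_const_add, add_assoc, hmean, ← add_assoc, ← hx']

/-- The accumulated drift from a fixed initial state bounds the time spent at level `0`. -/
lemma exists_occupation_bound (hβ0 : β 0 = 0)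
    (hβ : Summable fun b : ℕ => (b : ℝ) * (β b).toReal)
    (hirr : (transitionMatrix κ).IsIrreducible) {π : Fin N → ℝ} (hπ : IsStationaryVector κ π)
    (hα : ∀ i j, Summable fun k : ℕ => (k : ℝ) * (κ i (k, j)).toReal) (hρ : load κ π < 1)
    (s : ℕ × Fin N) :
    ∃ C : ℝ, ∀ n : ℕ, n * (1 - load κ π) ≤
      C + meanBatch β * ∑ m ∈ Finset.range n, ∑ i, (stepN κ β m s (0, i)).toReal := by
  obtain ⟨h, hh, hpoisson⟩ := exists_poisson hirr (sum_transitionMatrix κ) hπ.vecMul hπ.sum_eq_one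
    (r := fun i => ∑ j, alpha κ i j - load κ π) (by
      simp only [dotProduct, mul_sub, Finset.sum_sub_distrib]
      rw [← Finset.sum_mul, hπ.sum_eq_one, one_mul, load]
      simp only [Finset.mul_sum, sub_self])
  set V : ℕ × Fin N → ℝ≥0∞ := fun t => (t.1 : ℝ≥0∞) + ENNReal.ofReal (h t.2)
  have hV : V s ≠ ⊤ := by simp [V]
  have hzero : ∀ m, ∑' t, stepN κ β m s t * (if t.1 = 0 then 1 else 0 : ℝ≥0∞) =
      ∑ i, stepN κ β m s (0, i) := by
    intro m
    rw [tsum_prod_fin_ennreal]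
    refine Finset.sum_congr rfl fun i _ => ?_
    rw [tsum_eq_single 0] <;> simp +contextual
  -- The drift identity telescopes; the bound follows by dropping the nonnegative mean potential at
  -- time `n`.
  have hrec : ∀ n : ℕ, ∑' t, stepN κ β n s t * V t + n * ENNReal.ofReal (1 - load κ π) =
      V s + ENNReal.ofReal (meanBatch β) *
        ∑ m ∈ Finset.range n, ∑ i, stepN κ β m s (0, i) := by
    intro n
    induction n with
    | zero => simp [stepN]
    | succ n ih =>
      have h1 : ∑' t, stepN κ β (n + 1) s t * V t + ENNReal.ofReal (1 - load κ π) =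
          ∑' t, stepN κ β n s t * V t +
            ENNReal.ofReal (meanBatch β) * ∑ i, stepN κ β n s (0, i) := by
        rw [stepN, lintegral_bind, add_comm, ← lintegral_const_add, ← hzero n,
          ← ENNReal.tsum_mul_left, ← ENNReal.tsum_add]
        refine tsum_congr fun t => ?_
        rw [add_comm, drift_step hβ0 hβ hα hρ hh hpoisson t]
        ring
      rw [Finset.sum_range_succ, mul_add, ← add_assoc, ← ih, Nat.cast_succ, add_mul, one_mul,
        add_comm _ (ENNReal.ofReal _), ← add_assoc, h1]
      ring
  refine ⟨(V s).toReal, fun n => ?_⟩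
  have hle : (n : ℝ≥0∞) * ENNReal.ofReal (1 - load κ π) ≤ V s + ENNReal.ofReal (meanBatch β) *
      ∑ m ∈ Finset.range n, ∑ i, stepN κ β m s (0, i) := (hrec n) ▸ le_add_self
  have hfin : ∀ m, ∑ i, stepN κ β m s (0, i) ≠ ⊤ := fun m =>
    ENNReal.sum_ne_top.2 fun i _ => (stepN κ β m s).apply_ne_top _
  have hfin' : ∑ m ∈ Finset.range n, ∑ i, stepN κ β m s (0, i) ≠ ⊤ :=
    ENNReal.sum_ne_top.2 fun m _ => hfin m
  have hmul := ENNReal.mul_ne_top (a := ENNReal.ofReal (meanBatch β)) ENNReal.ofReal_ne_top hfin'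
  have := ENNReal.toReal_mono (ENNReal.add_ne_top.2 ⟨hV, hmul⟩) hle
  rw [ENNReal.toReal_add hV hmul, ENNReal.toReal_mul, ENNReal.toReal_mul, ENNReal.toReal_natCast,
    ENNReal.toReal_ofReal (by linarith), ENNReal.toReal_ofReal meanBatch_nonneg,
    ENNReal.toReal_sum fun m _ => hfin m] at this
  simpa only [ENNReal.toReal_sum fun i _ => (stepN κ β _ s).apply_ne_top (0, i)] using this

end Chain

end

end SMQueue

namespace SMQueue

noncomputable section

/-! ### Real expectations -/

section RealExpect

variable {α γ : Type*}

/-- The expectation of a real function under a probability mass function. -/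
def rexpect (p : PMF α) (f : α → ℝ) : ℝ := ∑' s, (p s).toReal * f s

lemma expect_ofReal (p : PMF α) (f : α → ℝ) : expect p (fun s => (f s : ℂ)) = rexpect p f := by
  simp [expect, rexpect, Complex.ofReal_tsum]

variable {f : α → ℝ} {C : ℝ}

lemma summable_rexpect (p : PMF α) (hf : ∀ s, |f s| ≤ C) : Summable fun s => (p s).toReal * f s := by
  refine .of_norm_bounded ((summable_toReal p).mul_right C) fun s => ?_
  rw [norm_mul, Real.norm_of_nonneg ENNReal.toReal_nonneg]
  exact mul_le_mul_of_nonneg_left (hf s) ENNReal.toReal_nonneg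

lemma rexpect_bind (p : PMF γ) (k : γ → PMF α) (hf : ∀ s, |f s| ≤ C) :
    rexpect (p.bind k) f = rexpect p fun s => rexpect (k s) f := by
  have h := expect_bind p k (g := fun s => (f s : ℂ)) (C := C) fun s => by simpa using hf s
  simp only [expect_ofReal] at h
  exact_mod_cast h

lemma rexpect_const (p : PMF α) (c : ℝ) : rexpect p (fun _ => c) = c := by
  rw [rexpect, tsum_mul_right, tsum_toReal, one_mul]

lemma rexpect_const_mul (p : PMF α) (c : ℝ) (f : α → ℝ) :
    rexpect p (fun s => c * f s) = c * rexpect p f := by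
  rw [rexpect, rexpect, ← tsum_mul_left]
  exact tsum_congr fun s => mul_left_comm _ _ _

lemma rexpect_add (p : PMF α) {f' : α → ℝ} {C' : ℝ} (hf : ∀ s, |f s| ≤ C) (hf' : ∀ s, |f' s| ≤ C') :
    rexpect p (fun s => f s + f' s) = rexpect p f + rexpect p f' := by
  rw [rexpect, rexpect, rexpect, ← (summable_rexpect p hf).tsum_add (summable_rexpect p hf')]
  exact tsum_congr fun s => mul_add _ _ _

lemma rexpect_sum {ι : Type*} (S : Finset ι) (p : PMF α) {F : ι → α → ℝ}
    (hF : ∀ i s, |F i s| ≤ C) :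
    rexpect p (fun s => ∑ i ∈ S, F i s) = ∑ i ∈ S, rexpect p (F i) := by
  simp only [rexpect, Finset.mul_sum]
  exact Summable.tsum_finsetSum fun i _ => summable_rexpect p (hF i)

lemma rexpect_mono (p : PMF α) {f' : α → ℝ} {C' : ℝ} (hf : ∀ s, |f s| ≤ C)
    (hf' : ∀ s, |f' s| ≤ C') (h : ∀ s, f s ≤ f' s) : rexpect p f ≤ rexpect p f' :=
  (summable_rexpect p hf).tsum_le_tsum
    (fun s => mul_le_mul_of_nonneg_left (h s) ENNReal.toReal_nonneg) (summable_rexpect p hf')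

lemma rexpect_nonneg (p : PMF α) (h : ∀ s, 0 ≤ f s) : 0 ≤ rexpect p f :=
  tsum_nonneg fun s => mul_nonneg ENNReal.toReal_nonneg (h s)

lemma rexpect_le (p : PMF α) (hf : ∀ s, |f s| ≤ C) : rexpect p f ≤ C := by
  rw [← rexpect_const p C]
  exact rexpect_mono p (C' := |C|) hf (fun _ => le_rfl) fun s => (le_abs_self _).trans (hf s)

lemma norm_expect_le_rexpect (p : PMF α) {g : α → ℂ} (hg : ∀ s, ‖g s‖ ≤ C) :
    ‖expect p g‖ ≤ rexpect p fun s => ‖g s‖ := by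
  refine tsum_of_norm_bounded (summable_rexpect p (f := fun s => ‖g s‖) (C := C)
    fun s => by simpa using hg s).hasSum fun s => ?_
  rw [norm_mul, Complex.norm_real, Real.norm_of_nonneg ENNReal.toReal_nonneg]

lemma tendsto_rexpect {ι : Type*} {l : Filter ι} (p : PMF α) {F : ι → α → ℝ}
    (hF : ∀ i s, |F i s| ≤ C) (h : ∀ s, Tendsto (fun i => F i s) l (𝓝 (f s))) :
    Tendsto (fun i => rexpect p (F i)) l (𝓝 (rexpect p f)) := by
  refine tendsto_tsum_of_dominated_convergence ((summable_toReal p).mul_right C)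
    (fun s => (h s).const_mul _) (.of_forall fun i s => ?_)
  rw [norm_mul, Real.norm_of_nonneg ENNReal.toReal_nonneg]
  exact mul_le_mul_of_nonneg_left (hF i s) ENNReal.toReal_nonneg

lemma tendsto_expect {ι : Type*} {l : Filter ι} (p : PMF α) {F : ι → α → ℂ} {g : α → ℂ}
    (hF : ∀ i s, ‖F i s‖ ≤ C) (h : ∀ s, Tendsto (fun i => F i s) l (𝓝 (g s))) :
    Tendsto (fun i => expect p (F i)) l (𝓝 (expect p g)) :=
  tendsto_tsum_of_dominated_convergence ((summable_toReal p).mul_right C)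
    (fun s => (h s).const_mul _) (.of_forall fun i s => norm_expect_term_le p (hF i) s)

/-- A bounded subharmonic function is constant along the transitions of a stationary chain. -/
lemma eq_of_subharmonic_of_stationary {ν : PMF α} {K : α → PMF α} (hν : ν.bind K = ν)
    (hf0 : ∀ s, 0 ≤ f s) (hfC : ∀ s, f s ≤ C) (hsub : ∀ s, f s ≤ rexpect (K s) f)
    {s t : α} (hs : ν s ≠ 0) (ht : K s t ≠ 0) : f t = f s := by
  have hC0 : 0 ≤ C := (hf0 s).trans (hfC s)
  have hf : ∀ s, |f s| ≤ C := fun s => by rw [abs_of_nonneg (hf0 s)]; exact hfC s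
  have hsq : ∀ s, |f s ^ 2| ≤ C ^ 2 := fun s => by
    rw [abs_pow]; exact pow_le_pow_left₀ (abs_nonneg _) (hf s) 2
  have hdiff : ∀ s t, |(f t - f s) ^ 2| ≤ C ^ 2 := fun s t => by
    rw [abs_pow]
    refine pow_le_pow_left₀ (abs_nonneg _) (abs_le.2 ⟨?_, ?_⟩) 2 <;>
      linarith [hf0 s, hf0 t, hfC s, hfC t]
  -- Subharmonicity and `f ≥ 0` give `D ≤ K(f²) - f²`, whose `ν`-mean vanishes by stationarity; so
  -- `f` does not move along charged transitions.
  set D : α → ℝ := fun s => rexpect (K s) fun t => (f t - f s) ^ 2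
  have hD0 : ∀ s, 0 ≤ D s := fun s => rexpect_nonneg _ fun t => sq_nonneg _
  have hDC : ∀ s, |D s| ≤ C ^ 2 := fun s => by
    rw [abs_of_nonneg (hD0 s)]
    exact rexpect_le _ (hdiff s)
  have hDle : ∀ s, D s + f s ^ 2 ≤ rexpect (K s) fun t => f t ^ 2 := by
    intro s
    have h1 : D s = (rexpect (K s) fun t => f t ^ 2) + ((-2 * f s) * rexpect (K s) f + f s ^ 2) := by
      have hb1 : ∀ t, |-2 * f s * f t| ≤ 2 * C * C := fun t => by
        rw [abs_mul, abs_mul, abs_neg, abs_two]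
        gcongr
        exacts [hf s, hf t]
      have hb2 : ∀ t, |-2 * f s * f t + f s ^ 2| ≤ 2 * C * C + C ^ 2 := fun t =>
        (abs_add_le _ _).trans (add_le_add (hb1 t) (hsq s))
      rw [← rexpect_const (K s) (f s ^ 2), ← rexpect_const_mul,
        ← rexpect_add _ hb1 (fun _ => hsq s), ← rexpect_add _ hsq hb2]
      exact congrArg (rexpect (K s)) (funext fun t => by ring)
    have := mul_le_mul_of_nonneg_left (hsub s) (hf0 s)
    rw [h1]
    nlinarith
  have h2 : rexpect ν D ≤ 0 := by
    have h3 := rexpect_mono ν (f := fun s => D s + f s ^ 2) (C := C ^ 2 + C ^ 2)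
      (f' := fun s => rexpect (K s) fun t => f t ^ 2) (C' := C ^ 2)
      (fun s => (abs_add_le _ _).trans (add_le_add (hDC s) (hsq s)))
      (fun s => by
        rw [abs_of_nonneg (rexpect_nonneg _ fun t => sq_nonneg _)]
        exact rexpect_le _ hsq) hDle
    rw [rexpect_add ν hDC hsq, ← rexpect_bind ν K hsq, hν] at h3
    linarith
  have hzero : ∀ {p : PMF α} {F : α → ℝ} {C' : ℝ}, (∀ s, 0 ≤ F s) → (∀ s, |F s| ≤ C') →
      rexpect p F ≤ 0 → ∀ s, p s ≠ 0 → F s = 0 := by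
    intro p F C' hF0 hFC hle s hps
    have h3 : HasSum (fun s => (p s).toReal * F s) (rexpect p F) := (summable_rexpect p hFC).hasSum
    rw [le_antisymm hle (rexpect_nonneg p hF0)] at h3
    have h4 := (hasSum_zero_iff_of_nonneg
      fun s => mul_nonneg ENNReal.toReal_nonneg (hF0 s)).1 h3
    exact (mul_eq_zero.1 (congrFun h4 s)).resolve_left
      (ENNReal.toReal_ne_zero.2 ⟨hps, p.apply_ne_top s⟩)
  have h5 : D s = 0 := hzero hD0 hDC h2 s hs
  have h6 := hzero (fun t => sq_nonneg _) (hdiff s) h5.le t ht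
  exact sub_eq_zero.1 (pow_eq_zero_iff two_ne_zero |>.1 h6)

end RealExpect

/-! ### The limit superior of a bounded sequence -/

section TailLim

/-- The limit superior of a bounded real sequence. -/
def tailLim (F : ℕ → ℝ) : ℝ := ⨅ k, ⨆ n, F (k + n)

variable {F : ℕ → ℝ} {C : ℝ}

lemma bddAbove_tail (hC : ∀ n, F n ≤ C) (k : ℕ) : BddAbove (Set.range fun n => F (k + n)) :=
  ⟨C, by rintro _ ⟨n, rfl⟩; exact hC _⟩

lemma le_tailSup (hC : ∀ n, F n ≤ C) {k n : ℕ} (h : k ≤ n) : F n ≤ ⨆ n, F (k + n) := by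
  obtain ⟨m, rfl⟩ := Nat.exists_eq_add_of_le h
  exact le_ciSup (bddAbove_tail hC k) m

lemma tailSup_nonneg (h0 : ∀ n, 0 ≤ F n) (hC : ∀ n, F n ≤ C) (k : ℕ) : 0 ≤ ⨆ n, F (k + n) :=
  (h0 k).trans (le_tailSup hC le_rfl)

lemma tailSup_le (hC : ∀ n, F n ≤ C) (k : ℕ) : ⨆ n, F (k + n) ≤ C :=
  ciSup_le fun _ => hC _

lemma tendsto_tailSup (h0 : ∀ n, 0 ≤ F n) (hC : ∀ n, F n ≤ C) :
    Tendsto (fun k => ⨆ n, F (k + n)) atTop (𝓝 (tailLim F)) := by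
  refine tendsto_atTop_ciInf (fun k l hkl => ciSup_le fun n => le_tailSup hC (by omega)) ?_
  exact ⟨0, by rintro _ ⟨k, rfl⟩; exact tailSup_nonneg h0 hC k⟩

lemma tailLim_nonneg (h0 : ∀ n, 0 ≤ F n) (hC : ∀ n, F n ≤ C) : 0 ≤ tailLim F :=
  le_ciInf fun k => tailSup_nonneg h0 hC k

lemma tailLim_le (h0 : ∀ n, 0 ≤ F n) (hC : ∀ n, F n ≤ C) : tailLim F ≤ C :=
  le_of_tendsto' (tendsto_tailSup h0 hC) (tailSup_le hC)

lemma tendsto_zero_of_tailLim (h0 : ∀ n, 0 ≤ F n) (hC : ∀ n, F n ≤ C) (h : tailLim F = 0) :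
    Tendsto F atTop (𝓝 0) :=
  squeeze_zero h0 (fun _ => le_tailSup hC le_rfl) (h ▸ tendsto_tailSup h0 hC)

/-- A reverse Fatou lemma. -/
lemma tailLim_le_rexpect {α : Type*} (p : PMF α) {E : ℕ → α → ℝ} (hE0 : ∀ n s, 0 ≤ E n s)
    (hEC : ∀ n s, E n s ≤ C) (h0 : ∀ n, 0 ≤ F n) (hC : ∀ n, F n ≤ C) {m : ℕ}
    (h : ∀ n, F (m + n) ≤ rexpect p (E n)) :
    tailLim F ≤ rexpect p fun s => tailLim fun n => E n s := by
  have hsup : ∀ k s, |⨆ n, E (k + n) s| ≤ C := fun k s => by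
    rw [abs_of_nonneg (tailSup_nonneg (F := fun n => E n s) (fun n => hE0 n s) (fun n => hEC n s) k)]
    exact tailSup_le (F := fun n => E n s) (fun n => hEC n s) k
  have h1 := tendsto_rexpect p hsup fun s =>
    tendsto_tailSup (F := fun n => E n s) (fun n => hE0 n s) fun n => hEC n s
  have h2 : Tendsto (fun k => ⨆ n, F (m + k + n)) atTop (𝓝 (tailLim F)) :=
    (tendsto_tailSup h0 hC).comp (tendsto_atTop_mono (fun k => Nat.le_add_left k m) tendsto_id)
  refine le_of_tendsto_of_tendsto' h2 h1 fun k => ciSup_le fun n => ?_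
  rw [add_assoc]
  refine (h (k + n)).trans (rexpect_mono p (C := C) (fun s => ?_) (hsup k) fun s => ?_)
  · rw [abs_of_nonneg (hE0 _ s)]
    exact hEC _ s
  · exact le_tailSup (F := fun n => E n s) (fun n => hEC n s) (Nat.le_add_right k n)

end TailLim

/-! ### The product of two independent copies -/

section Product

variable {α : Type*}

/-- The product of two probability mass functions. -/
def prodPMF (p p' : PMF α) : PMF (α × α) := p.bind fun a => p'.map (Prod.mk a)

lemma prodPMF_apply (p p' : PMF α) (x : α × α) : prodPMF p p' x = p x.1 * p' x.2 := by
  classical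
  obtain ⟨a, b⟩ := x
  rw [prodPMF, PMF.bind_apply, tsum_eq_single a]
  · rw [PMF.map_apply, tsum_eq_single b]
    · simp
    · intro b' hb'
      simp [hb'.symm]
  · intro a' ha'
    simp [PMF.map_apply, ha'.symm]

lemma prodPMF_bind (μ : PMF α) (k : α → PMF α) (h : μ.bind k = μ) :
    (prodPMF μ μ).bind (fun x => prodPMF (k x.1) (k x.2)) = prodPMF μ μ := by
  ext ⟨a, b⟩
  have h1 : ∀ a, ∑' s, μ s * k s a = μ a := fun a => by rw [← PMF.bind_apply, h]
  rw [PMF.bind_apply, ENNReal.tsum_prod']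
  simp only [prodPMF_apply]
  calc ∑' s, ∑' t, μ s * μ t * (k s a * k t b)
      = ∑' s, (μ s * k s a) * ∑' t, μ t * k t b := by
        refine tsum_congr fun s => ?_
        rw [← ENNReal.tsum_mul_left]
        exact tsum_congr fun t => by ring
    _ = μ a * μ b := by rw [ENNReal.tsum_mul_right, h1, h1]

lemma expect_prodPMF_sub (p p' : PMF α) {g : α → ℂ} {C : ℝ} (hg : ∀ s, ‖g s‖ ≤ C) :
    expect (prodPMF p p') (fun x => g x.1 - g x.2) = expect p g - expect p' g := by
  have h2 : ∀ x : α × α, ‖g x.1 - g x.2‖ ≤ C + C := fun x =>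
    (norm_sub_le _ _).trans (add_le_add (hg _) (hg _))
  have hE : ∀ a : α, ‖expect p' g‖ ≤ C := fun _ => norm_expect_le p' hg
  rw [prodPMF, expect_bind _ _ h2]
  simp only [expect_map _ _ h2]
  rw [← expect_const p (expect p' g), ← expect_sub p hg hE]
  congr 1
  ext a
  rw [expect_sub p' (fun _ => hg a) hg, expect_const]

end Product

end

end SMQueue

namespace SMQueue

noncomputable section

/-! ### Mass of limits of the laws of the chain -/

section SteadyState

variable {N : ℕ} {κ : Fin N → PMF (ℕ × Fin N)} {β : PMF ℕ}

lemma one_le_meanBatch (hβ0 : β 0 = 0) (hβ : Summable fun b : ℕ => (b : ℝ) * (β b).toReal) :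
    1 ≤ meanBatch β := by
  rw [← tsum_toReal β]
  refine (summable_toReal β).tsum_le_tsum (fun b => ?_) hβ
  rcases Nat.eq_zero_or_pos b with rfl | hb
  · simp [hβ0]
  · exact le_mul_of_one_le_left ENNReal.toReal_nonneg (by exact_mod_cast hb)

/-- A sub-probability solution of the steady-state equations with enough mass at level `0` is a
probability. -/
lemma mass_eq (hβ : Summable fun b : ℕ => (b : ℝ) * (β b).toReal)
    (hirr : (transitionMatrix κ).IsIrreducible) {π : Fin N → ℝ} (hπ : IsStationaryVector κ π)
    (hα : ∀ i j, Summable fun k : ℕ => (k : ℝ) * (κ i (k, j)).toReal) (hρ : load κ π < 1)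
    {q : ℕ × Fin N → ℝ} (hq0 : ∀ s, 0 ≤ q s) (hqs : Summable q) (hq1 : ∑' s, q s ≤ 1)
    (hlow : 1 - load κ π ≤ meanBatch β * ∑ i, q (0, i))
    (heq : ∀ (j : Fin N) (z : ℂ), ‖z‖ < 1 → z * genFun (fun x => q (x, j)) z =
      ∑ i, Agf κ i j z * (genFun (fun x => q (x, i)) z + (Bgf β z - 1) * q (0, i))) :
    (∑' s, q s = 1) ∧ meanBatch β * ∑ i, q (0, i) = 1 - load κ π := by
  set g : Fin N → ℝ := fun j => ∑' x, q (x, j)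
  have hgs : ∀ j, Summable fun x => q (x, j) := fun j =>
    hqs.comp_injective (Prod.mk_left_injective j)
  have hgsum : ∑' s, q s = ∑ j, g j := tsum_prod_fin hqs
  have hG : ∀ j, Tendsto (fun x : ℝ => genFun (fun x => q (x, j)) x) (𝓝[<] 1) (𝓝 (g j)) := fun j =>
    tendsto_genFun_one (fun x => hq0 _) (hgs j)
  have hA : ∀ i j, Tendsto (fun x : ℝ => Agf κ i j x) (𝓝[<] 1) (𝓝 (transitionMatrix κ i j)) :=
    fun i j => tendsto_genFun_one (fun _ => ENNReal.toReal_nonneg) (summable_kernel κ i j)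
  have hB : Tendsto (fun x : ℝ => Bgf β x) (𝓝[<] 1) (𝓝 1) := by
    have := tendsto_genFun_one (a := fun b => (β b).toReal) (fun _ => ENNReal.toReal_nonneg)
      (summable_toReal β)
    rwa [tsum_toReal, Complex.ofReal_one] at this
  have hx : Tendsto (fun x : ℝ => (x : ℂ)) (𝓝[<] 1) (𝓝 1) :=
    (Complex.continuous_ofReal.tendsto' 1 1 (by simp)).mono_left nhdsWithin_le_nhds
  have heq' : ∀ᶠ x : ℝ in 𝓝[<] 1, ∀ j, (x : ℂ) * genFun (fun x => q (x, j)) x =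
      ∑ i, Agf κ i j x * (genFun (fun x => q (x, i)) x + (Bgf β x - 1) * q (0, i)) := by
    filter_upwards [Ioo_mem_nhdsLT (zero_lt_one' ℝ)] with x hx j
    exact heq j x (by simpa [abs_of_pos hx.1] using hx.2)
  -- Zeroth order at `z = 1`: the `B(z) - 1` term disappears, so `g` is a multiple of `π`.
  have hleft : g ᵥ* transitionMatrix κ = g := by
    ext j
    have h1 := tendsto_nhds_unique ((hx.mul (hG j)).congr' (heq'.mono fun x hx => hx j))
      (tendsto_finsetSum _ fun i _ => (hA i j).mul
        ((hG i).add ((hB.sub_const 1).mul_const (q (0, i) : ℂ))))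
    simp only [sub_self, zero_mul, add_zero, one_mul] at h1
    have h2 : (g j : ℂ) = ((∑ i, transitionMatrix κ i j * g i : ℝ) : ℂ) := by
      rw [h1]; push_cast; rfl
    rw [Complex.ofReal_inj] at h2
    simp only [Matrix.vecMul, dotProduct]
    rw [h2]
    exact Finset.sum_congr rfl fun i _ => mul_comm _ _
  have hgπ := eq_smul_of_vecMul_eq hirr (sum_transitionMatrix κ) hπ.vecMul hπ.sum_eq_one hleft
  have hAs : ∀ i j, Tendsto (fun x : ℝ => (Agf κ i j 1 - Agf κ i j x) / (1 - x)) (𝓝[<] 1)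
      (𝓝 (alpha κ i j : ℂ)) := fun i j =>
    tendsto_genFun_slope_one (fun _ => ENNReal.toReal_nonneg) (summable_kernel κ i j) (hα i j)
  have hBs : Tendsto (fun x : ℝ => (Bgf β 1 - Bgf β x) / (1 - x)) (𝓝[<] 1) (𝓝 (meanBatch β : ℂ)) :=
    tendsto_genFun_slope_one (fun _ => ENNReal.toReal_nonneg) (summable_toReal β) hβ
  -- First order at `z = 1`: summing the equations over `j` and dividing by `1 - x` brings in the
  -- slopes `α_ij` and `E[B]`.
  have hsumeq : ∀ᶠ x : ℝ in 𝓝[<] 1,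
      ∑ i, (∑ j, (Agf κ i j 1 - Agf κ i j x) / (1 - x)) * genFun (fun x => q (x, i)) x =
      ∑ i, genFun (fun x => q (x, i)) x -
        (Bgf β 1 - Bgf β x) / (1 - x) * ∑ i, (∑ j, Agf κ i j x) * q (0, i) := by
    filter_upwards [heq', self_mem_nhdsWithin] with x hx hx1
    have hne : (1 : ℂ) - x ≠ 0 := by
      rw [sub_ne_zero]
      exact_mod_cast (ne_of_lt hx1).symm
    have h1 := Finset.sum_congr rfl fun j (_ : j ∈ Finset.univ) => hx j
    rw [Finset.sum_comm, ← Finset.mul_sum] at h1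
    have h2 : ∀ i, ∑ j, (Agf κ i j 1 - Agf κ i j x) / (1 - x) =
        (1 - ∑ j, Agf κ i j x) / (1 - x) := by
      intro i
      rw [← Finset.sum_div, Finset.sum_sub_distrib]
      congr 2
      simp only [Agf_one, ← Complex.ofReal_sum, sum_transitionMatrix, Complex.ofReal_one]
    simp only [h2, ← Finset.sum_mul, mul_add, Finset.sum_add_distrib] at h1 ⊢
    rw [Bgf_one]
    have h3 : ∑ i, (1 - ∑ j, Agf κ i j x) / (1 - x) * genFun (fun x => q (x, i)) x =
        (∑ i, genFun (fun x => q (x, i)) x -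
          ∑ i, (∑ j, Agf κ i j x) * genFun (fun x => q (x, i)) x) / (1 - x) := by
      rw [← Finset.sum_sub_distrib, Finset.sum_div]
      exact Finset.sum_congr rfl fun i _ => by ring
    have h4 : ∑ i, (∑ j, Agf κ i j x) * ((Bgf β x - 1) * (q (0, i) : ℂ)) =
        (Bgf β x - 1) * ∑ i, (∑ j, Agf κ i j x) * q (0, i) := by
      rw [Finset.mul_sum]
      exact Finset.sum_congr rfl fun i _ => by ring
    rw [h4] at h1
    rw [h3]
    field_simp
    linear_combination h1
  have hlim := tendsto_nhds_unique
    ((tendsto_finsetSum Finset.univ fun i _ =>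
      (tendsto_finsetSum Finset.univ fun j _ => hAs i j).mul (hG i)).congr' hsumeq)
    ((tendsto_finsetSum Finset.univ fun i _ => hG i).sub
      (hBs.mul (tendsto_finsetSum Finset.univ fun i _ =>
        (tendsto_finsetSum Finset.univ fun j _ => hA i j).mul_const (q (0, i) : ℂ))))
  have hreal : ∑ i, (∑ j, alpha κ i j) * g i =
      ∑ i, g i - meanBatch β * ∑ i, (∑ j, transitionMatrix κ i j) * q (0, i) := by
    exact_mod_cast hlim
  simp only [sum_transitionMatrix, one_mul] at hreal
  set γ := ∑ i, g i
  have hload : ∑ i, (∑ j, alpha κ i j) * g i = γ * load κ π := by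
    rw [load, Finset.mul_sum]
    refine Finset.sum_congr rfl fun i _ => ?_
    rw [hgπ i, ← Finset.mul_sum]
    ring
  rw [hload] at hreal
  have hγ1 : γ ≤ 1 := hgsum ▸ hq1
  -- The first-order relation says `E[B] ∑ q(0, i) = γ (1 - ρ)`, so `γ < 1` would contradict `hlow`.
  have hγ : γ = 1 := le_antisymm hγ1 (by
    by_contra! hlt
    nlinarith)
  rw [hgsum]
  refine ⟨hγ, ?_⟩
  rw [hγ] at hreal
  linarith

/-- Sequences of sub-probabilities have cluster points, with convergence of the generating
functions. -/
lemma exists_limit_along_ultrafilter (U : Ultrafilter ℕ) {a : ℕ → ℕ × Fin N → ℝ}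
    (ha0 : ∀ n s, 0 ≤ a n s) (has : ∀ n, Summable (a n)) (ha1 : ∀ n, ∑' s, a n s ≤ 1) :
    ∃ q : ℕ × Fin N → ℝ, (∀ s, 0 ≤ q s) ∧ Summable q ∧ ∑' s, q s ≤ 1 ∧
      (∀ s, Tendsto (fun n => a n s) U (𝓝 (q s))) ∧
      ∀ (j : Fin N) (z : ℂ), ‖z‖ < 1 → Tendsto (fun n => genFun (fun x => a n (x, j)) z) U
        (𝓝 (genFun (fun x => q (x, j)) z)) := by
  have hle : ∀ n s, a n s ≤ 1 := fun n s =>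
    ((has n).le_tsum s fun t _ => ha0 n t).trans (ha1 n)
  have hex : ∀ s, ∃ y : ℝ, Tendsto (fun n => a n s) U (𝓝 y) := fun s => by
    obtain ⟨y, -, hy⟩ := (isCompact_Icc (a := (0 : ℝ)) (b := 1)).ultrafilter_le_nhds
      (U.map fun n => a n s) (by
        rw [Ultrafilter.coe_map]
        exact tendsto_principal.2 (.of_forall fun n => ⟨ha0 n s, hle n s⟩))
    exact ⟨y, hy⟩
  choose q hq using hex
  have hq0 : ∀ s, 0 ≤ q s := fun s => ge_of_tendsto' (hq s) fun n => ha0 n s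
  have hfin : ∀ F : Finset (ℕ × Fin N), ∑ s ∈ F, q s ≤ 1 := fun F =>
    le_of_tendsto' (tendsto_finsetSum F fun s _ => hq s) fun n =>
      ((has n).sum_le_tsum F fun t _ => ha0 n t).trans (ha1 n)
  have hqs : Summable q := summable_of_sum_le hq0 hfin
  refine ⟨q, hq0, hqs, hqs.tsum_le_of_sum_le hfin, hq, fun j z hz => ?_⟩
  -- Domination by `|z|^x` works only inside the disc; at `|z| = 1` mass could still escape to
  -- infinity.
  refine tendsto_tsum_of_dominated_convergence (summable_geometric_of_lt_one (norm_nonneg z) hz)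
    (fun x => ((Complex.continuous_ofReal.tendsto _).comp (hq (x, j))).mul_const _)
    (.of_forall fun n x => ?_)
  rw [norm_mul, norm_pow, Complex.norm_real, Real.norm_of_nonneg (ha0 n _)]
  exact mul_le_of_le_one_left (by positivity) (hle n _)

/-- Both have total mass `1`, which leaves no room for a strict inequality. -/
lemma PMF_eq_of_le {α : Type*} {p p' : PMF α} (h : ∀ s, p s ≤ p' s) : p = p' := by
  by_contra hne
  obtain ⟨s, hs⟩ : ∃ s, p s ≠ p' s := by
    by_contra! hall
    exact hne (PMF.ext hall)
  have := ENNReal.tsum_lt_tsum (p.tsum_coe_ne_top) h (lt_of_le_of_ne (h s) hs)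
  rw [p.tsum_coe, p'.tsum_coe] at this
  exact lt_irrefl _ this

end SteadyState

end

end SMQueue

namespace SMQueue

noncomputable section

/-! ### Existence of a stationary distribution from time averages -/

section Existence

variable {N : ℕ} {κ : Fin N → PMF (ℕ × Fin N)} {β : PMF ℕ}

lemma norm_lawGF_le (p : PMF (ℕ × Fin N)) (j : Fin N) {z : ℂ} (hz : ‖z‖ ≤ 1) :
    ‖lawGF p j z‖ ≤ 1 := by
  rw [← expect_testFun p j hz]
  exact norm_expect_le p (norm_testFun_le j hz)

lemma tendsto_inv_succ : Tendsto (fun n : ℕ => ((n : ℝ) + 1)⁻¹) atTop (𝓝 0) := by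
  simpa using tendsto_one_div_add_atTop_nhds_zero_nat (𝕜 := ℝ)

/-- The time average of the first `n + 1` laws of the chain started at `s`. -/
def avgLaw (κ : Fin N → PMF (ℕ × Fin N)) (β : PMF ℕ) (s : ℕ × Fin N) (n : ℕ)
    (t : ℕ × Fin N) : ℝ :=
  ((n : ℝ) + 1)⁻¹ * ∑ m ∈ Finset.range (n + 1), (stepN κ β m s t).toReal

lemma avgLaw_nonneg (s : ℕ × Fin N) (n : ℕ) (t : ℕ × Fin N) : 0 ≤ avgLaw κ β s n t :=
  mul_nonneg (by positivity) (Finset.sum_nonneg fun _ _ => ENNReal.toReal_nonneg)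

lemma summable_avgLaw (s : ℕ × Fin N) (n : ℕ) : Summable (avgLaw κ β s n) :=
  (summable_sum fun m _ => summable_toReal (stepN κ β m s)).mul_left _

lemma tsum_avgLaw (s : ℕ × Fin N) (n : ℕ) : ∑' t, avgLaw κ β s n t = 1 := by
  simp only [avgLaw]
  rw [tsum_mul_left, Summable.tsum_finsetSum fun m _ => summable_toReal (stepN κ β m s)]
  simp only [tsum_toReal, Finset.sum_const, Finset.card_range, nsmul_eq_mul, mul_one]
  push_cast
  exact inv_mul_cancel₀ (by positivity)

lemma genFun_avgLaw (s : ℕ × Fin N) (n : ℕ) (j : Fin N) {z : ℂ} (hz : ‖z‖ ≤ 1) :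
    genFun (fun x => avgLaw κ β s n (x, j)) z =
      (((n : ℝ) + 1)⁻¹ : ℝ) * ∑ m ∈ Finset.range (n + 1), lawGF (stepN κ β m s) j z := by
  simp only [genFun, avgLaw, lawGF]
  rw [← Summable.tsum_finsetSum fun m _ =>
    summable_genFun (fun _ => ENNReal.toReal_nonneg) (summable_slice (stepN κ β m s) j) hz,
    ← tsum_mul_left]
  refine tsum_congr fun x => ?_
  push_cast
  rw [mul_assoc, Finset.sum_mul]

/-- The time averages satisfy the steady-state equations up to a vanishing error. -/
lemma mul_genFun_avgLaw (hβ0 : β 0 = 0) (s : ℕ × Fin N) (n : ℕ) (j : Fin N) {z : ℂ}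
    (hz : ‖z‖ ≤ 1) :
    z * (genFun (fun x => avgLaw κ β s n (x, j)) z + (((n : ℝ) + 1)⁻¹ : ℝ) *
        (lawGF (stepN κ β (n + 1) s) j z - lawGF (stepN κ β 0 s) j z)) =
      ∑ i, Agf κ i j z * (genFun (fun x => avgLaw κ β s n (x, i)) z +
        (Bgf β z - 1) * avgLaw κ β s n (0, i)) := by
  have h1 : genFun (fun x => avgLaw κ β s n (x, j)) z + (((n : ℝ) + 1)⁻¹ : ℝ) *
      (lawGF (stepN κ β (n + 1) s) j z - lawGF (stepN κ β 0 s) j z) =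
      (((n : ℝ) + 1)⁻¹ : ℝ) *
        ∑ m ∈ Finset.range (n + 1), lawGF ((stepN κ β m s).bind (step κ β)) j z := by
    have h2 := Finset.sum_range_succ (fun m => lawGF (stepN κ β m s) j z) (n + 1)
    rw [Finset.sum_range_succ'] at h2
    have h3 : ∀ m, lawGF ((stepN κ β m s).bind (step κ β)) j z =
        lawGF (stepN κ β (m + 1) s) j z := fun m => rfl
    rw [genFun_avgLaw s n j hz]
    simp only [h3]
    linear_combination (-(((n : ℝ) + 1)⁻¹ : ℝ) : ℂ) * h2
  rw [h1, mul_left_comm, Finset.mul_sum]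
  simp only [mul_lawGF_bind_step hβ0 _ j hz, genFun_avgLaw s n _ hz]
  rw [Finset.sum_comm, Finset.mul_sum]
  refine Finset.sum_congr rfl fun i _ => ?_
  rw [← Finset.mul_sum, Finset.sum_add_distrib, ← Finset.mul_sum, avgLaw]
  push_cast
  ring

/-- A shift in time changes the average only through its end terms. Finite sums are used because
they survive pointwise limits. -/
lemma avgLaw_step_le (s : ℕ × Fin N) (n : ℕ) (t : ℕ × Fin N) (F : Finset (ℕ × Fin N)) :
    ∑ u ∈ F, avgLaw κ β s n u * (step κ β u t).toReal ≤
      avgLaw κ β s n t + ((n : ℝ) + 1)⁻¹ := by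
  have h1 : ∀ m, ∑ u ∈ F, (stepN κ β m s u).toReal * (step κ β u t).toReal ≤
      (stepN κ β (m + 1) s t).toReal := by
    intro m
    have h2 : ∑ u ∈ F, stepN κ β m s u * step κ β u t ≤ stepN κ β (m + 1) s t := by
      rw [stepN, PMF.bind_apply]
      exact ENNReal.sum_le_tsum F
    have h3 := ENNReal.toReal_mono ((stepN κ β (m + 1) s).apply_ne_top t) h2
    rw [ENNReal.toReal_sum fun u _ => ENNReal.mul_ne_top (PMF.apply_ne_top _ _)
      (PMF.apply_ne_top _ _)] at h3
    simpa only [ENNReal.toReal_mul] using h3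
  have h4 : ∑ u ∈ F, avgLaw κ β s n u * (step κ β u t).toReal = ((n : ℝ) + 1)⁻¹ *
      ∑ m ∈ Finset.range (n + 1), ∑ u ∈ F, (stepN κ β m s u).toReal * (step κ β u t).toReal := by
    rw [Finset.sum_comm, Finset.mul_sum]
    refine Finset.sum_congr rfl fun u _ => ?_
    rw [avgLaw, mul_assoc, Finset.sum_mul]
  have h5 : ∑ m ∈ Finset.range (n + 1), (stepN κ β (m + 1) s t).toReal ≤
      ∑ m ∈ Finset.range (n + 1), (stepN κ β m s t).toReal + 1 := by
    have h6 := Finset.sum_range_succ (fun m => (stepN κ β m s t).toReal) (n + 1)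
    rw [Finset.sum_range_succ'] at h6
    have h7 : (stepN κ β (n + 1) s t).toReal ≤ 1 :=
      ENNReal.toReal_le_of_le_ofReal zero_le_one (by simpa using (PMF.coe_le_one _ t))
    have h8 : 0 ≤ (stepN κ β 0 s t).toReal := ENNReal.toReal_nonneg
    linarith
  rw [h4, avgLaw]
  calc _ ≤ ((n : ℝ) + 1)⁻¹ * (∑ m ∈ Finset.range (n + 1), (stepN κ β m s t).toReal + 1) :=
        mul_le_mul_of_nonneg_left ((Finset.sum_le_sum fun m _ => h1 m).trans h5) (by positivity)
    _ = _ := by ring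

/-- Existence of a stationary distribution. -/
theorem exists_stationary (hβ0 : β 0 = 0) (hβ : Summable fun b : ℕ => (b : ℝ) * (β b).toReal)
    (hirr : (transitionMatrix κ).IsIrreducible) {π : Fin N → ℝ} (hπ : IsStationaryVector κ π)
    (hα : ∀ i j, Summable fun k : ℕ => (k : ℝ) * (κ i (k, j)).toReal) (hρ : load κ π < 1) :
    ∃ μ : PMF (ℕ × Fin N), μ.bind (step κ β) = μ := by
  obtain ⟨i₀⟩ := hπ.nonempty
  set s : ℕ × Fin N := (0, i₀)
  set U : Ultrafilter ℕ := hyperfilter ℕ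
  have hU : (U : Filter ℕ) ≤ atTop := Nat.hyperfilter_le_atTop
  obtain ⟨q, hq0, hqs, hq1, hq, hqG⟩ := exists_limit_along_ultrafilter U
    (a := avgLaw κ β s) (avgLaw_nonneg s) (summable_avgLaw s) fun n => (tsum_avgLaw s n).le
  have hinv := tendsto_inv_succ.mono_left hU
  have heq : ∀ (j : Fin N) (z : ℂ), ‖z‖ < 1 → z * genFun (fun x => q (x, j)) z =
      ∑ i, Agf κ i j z * (genFun (fun x => q (x, i)) z + (Bgf β z - 1) * q (0, i)) := by
    intro j z hz
    have herr : Tendsto (fun n : ℕ => ((((n : ℝ) + 1)⁻¹ : ℝ) : ℂ) *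
        (lawGF (stepN κ β (n + 1) s) j z - lawGF (stepN κ β 0 s) j z)) U (𝓝 0) := by
      refine squeeze_zero_norm (a := fun n : ℕ => ((n : ℝ) + 1)⁻¹ * 2) (fun n => ?_)
        (by simpa using hinv.mul_const 2)
      rw [norm_mul, Complex.norm_real, Real.norm_of_nonneg (by positivity)]
      refine mul_le_mul_of_nonneg_left ((norm_sub_le _ _).trans ?_) (by positivity)
      linarith [norm_lawGF_le (stepN κ β (n + 1) s) j hz.le,
        norm_lawGF_le (stepN κ β 0 s) j hz.le]
    have h1 := ((hqG j z hz).add herr).const_mul z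
    rw [add_zero] at h1
    refine tendsto_nhds_unique (h1.congr fun n => mul_genFun_avgLaw hβ0 s n j hz.le)
      (tendsto_finsetSum _ fun i _ => Tendsto.const_mul _ ((hqG i z hz).add
        (((Complex.continuous_ofReal.tendsto _).comp (hq (0, i))).const_mul _)))
  have hlow : 1 - load κ π ≤ meanBatch β * ∑ i, q (0, i) := by
    obtain ⟨C, hC⟩ := exists_occupation_bound hβ0 hβ hirr hπ hα hρ s
    have h1 : ∀ n : ℕ, 1 - load κ π ≤
        ((n : ℝ) + 1)⁻¹ * C + meanBatch β * ∑ i, avgLaw κ β s n (0, i) := by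
      intro n
      have h2 := hC (n + 1)
      push_cast at h2
      have hn : (0 : ℝ) < n + 1 := by positivity
      rw [Finset.sum_comm] at h2
      simp only [avgLaw]
      rw [← Finset.mul_sum, mul_left_comm, ← mul_add, ← div_eq_inv_mul, le_div_iff₀ hn]
      linarith
    refine ge_of_tendsto' (f := fun n : ℕ =>
      ((n : ℝ) + 1)⁻¹ * C + meanBatch β * ∑ i, avgLaw κ β s n (0, i)) (x := U) ?_ h1
    simpa using (hinv.mul_const C).add
      ((tendsto_finsetSum Finset.univ fun i _ => hq (0, i)).const_mul (meanBatch β))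
  obtain ⟨hmass, -⟩ := mass_eq hβ hirr hπ hα hρ hq0 hqs hq1 hlow heq
  have hsum : HasSum (fun s => ENNReal.ofReal (q s)) 1 := by
    rw [← ENNReal.ofReal_one, ← hmass, ENNReal.ofReal_tsum_of_nonneg hq0 hqs]
    exact ENNReal.summable.hasSum
  obtain ⟨μ, hμ⟩ : ∃ μ : PMF (ℕ × Fin N), ∀ s, μ s = ENNReal.ofReal (q s) :=
    ⟨⟨_, hsum⟩, fun _ => rfl⟩
  -- Pointwise limits yield only that one step does not increase `μ`; equality of masses does the
  -- rest.
  refine ⟨μ, PMF_eq_of_le fun t => ?_⟩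
  rw [PMF.bind_apply]
  refine ENNReal.summable.tsum_le_of_sum_le fun F => ?_
  have h1 : ∑ u ∈ F, q u * (step κ β u t).toReal ≤ q t := by
    have h2 := le_of_tendsto_of_tendsto' (tendsto_finsetSum F fun u _ =>
      (hq u).mul_const (step κ β u t).toReal) ((hq t).add hinv) fun n => avgLaw_step_le s n t F
    rwa [add_zero] at h2
  calc ∑ u ∈ F, μ u * step κ β u t
      = ENNReal.ofReal (∑ u ∈ F, q u * (step κ β u t).toReal) := by
        rw [ENNReal.ofReal_sum_of_nonneg fun u _ => mul_nonneg (hq0 u) ENNReal.toReal_nonneg]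
        refine Finset.sum_congr rfl fun u _ => ?_
        rw [hμ, ENNReal.ofReal_mul (hq0 u), ENNReal.ofReal_toReal (PMF.apply_ne_top _ _)]
    _ ≤ μ t := by
        rw [hμ]
        exact ENNReal.ofReal_le_ofReal h1

end Existence

end

end SMQueue

namespace SMQueue

noncomputable section

/-! ### Convergence to the stationary distribution -/

section Convergence

variable {N : ℕ} {κ : Fin N → PMF (ℕ × Fin N)} {β : PMF ℕ}

lemma mul_le_bind_apply {α γ : Type*} (p : PMF γ) (k : γ → PMF α) (s : γ) (t : α) :
    p s * k s t ≤ p.bind k t := by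
  rw [PMF.bind_apply]
  exact ENNReal.le_tsum (f := fun s => p s * k s t) s

/-- The chain returns to an accessible state with a probability bounded away from zero, uniformly
in the initial state. -/
lemma exists_uniform_access (hβ0 : β 0 = 0)
    (hβ : Summable fun b : ℕ => (b : ℝ) * (β b).toReal)
    (hirr : (transitionMatrix κ).IsIrreducible) {π : Fin N → ℝ} (hπ : IsStationaryVector κ π)
    (hα : ∀ i j, Summable fun k : ℕ => (k : ℝ) * (κ i (k, j)).toReal) (hρ : load κ π < 1)
    {s₀ : ℕ × Fin N} (hacc : ∀ s, ∃ n, s₀ ∈ (stepN κ β n s).support) :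
    ∃ η : ℝ, 0 < η ∧ ∀ s, ∃ m, η ≤ (stepN κ β m s s₀).toReal := by
  have := hπ.nonempty
  have hB : 0 < meanBatch β := zero_lt_one.trans_le (one_le_meanBatch hβ0 hβ)
  -- Half the guaranteed frequency of level `0`: if that level had probability below `c` at all
  -- times, the occupation bound would fail for large `n`, whatever its constant.
  set c := (1 - load κ π) / (2 * meanBatch β) with hc
  have hc0 : 0 < c := div_pos (by linarith) (by positivity)
  have hN : 0 < N := Fin.pos_iff_nonempty.2 this
  have hNpos : (0 : ℝ) < N := by exact_mod_cast hN
  choose k hk using fun i : Fin N => hacc (0, i)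
  have hpos : ∀ i, 0 < (stepN κ β (k i) (0, i) s₀).toReal := fun i =>
    ENNReal.toReal_pos ((PMF.mem_support_iff _ _).1 (hk i)) (PMF.apply_ne_top _ _)
  obtain ⟨i₁, hi₁⟩ := Finite.exists_min fun i => (stepN κ β (k i) (0, i) s₀).toReal
  set δ := (stepN κ β (k i₁) (0, i₁) s₀).toReal
  refine ⟨c / N * δ, mul_pos (div_pos hc0 hNpos) (hpos i₁), fun s => ?_⟩
  obtain ⟨C, hC⟩ := exists_occupation_bound hβ0 hβ hirr hπ hα hρ s
  obtain ⟨m, hm⟩ : ∃ m, c ≤ ∑ i, (stepN κ β m s (0, i)).toReal := by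
    by_contra! hlt
    obtain ⟨n, hn⟩ := exists_nat_gt (2 * C / (1 - load κ π))
    rw [div_lt_iff₀ (by linarith)] at hn
    have h1 := hC n
    have h2 : ∑ m ∈ Finset.range n, ∑ i, (stepN κ β m s (0, i)).toReal ≤ n * c := by
      refine (Finset.sum_le_sum fun m _ => (hlt m).le).trans_eq ?_
      simp
    have h3 := mul_le_mul_of_nonneg_left h2 hB.le
    have h4 : meanBatch β * (n * c) = n * (1 - load κ π) / 2 := by
      rw [hc]; field_simp
    linarith
  obtain ⟨i, hi⟩ : ∃ i, c / N ≤ (stepN κ β m s (0, i)).toReal := by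
    by_contra! hlt
    have : ∑ i, (stepN κ β m s (0, i)).toReal < ∑ _i : Fin N, c / N :=
      Finset.sum_lt_sum_of_nonempty Finset.univ_nonempty fun i _ => hlt i
    rw [Finset.sum_const, Finset.card_univ, Fintype.card_fin, nsmul_eq_mul,
      mul_div_cancel₀ _ hNpos.ne'] at this
    linarith
  refine ⟨m + k i, ?_⟩
  have h1 := ENNReal.toReal_mono (PMF.apply_ne_top _ _)
    (mul_le_bind_apply (stepN κ β m s) (stepN κ β (k i)) (0, i) s₀)
  rw [ENNReal.toReal_mul, ← stepN_add] at h1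
  exact (mul_le_mul hi (hi₁ i) ENNReal.toReal_nonneg ENNReal.toReal_nonneg).trans h1

lemma mem_support_stepN_add {m n : ℕ} {s t u : ℕ × Fin N} (h1 : t ∈ (stepN κ β m s).support)
    (h2 : u ∈ (stepN κ β n t).support) : u ∈ (stepN κ β (m + n) s).support := by
  rw [stepN_add, PMF.mem_support_bind_iff]
  exact ⟨t, h1, h2⟩

/-- Convergence of the chain to its stationary distribution, from a fixed state. -/
theorem tendsto_expect_stepN (hβ0 : β 0 = 0)
    (hβ : Summable fun b : ℕ => (b : ℝ) * (β b).toReal)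
    (hirr : (transitionMatrix κ).IsIrreducible) {π : Fin N → ℝ} (hπ : IsStationaryVector κ π)
    (hα : ∀ i j, Summable fun k : ℕ => (k : ℝ) * (κ i (k, j)).toReal) (hρ : load κ π < 1)
    {μ : PMF (ℕ × Fin N)} (hμ : μ.bind (step κ β) = μ) (hap : HasAperiodicState κ β)
    {g : ℕ × Fin N → ℂ} (hg : ∀ s, ‖g s‖ ≤ 1) (s : ℕ × Fin N) :
    Tendsto (fun n => expect (stepN κ β n s) g) atTop (𝓝 (expect μ g)) := by
  obtain ⟨s₀, hacc, m₀, hm₀⟩ := hap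
  obtain ⟨η, hη, hunif⟩ := exists_uniform_access hβ0 hβ hirr hπ hα hρ hacc
  have hstat := fun n => bind_stepN_of_stationary hμ n
  set P : ℕ → ℕ × Fin N → ℂ := fun n s => expect (stepN κ β n s) g
  have hP1 : ∀ n s, ‖P n s‖ ≤ 1 := fun n s => norm_expect_le _ hg
  have hPadd : ∀ m n s, P (m + n) s = expect (stepN κ β m s) (P n) := fun m n s => by
    simp only [P]
    rw [stepN_add, expect_bind _ _ hg]
  have hPμ : ∀ n, expect μ (P n) = expect μ g := fun n => by
    simp only [P]
    rw [← expect_bind _ _ hg, hstat]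
  -- `μ` charges the aperiodic state
  have hμs₀ : μ s₀ ≠ 0 := by
    obtain ⟨t, ht⟩ := μ.support_nonempty
    obtain ⟨n, hn⟩ := hacc t
    rw [← PMF.mem_support_iff, ← hstat n, PMF.mem_support_bind_iff]
    exact ⟨t, ht, hn⟩
  -- asymptotic oscillation for pairs of initial states
  set E : ℕ → (ℕ × Fin N) × (ℕ × Fin N) → ℝ := fun n x => ‖P n x.1 - P n x.2‖
  have hE0 : ∀ n x, 0 ≤ E n x := fun n x => norm_nonneg _
  have hE2 : ∀ n x, E n x ≤ 2 := fun n x =>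
    (norm_sub_le _ _).trans (by linarith [hP1 n x.1, hP1 n x.2])
  set e : (ℕ × Fin N) × (ℕ × Fin N) → ℝ := fun x => tailLim fun n => E n x
  have he0 : ∀ x, 0 ≤ e x := fun x => tailLim_nonneg (fun n => hE0 n x) fun n => hE2 n x
  have he2 : ∀ x, e x ≤ 2 := fun x => tailLim_le (fun n => hE0 n x) fun n => hE2 n x
  have hsub : ∀ m x, e x ≤ rexpect (prodPMF (stepN κ β m x.1) (stepN κ β m x.2)) e := by
    intro m x
    refine tailLim_le_rexpect _ hE0 hE2 (fun n => hE0 n x) (fun n => hE2 n x) (m := m) fun n => ?_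
    simp only [E, hPadd]
    rw [← expect_prodPMF_sub _ _ (hP1 n)]
    exact norm_expect_le_rexpect _ fun y => hE2 n y
  have hdiag : ∀ s, e (s, s) = 0 := fun s => by simp [e, E, tailLim]
  -- In `n + m₀` steps both coordinates can reach `s₀`: the second arrives in `n` and returns in
  -- `m₀`, the first returns in `n + m₀` by aperiodicity.
  have he : ∀ y, μ y ≠ 0 → e (s₀, y) = 0 := by
    intro y hy
    obtain ⟨n, hn⟩ := hacc y
    have h1 : s₀ ∈ (stepN κ β (n + m₀) s₀).support := hm₀ _ (Nat.le_add_left _ _)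
    have h2 : s₀ ∈ (stepN κ β (n + m₀) y).support := mem_support_stepN_add hn (hm₀ m₀ le_rfl)
    rw [← hdiag s₀]
    refine (eq_of_subharmonic_of_stationary (prodPMF_bind μ _ (hstat (n + m₀))) he0 he2
      (hsub (n + m₀)) ?_ ?_).symm
    · rw [prodPMF_apply]
      exact mul_ne_zero hμs₀ hy
    · rw [prodPMF_apply]
      exact mul_ne_zero ((PMF.mem_support_iff _ _).1 h1) ((PMF.mem_support_iff _ _).1 h2)
  -- asymptotic distance to the stationary mean
  set F : ℕ → ℕ × Fin N → ℝ := fun n s => ‖P n s - expect μ g‖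
  have hF0 : ∀ n s, 0 ≤ F n s := fun n s => norm_nonneg _
  have hF2 : ∀ n s, F n s ≤ 2 := fun n s =>
    (norm_sub_le _ _).trans (by linarith [hP1 n s, norm_expect_le μ hg])
  set d : ℕ × Fin N → ℝ := fun s => tailLim fun n => F n s
  have hd0 : ∀ s, 0 ≤ d s := fun s => tailLim_nonneg (fun n => hF0 n s) fun n => hF2 n s
  have hd2 : ∀ s, d s ≤ 2 := fun s => tailLim_le (fun n => hF0 n s) fun n => hF2 n s
  have hdsub : ∀ m s, d s ≤ rexpect (stepN κ β m s) d := by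
    intro m s
    refine tailLim_le_rexpect _ hF0 hF2 (fun n => hF0 n s) (fun n => hF2 n s) (m := m) fun n => ?_
    have h1 : P (m + n) s - expect μ g =
        expect (stepN κ β m s) fun y => P n y - expect μ g := by
      rw [expect_sub _ (hP1 n) (fun _ => norm_expect_le μ hg), expect_const, hPadd]
    simp only [F, h1]
    exact norm_expect_le_rexpect _ fun y => hF2 n y
  have hds₀ : d s₀ = 0 := by
    refine le_antisymm ?_ (hd0 s₀)
    -- By invariance, averaging `P n s₀ - P n y` over `y` under `μ` gives `P n s₀ - expect μ g`.
    have h1 : d s₀ ≤ rexpect μ fun y => e (s₀, y) := by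
      refine tailLim_le_rexpect μ (E := fun n y => E n (s₀, y)) (fun n y => hE0 n _)
        (fun n y => hE2 n _) (fun n => hF0 n s₀) (fun n => hF2 n s₀) (m := 0) fun n => ?_
      simp only [F, zero_add]
      rw [← hPμ n, ← expect_const μ (P n s₀), ← expect_sub μ (fun _ => hP1 n s₀) (hP1 n)]
      exact norm_expect_le_rexpect _ fun y => hE2 n (s₀, y)
    refine h1.trans_eq ?_
    rw [rexpect]
    refine (tsum_congr fun y => ?_).trans tsum_zero
    by_cases hy : μ y = 0
    · simp [hy]
    · rw [he y hy, mul_zero]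
  set D := ⨆ s, d s
  have hbdd : BddAbove (Set.range d) := ⟨2, by rintro _ ⟨s, rfl⟩; exact hd2 s⟩
  have hdD : ∀ s, d s ≤ D := fun s => le_ciSup hbdd s
  have hD0 : 0 ≤ D := (hd0 s₀).trans (hdD s₀)
  -- At time `m` the chain is at `s₀`, where `d` vanishes, with probability at least `η`; elsewhere
  -- `d ≤ D`.
  have hcontr : ∀ s, d s ≤ D * (1 - η) := by
    intro s
    obtain ⟨m, hm⟩ := hunif s
    have hind : ∀ t, |(-D) * (if t = s₀ then 1 else 0)| ≤ D := fun t => by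
      split_ifs <;> simp [abs_of_nonneg hD0, hD0]
    calc d s ≤ rexpect (stepN κ β m s) d := hdsub m s
      _ ≤ rexpect (stepN κ β m s) fun t => D + (-D) * if t = s₀ then 1 else 0 := by
          refine rexpect_mono _ (C := 2) (C' := D + D) (fun t => ?_) (fun t => ?_) fun t => ?_
          · rw [abs_of_nonneg (hd0 t)]; exact hd2 t
          · exact (abs_add_le _ _).trans (add_le_add (abs_of_nonneg hD0).le (hind t))
          · split_ifs with h
            · rw [h, hds₀]; simp
            · simpa using hdD t
      _ = D - D * (stepN κ β m s s₀).toReal := by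
          rw [rexpect_add _ (fun _ => (abs_of_nonneg hD0).le) hind, rexpect_const,
            rexpect_const_mul]
          have : rexpect (stepN κ β m s) (fun t => if t = s₀ then 1 else 0) =
              (stepN κ β m s s₀).toReal := by
            rw [rexpect, tsum_eq_single s₀] <;> simp +contextual
          rw [this]
          ring
      _ ≤ D * (1 - η) := by nlinarith
  have : Nonempty (ℕ × Fin N) := ⟨s₀⟩
  have hDle : D ≤ D * (1 - η) := ciSup_le hcontr
  have hDzero : D = 0 := le_antisymm (by nlinarith) hD0
  have hds : d s = 0 := le_antisymm (hDzero ▸ hdD s) (hd0 s)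
  rw [tendsto_iff_norm_sub_tendsto_zero]
  exact tendsto_zero_of_tailLim (fun n => hF0 n s) (fun n => hF2 n s) hds

/-- Convergence of the generating functions, from an arbitrary initial law. -/
theorem tendsto_lawGF (hβ0 : β 0 = 0)
    (hβ : Summable fun b : ℕ => (b : ℝ) * (β b).toReal)
    (hirr : (transitionMatrix κ).IsIrreducible) {π : Fin N → ℝ} (hπ : IsStationaryVector κ π)
    (hα : ∀ i j, Summable fun k : ℕ => (k : ℝ) * (κ i (k, j)).toReal) (hρ : load κ π < 1)
    {μ : PMF (ℕ × Fin N)} (hμ : μ.bind (step κ β) = μ) (hap : HasAperiodicState κ β)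
    (l : PMF (ℕ × Fin N)) (j : Fin N) {z : ℂ} (hz : ‖z‖ ≤ 1) :
    Tendsto (fun n => lawGF (l.bind (stepN κ β n)) j z) atTop (𝓝 (lawGF μ j z)) := by
  have hg := norm_testFun_le j hz
  simp only [← expect_testFun _ j hz, expect_bind _ _ hg]
  have := tendsto_expect l (fun n s => norm_expect_le (stepN κ β n s) hg)
    fun s => tendsto_expect_stepN hβ0 hβ hirr hπ hα hρ hμ hap hg s
  rwa [expect_const] at this

end Convergence

end

end SMQueue

namespace SMQueue

noncomputable section

/-! ### Markov property and law of the queueing process -/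

section History

variable {N : ℕ} {Ω : Type*} {X A B : ℕ → Ω → ℕ} {J : ℕ → Ω → Fin N}

/-- The queue up to time `n`. -/
def history (X A B : ℕ → Ω → ℕ) (J : ℕ → Ω → Fin N) (n : ℕ) (ω : Ω) :
    ℕ × Fin N × (Fin n → ℕ × Fin N × ℕ) :=
  (X 0 ω, J 1 ω, fun m => (A (m + 1) ω, J (m + 2) ω, B (m + 1) ω))

lemma history_eq_iff {n : ℕ} {ω ω₀ : Ω} : history X A B J n ω = history X A B J n ω₀ ↔
    X 0 ω = X 0 ω₀ ∧ J 1 ω = J 1 ω₀ ∧ ∀ m ∈ Finset.Icc 1 n,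
      A m ω = A m ω₀ ∧ J (m + 1) ω = J (m + 1) ω₀ ∧ B m ω = B m ω₀ := by
  simp only [history, Prod.mk.injEq, funext_iff]
  refine and_congr_right fun _ => and_congr_right fun _ => ⟨fun h m hm => ?_, fun h m => ?_⟩
  · obtain ⟨h1, h2⟩ := Finset.mem_Icc.1 hm
    obtain ⟨m, rfl⟩ := Nat.exists_eq_add_of_le' h1
    exact h ⟨m, by omega⟩
  · exact h (m + 1) (Finset.mem_Icc.2 ⟨by omega, by omega⟩)

end History

section Law

variable {N : ℕ} {κ : Fin N → PMF (ℕ × Fin N)} {β : PMF ℕ} {Ω : Type*} [MeasurableSpace Ω]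
  {ℙ : Measure Ω} {X A B : ℕ → Ω → ℕ} {J : ℕ → Ω → Fin N}

lemma measure_eq_tsum_fibers {H : Type*} [Countable H] [MeasurableSpace H]
    [MeasurableSingletonClass H] {f : Ω → H} (hf : Measurable f) {S : Set Ω}
    (hS : MeasurableSet S) : ℙ S = ∑' h, ℙ (S ∩ {ω | f ω = h}) := by
  rw [← measure_iUnion]
  · congr 1
    ext ω
    simp
  · intro h h' hne
    rw [Function.onFun, Set.disjoint_left]
    rintro ω ⟨-, h1⟩ ⟨-, h2⟩
    exact hne (h1.symm.trans h2)
  · exact fun h => hS.inter (hf (measurableSet_singleton h))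

lemma IsQueue.measurable_X (hX : IsQueue κ β ℙ X A B J) (n : ℕ) : Measurable (X n) := by
  induction n with
  | zero => exact hX.measurable_X_zero
  | succ n ih =>
    have h : X (n + 1) = fun ω =>
        if 1 ≤ X n ω then X n ω - 1 + A (n + 1) ω else A (n + 1) ω + B (n + 1) ω - 1 :=
      funext (hX.recurrence n)
    rw [h]
    exact Measurable.ite (measurableSet_le measurable_const ih)
      ((ih.sub measurable_const).add (hX.measurable_A _))
      (((hX.measurable_A _).add (hX.measurable_B _)).sub measurable_const)

lemma IsQueue.measurable_history (hX : IsQueue κ β ℙ X A B J) (n : ℕ) :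
    Measurable (history X A B J n) :=
  hX.measurable_X_zero.prodMk ((hX.measurable_J 1).prodMk (measurable_pi_lambda _ fun _ =>
    (hX.measurable_A _).prodMk ((hX.measurable_J _).prodMk (hX.measurable_B _))))

/-- The state at time `n` is a function of the history. -/
lemma IsQueue.state_eq_of_history_eq (hX : IsQueue κ β ℙ X A B J) {n : ℕ} {ω ω₀ : Ω}
    (h : history X A B J n ω = history X A B J n ω₀) :
    X n ω = X n ω₀ ∧ J (n + 1) ω = J (n + 1) ω₀ := by
  rw [history_eq_iff] at h
  obtain ⟨h0, h1, h2⟩ := h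
  have hXm : ∀ m ≤ n, X m ω = X m ω₀ := by
    intro m
    induction m with
    | zero => exact fun _ => h0
    | succ m ih =>
      intro hm
      obtain ⟨h3, -, h4⟩ := h2 (m + 1) (Finset.mem_Icc.2 ⟨by omega, hm⟩)
      rw [hX.recurrence, hX.recurrence, ih (by omega), h3, h4]
  refine ⟨hXm n le_rfl, ?_⟩
  rcases Nat.eq_zero_or_pos n with rfl | hn
  · exact h1
  · exact (h2 n (Finset.mem_Icc.2 ⟨hn, le_rfl⟩)).2.1

/-- The field `law` is used at `n` and at `n + 1`. Overwriting entry `n + 1` of `A` and `B`, and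
entry `n + 2` of `J`, leaves the first `n` factors unchanged. -/
lemma IsQueue.measure_history_next (hX : IsQueue κ β ℙ X A B J) (n : ℕ) (ω₀ : Ω) (k b : ℕ)
    (j : Fin N) :
    ℙ {ω | history X A B J n ω = history X A B J n ω₀ ∧
        A (n + 1) ω = k ∧ J (n + 2) ω = j ∧ B (n + 1) ω = b} =
      ℙ {ω | history X A B J n ω = history X A B J n ω₀} *
        (κ (J (n + 1) ω₀) (k, j) * β b) := by
  have h1 := hX.law n (X 0 ω₀) (fun m => J m ω₀) (fun m => A m ω₀) (fun m => B m ω₀)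
  have h2 := hX.law (n + 1) (X 0 ω₀) (Function.update (fun m => J m ω₀) (n + 2) j)
    (Function.update (fun m => A m ω₀) (n + 1) k) (Function.update (fun m => B m ω₀) (n + 1) b)
  rw [Finset.prod_Icc_succ_top (by omega), ← mul_assoc] at h2
  have hprod : ∏ m ∈ Finset.Icc 1 n,
      (κ (Function.update (fun m => J m ω₀) (n + 2) j m)
        (Function.update (fun m => A m ω₀) (n + 1) k m,
          Function.update (fun m => J m ω₀) (n + 2) j (m + 1)) *
        β (Function.update (fun m => B m ω₀) (n + 1) b m)) =
      ∏ m ∈ Finset.Icc 1 n, (κ (J m ω₀) (A m ω₀, J (m + 1) ω₀) * β (B m ω₀)) := by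
    refine Finset.prod_congr rfl fun m hm => ?_
    have := (Finset.mem_Icc.1 hm).2
    rw [Function.update_of_ne (by omega), Function.update_of_ne (by omega),
      Function.update_of_ne (by omega), Function.update_of_ne (by omega)]
  rw [hprod, Function.update_of_ne (by omega), ← h1] at h2
  rw [Function.update_of_ne (by omega), Function.update_self, Function.update_self,
    Function.update_self] at h2
  simp only [history_eq_iff]
  rw [← h2]
  congr 1
  ext ω
  simp only [Set.mem_ofPred_eq]
  have hIcc : Finset.Icc 1 (n + 1) = insert (n + 1) (Finset.Icc 1 n) := by
    ext m; simp only [Finset.mem_Icc, Finset.mem_insert]; omega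
  rw [hIcc, Finset.forall_mem_insert, Function.update_self, Function.update_self,
    Function.update_self]
  have hcongr : (∀ m ∈ Finset.Icc 1 n, A m ω = Function.update (fun m => A m ω₀) (n + 1) k m ∧
      J (m + 1) ω = Function.update (fun m => J m ω₀) (n + 2) j (m + 1) ∧
      B m ω = Function.update (fun m => B m ω₀) (n + 1) b m) ↔
      ∀ m ∈ Finset.Icc 1 n, A m ω = A m ω₀ ∧ J (m + 1) ω = J (m + 1) ω₀ ∧ B m ω = B m ω₀ := by
    refine forall₂_congr fun m hm => ?_
    have := (Finset.mem_Icc.1 hm).2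
    rw [Function.update_of_ne (by omega), Function.update_of_ne (by omega),
      Function.update_of_ne (by omega)]
  rw [hcongr]
  tauto

/-- The Markov property of the queue. -/
lemma IsQueue.markov (hX : IsQueue κ β ℙ X A B J) (n : ℕ) (s a : ℕ × Fin N) (b : ℕ) :
    ℙ {ω | (X n ω, J (n + 1) ω) = s ∧ (A (n + 1) ω, J (n + 2) ω) = a ∧ B (n + 1) ω = b} =
      ℙ {ω | (X n ω, J (n + 1) ω) = s} * (κ s.2 a * β b) := by
  obtain ⟨k, j⟩ := a
  have hs : MeasurableSet {ω | (X n ω, J (n + 1) ω) = s} :=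
    ((hX.measurable_X n).prodMk (hX.measurable_J (n + 1))) (measurableSet_singleton s)
  have ha : MeasurableSet {ω | (A (n + 1) ω, J (n + 2) ω) = (k, j)} :=
    ((hX.measurable_A (n + 1)).prodMk (hX.measurable_J (n + 2))) (measurableSet_singleton (k, j))
  have hb : MeasurableSet {ω | B (n + 1) ω = b} := hX.measurable_B (n + 1) (measurableSet_singleton b)
  have hall : MeasurableSet {ω | (X n ω, J (n + 1) ω) = s ∧
      (A (n + 1) ω, J (n + 2) ω) = (k, j) ∧ B (n + 1) ω = b} := hs.inter (ha.inter hb)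
  rw [measure_eq_tsum_fibers (hX.measurable_history n) hall,
    measure_eq_tsum_fibers (hX.measurable_history n) hs, ← ENNReal.tsum_mul_right]
  refine tsum_congr fun h => ?_
  -- The history determines the state: its fibre lies inside the event that the state is `s`, or
  -- misses it and both terms are zero.
  by_cases hne : ∃ ω₀, history X A B J n ω₀ = h ∧ (X n ω₀, J (n + 1) ω₀) = s
  · obtain ⟨ω₀, rfl, rfl⟩ := hne
    have hst : ∀ ω, history X A B J n ω = history X A B J n ω₀ →
        (X n ω, J (n + 1) ω) = (X n ω₀, J (n + 1) ω₀) := fun ω hω => by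
      obtain ⟨h1, h2⟩ := hX.state_eq_of_history_eq hω
      rw [h1, h2]
    convert hX.measure_history_next n ω₀ k b j using 2
    · ext ω
      simp only [Set.mem_inter_iff, Set.mem_ofPred_eq]
      have := hst ω
      rw [Prod.mk.injEq (A (n + 1) ω)]
      tauto
    · congr 1
      ext ω
      simp only [Set.mem_inter_iff, Set.mem_ofPred_eq]
      have := hst ω
      tauto
  · have h1 : ∀ S : Set Ω, S ⊆ {ω | (X n ω, J (n + 1) ω) = s} →
        S ∩ {ω | history X A B J n ω = h} = ∅ := fun S hS => by
      ext ω
      simp only [Set.mem_inter_iff, Set.mem_ofPred_eq, Set.mem_empty_iff_false, iff_false, not_and]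
      exact fun hω hh => hne ⟨ω, hh, hS hω⟩
    rw [h1 _ fun ω hω => hω.1, h1 _ subset_rfl]
    simp

/-- Draws a batch at every step even if it is discarded, to match the process, in which `B (n + 1)`
always exists. -/
lemma step_eq (s : ℕ × Fin N) : step κ β s = (κ s.2).bind fun a => β.map fun b =>
    (if 1 ≤ s.1 then s.1 - 1 + a.1 else a.1 + b - 1, a.2) := by
  unfold step
  split_ifs with h
  · have h1 : ∀ a : ℕ × Fin N, (β.map fun _ => (s.1 - 1 + a.1, a.2)) =
        PMF.pure (s.1 - 1 + a.1, a.2) := fun a => PMF.map_const _ _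
    simp only [h1]
    rfl
  · rfl

lemma IsQueue.measure_succ (hX : IsQueue κ β ℙ X A B J) (n : ℕ) (t : ℕ × Fin N) :
    ℙ {ω | (X (n + 1) ω, J (n + 2) ω) = t} =
      ∑' s, ℙ {ω | (X n ω, J (n + 1) ω) = s} * step κ β s t := by
  have hf : Measurable fun ω => ((X n ω, J (n + 1) ω), (A (n + 1) ω, J (n + 2) ω), B (n + 1) ω) :=
    ((hX.measurable_X n).prodMk (hX.measurable_J (n + 1))).prodMk
      (((hX.measurable_A (n + 1)).prodMk (hX.measurable_J (n + 2))).prodMk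
        (hX.measurable_B (n + 1)))
  have ht : MeasurableSet {ω | (X (n + 1) ω, J (n + 2) ω) = t} :=
    ((hX.measurable_X (n + 1)).prodMk (hX.measurable_J (n + 2))) (measurableSet_singleton t)
  rw [measure_eq_tsum_fibers hf ht, ENNReal.tsum_prod']
  refine tsum_congr fun s => ?_
  rw [ENNReal.tsum_prod', step_eq, PMF.bind_apply, ← ENNReal.tsum_mul_left]
  refine tsum_congr fun a => ?_
  rw [PMF.map_apply, ← ENNReal.tsum_mul_left, ← ENNReal.tsum_mul_left]
  refine tsum_congr fun b => ?_
  by_cases h : t = (if 1 ≤ s.1 then s.1 - 1 + a.1 else a.1 + b - 1, a.2)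
  · rw [if_pos h, ← hX.markov]
    congr 1
    ext ω
    simp only [Set.mem_inter_iff, Set.mem_ofPred_eq, Prod.mk.injEq]
    constructor
    · rintro ⟨-, h1, h2, h3⟩
      exact ⟨h1, h2, h3⟩
    · rintro ⟨rfl, rfl, rfl⟩
      refine ⟨?_, rfl, rfl, rfl⟩
      rw [h, hX.recurrence]
  · rw [if_neg h, mul_zero, mul_zero]
    refine measure_mono_null (t := ∅) ?_ measure_empty
    rintro ω ⟨h1, h2⟩
    simp only [Set.mem_ofPred_eq, Prod.mk.injEq] at h1 h2
    obtain ⟨rfl, rfl, rfl⟩ := h2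
    refine h ?_
    rw [← h1, hX.recurrence]

lemma IsQueue.exists_initial_law [IsProbabilityMeasure ℙ] (hX : IsQueue κ β ℙ X A B J) :
    ∃ l : PMF (ℕ × Fin N), ∀ s, ℙ {ω | (X 0 ω, J 1 ω) = s} = l s := by
  have hf : Measurable fun ω => (X 0 ω, J 1 ω) := hX.measurable_X_zero.prodMk (hX.measurable_J 1)
  have := Measure.isProbabilityMeasure_map (μ := ℙ) hf.aemeasurable
  refine ⟨(ℙ.map fun ω => (X 0 ω, J 1 ω)).toPMF, fun s => ?_⟩
  rw [Measure.toPMF_apply, Measure.map_apply hf (measurableSet_singleton s)]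
  rfl

/-- The law of the state at time `n`. -/
lemma IsQueue.measure_state (hX : IsQueue κ β ℙ X A B J) {l : PMF (ℕ × Fin N)}
    (hl : ∀ s, ℙ {ω | (X 0 ω, J 1 ω) = s} = l s) (n : ℕ) (s : ℕ × Fin N) :
    ℙ {ω | (X n ω, J (n + 1) ω) = s} = l.bind (stepN κ β n) s := by
  induction n generalizing s with
  | zero => rw [bind_stepN_zero]; exact hl s
  | succ n ih =>
    rw [stepN_succ', PMF.bind_apply, hX.measure_succ]
    simp only [ih]

lemma IsQueue.jointGF_eq [IsProbabilityMeasure ℙ] (hX : IsQueue κ β ℙ X A B J)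
    {l : PMF (ℕ × Fin N)} (hl : ∀ s, ℙ {ω | (X 0 ω, J 1 ω) = s} = l s) (n : ℕ) (j : Fin N) {z : ℂ}
    (hz : ‖z‖ ≤ 1) : jointGF ℙ X J n j z = lawGF (l.bind (stepN κ β n)) j z := by
  have hf : Measurable fun ω => (X n ω, J (n + 1) ω) :=
    (hX.measurable_X n).prodMk (hX.measurable_J (n + 1))
  have hprob := Measure.isProbabilityMeasure_map (μ := ℙ) hf.aemeasurable
  have hint : Integrable (testFun j z) (ℙ.map fun ω => (X n ω, J (n + 1) ω)) :=
    Integrable.of_bound (measurable_of_countable _).aestronglyMeasurable 1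
      (.of_forall fun s => norm_testFun_le j hz s)
  have h1 : jointGF ℙ X J n j z = ∫ ω, testFun j z (X n ω, J (n + 1) ω) ∂ℙ := rfl
  rw [h1, ← integral_map hf.aemeasurable (measurable_of_countable _).aestronglyMeasurable
    (f := testFun j z), integral_countable hint, ← expect_testFun _ j hz, expect]
  refine tsum_congr fun s => ?_
  rw [Measure.real, Measure.map_apply hf (measurableSet_singleton s), Complex.real_smul,
    ← hX.measure_state hl]
  rfl

end Law

end

end SMQueue

namespace SMQueue

noncomputable section

/-! ### The steady-state equations and the boundary conditions -/

section Limit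

variable {N : ℕ} {κ : Fin N → PMF (ℕ × Fin N)} {β : PMF ℕ}

lemma toReal_bind {α γ : Type*} (p : PMF γ) (k : γ → PMF α) (t : α) :
    (p.bind k t).toReal = rexpect p fun s => (k s t).toReal := by
  rw [PMF.bind_apply, ENNReal.tsum_toReal_eq fun s =>
    ENNReal.mul_ne_top (PMF.apply_ne_top _ _) (PMF.apply_ne_top _ _), rexpect]
  simp only [ENNReal.toReal_mul]

lemma abs_toReal_apply_le {α : Type*} (p : PMF α) (t : α) : |(p t).toReal| ≤ 1 := by
  rw [abs_of_nonneg ENNReal.toReal_nonneg]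
  exact ENNReal.toReal_le_of_le_ofReal zero_le_one (by simpa using PMF.coe_le_one p t)

/-- A limit of the probability of an empty queue is large enough for stability. -/
lemma le_of_tendsto_occupation (hβ0 : β 0 = 0)
    (hβ : Summable fun b : ℕ => (b : ℝ) * (β b).toReal)
    (hirr : (transitionMatrix κ).IsIrreducible) {π : Fin N → ℝ} (hπ : IsStationaryVector κ π)
    (hα : ∀ i j, Summable fun k : ℕ => (k : ℝ) * (κ i (k, j)).toReal) (hρ : load κ π < 1)
    (l : PMF (ℕ × Fin N)) {Q : ℝ}
    (hQ : Tendsto (fun n => ∑ i, (l.bind (stepN κ β n) (0, i)).toReal) atTop (𝓝 Q)) :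
    1 - load κ π ≤ meanBatch β * Q := by
  set ψ : ℕ → ℕ × Fin N → ℝ := fun m s => ∑ i, (stepN κ β m s (0, i)).toReal with hψ
  have hψ0 : ∀ m s, 0 ≤ ψ m s := fun m s => Finset.sum_nonneg fun i _ => ENNReal.toReal_nonneg
  have hψN : ∀ m s, ψ m s ≤ N := fun m s => by
    refine (Finset.sum_le_card_nsmul _ _ 1 fun i _ =>
      (le_abs_self _).trans (abs_toReal_apply_le _ _)).trans_eq (by simp)
  have hψabs : ∀ m s, |ψ m s| ≤ N := fun m s => by
    rw [abs_of_nonneg (hψ0 m s)]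
    exact hψN m s
  have hE := meanBatch_nonneg (β := β)
  set g : ℕ → ℕ × Fin N → ℝ := fun n s =>
    meanBatch β * ((n : ℝ)⁻¹ * ∑ m ∈ Finset.range n, ψ m s) with hg
  have hsum0 : ∀ n s, 0 ≤ ∑ m ∈ Finset.range n, ψ m s := fun n s =>
    Finset.sum_nonneg fun m _ => hψ0 m s
  have hg0 : ∀ n s, 0 ≤ g n s := fun n s =>
    mul_nonneg hE (mul_nonneg (by positivity) (hsum0 n s))
  have hsumle : ∀ n s, |∑ m ∈ Finset.range n, ψ m s| ≤ n * N := fun n s => by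
    rw [abs_of_nonneg (hsum0 n s)]
    exact (Finset.sum_le_card_nsmul _ _ (N : ℝ) fun m _ => hψN m s).trans_eq (by simp)
  have hgE : ∀ n, rexpect l (g n) = meanBatch β * ((n : ℝ)⁻¹ *
      ∑ m ∈ Finset.range n, ∑ i, (l.bind (stepN κ β m) (0, i)).toReal) := fun n => by
    rw [hg, rexpect_const_mul, rexpect_const_mul, rexpect_sum _ _ hψabs]
    congr 2
    refine Finset.sum_congr rfl fun m _ => ?_
    rw [hψ, rexpect_sum _ _ fun i s => abs_toReal_apply_le (stepN κ β m s) (0, i)]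
    simp only [toReal_bind]
  have h1 : Tendsto (fun n => rexpect l (g n)) atTop (𝓝 (meanBatch β * Q)) := by
    simp only [hgE]
    exact hQ.cesaro.const_mul _
  -- The constant in the occupation bound depends on `s` and need not be integrable under `l`;
  -- truncating at `1 - ρ` provides the domination.
  have h2 : Tendsto (fun n => rexpect l fun s => min (1 - load κ π) (g n s)) atTop
      (𝓝 (rexpect l fun _ => 1 - load κ π)) := by
    refine tendsto_rexpect l (C := 1 - load κ π) (fun n s => ?_) fun s => ?_
    · rw [abs_of_nonneg (le_min (by linarith) (hg0 n s))]
      exact min_le_left _ _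
    · obtain ⟨C, hC⟩ := exists_occupation_bound hβ0 hβ hirr hπ hα hρ s
      have h3 : Tendsto (fun n : ℕ => 1 - load κ π - C * (n : ℝ)⁻¹) atTop (𝓝 (1 - load κ π)) := by
        simpa using (tendsto_inv_atTop_nhds_zero_nat (𝕜 := ℝ)).const_mul C |>.const_sub
          (1 - load κ π)
      have h4 : Tendsto (fun n : ℕ => min (1 - load κ π) (1 - load κ π - C * (n : ℝ)⁻¹)) atTop
          (𝓝 (1 - load κ π)) := by
        simpa using (tendsto_const_nhds (x := 1 - load κ π)).min h3
      refine tendsto_of_tendsto_of_tendsto_of_le_of_le' h4 tendsto_const_nhds ?_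
        (.of_forall fun n => min_le_left _ _)
      filter_upwards [eventually_gt_atTop 0] with n hn
      refine min_le_min_left _ ?_
      have hn' : (0 : ℝ) < n := by exact_mod_cast hn
      have h5 := hC n
      rw [hg]
      dsimp only
      rw [mul_left_comm, ← div_eq_inv_mul, le_div_iff₀ hn', sub_mul, mul_assoc,
        inv_mul_cancel₀ hn'.ne']
      linarith
  rw [rexpect_const] at h2
  refine le_of_tendsto_of_tendsto' h2 h1 fun n => rexpect_mono l (C := 1 - load κ π)
    (C' := meanBatch β * ((n : ℝ)⁻¹ * (n * N))) (fun s => ?_) (fun s => ?_) fun s => min_le_right _ _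
  · rw [abs_of_nonneg (le_min (by linarith) (hg0 n s))]
    exact min_le_left _ _
  · rw [hg, abs_mul, abs_mul, abs_of_nonneg hE, abs_of_nonneg (by positivity : 0 ≤ (n : ℝ)⁻¹)]
    have := hsumle n s
    gcongr

variable {l : PMF (ℕ × Fin N)} {f : Fin N → ℂ → ℂ}

lemma tendsto_zero_prob
    (hf : ∀ (j : Fin N) (z : ℂ), ‖z‖ ≤ 1 →
      Tendsto (fun n => lawGF (l.bind (stepN κ β n)) j z) atTop (𝓝 (f j z))) (i : Fin N) :
    Tendsto (fun n => ((l.bind (stepN κ β n) (0, i)).toReal : ℂ)) atTop (𝓝 (f i 0)) := by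
  simpa only [lawGF_zero] using hf i 0 (by simp)

/-- The steady-state equations. -/
lemma mul_limit_eq (hβ0 : β 0 = 0)
    (hf : ∀ (j : Fin N) (z : ℂ), ‖z‖ ≤ 1 →
      Tendsto (fun n => lawGF (l.bind (stepN κ β n)) j z) atTop (𝓝 (f j z)))
    (j : Fin N) {z : ℂ} (hz : ‖z‖ ≤ 1) :
    z * f j z = ∑ i, Agf κ i j z * (f i z + (Bgf β z - 1) * f i 0) := by
  have h1 := ((hf j z hz).comp (tendsto_add_atTop_nat 1)).const_mul z
  refine tendsto_nhds_unique h1 (Tendsto.congr (fun n => ?_) (tendsto_finsetSum _ fun i _ =>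
    Tendsto.const_mul _ ((hf i z hz).add ((tendsto_zero_prob hf i).const_mul _))))
  rw [Function.comp_apply, stepN_succ', mul_lawGF_bind_step hβ0 _ j hz]

lemma transpose_Mmat_mulVec_limit (hβ0 : β 0 = 0)
    (hf : ∀ (j : Fin N) (z : ℂ), ‖z‖ ≤ 1 →
      Tendsto (fun n => lawGF (l.bind (stepN κ β n)) j z) atTop (𝓝 (f j z)))
    {z : ℂ} (hz : ‖z‖ ≤ 1) :
    (Mmat κ z)ᵀ *ᵥ (fun j => f j z) = bvec κ β (fun i => f i 0) z := by
  ext j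
  rw [Mmat_eq, Matrix.transpose_sub, Matrix.transpose_smul, Matrix.transpose_one,
    Matrix.sub_mulVec, Matrix.smul_mulVec, Matrix.one_mulVec, Pi.sub_apply, Pi.smul_apply,
    smul_eq_mul, mul_limit_eq hβ0 hf j hz, bvec, Finset.mul_sum, Matrix.mulVec, dotProduct,
    ← Finset.sum_sub_distrib]
  refine Finset.sum_congr rfl fun i _ => ?_
  rw [Matrix.transpose_apply, Amat, Matrix.of_apply]
  ring

/-- The numerator is `det M(z)` times the limit. -/
lemma numerator_eq_det_smul (hβ0 : β 0 = 0)
    (hf : ∀ (j : Fin N) (z : ℂ), ‖z‖ ≤ 1 →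
      Tendsto (fun n => lawGF (l.bind (stepN κ β n)) j z) atTop (𝓝 (f j z)))
    {z : ℂ} (hz : ‖z‖ ≤ 1) :
    numerator κ β (fun i => f i 0) z = (Mmat κ z).det • fun j => f j z := by
  rw [numerator, ← transpose_Mmat_mulVec_limit hβ0 hf hz, Matrix.mulVec_mulVec,
    Matrix.adjugate_mul, Matrix.det_transpose, Matrix.smul_mulVec, Matrix.one_mulVec]

/-- The limit is the vector of generating functions of a distribution on the state space, and
the boundary values sum up to `(1 - ρ) / E[B]`. -/
lemma exists_limit_mass (hβ0 : β 0 = 0)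
    (hβ : Summable fun b : ℕ => (b : ℝ) * (β b).toReal)
    (hirr : (transitionMatrix κ).IsIrreducible) {π : Fin N → ℝ} (hπ : IsStationaryVector κ π)
    (hα : ∀ i j, Summable fun k : ℕ => (k : ℝ) * (κ i (k, j)).toReal) (hρ : load κ π < 1)
    (hf : ∀ (j : Fin N) (z : ℂ), ‖z‖ ≤ 1 →
      Tendsto (fun n => lawGF (l.bind (stepN κ β n)) j z) atTop (𝓝 (f j z))) :
    ∃ q : ℕ × Fin N → ℝ, (∀ s, 0 ≤ q s) ∧ Summable q ∧
      (∀ (j : Fin N) (z : ℂ), ‖z‖ < 1 → f j z = genFun (fun x => q (x, j)) z) ∧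
      meanBatch β * ∑ i, q (0, i) = 1 - load κ π := by
  have hU : (hyperfilter ℕ : Filter ℕ) ≤ atTop := Nat.hyperfilter_le_atTop
  -- The limit `f` already exists; the ultrafilter serves to identify it in the open disc as a
  -- vector of generating functions, hence analytic.
  obtain ⟨q, hq0, hqs, hq1, -, hqG⟩ := exists_limit_along_ultrafilter (hyperfilter ℕ)
    (a := fun n s => (l.bind (stepN κ β n) s).toReal) (fun _ _ => ENNReal.toReal_nonneg)
    (fun n => summable_toReal _) fun n => (tsum_toReal _).le
  have hfq : ∀ (j : Fin N) (z : ℂ), ‖z‖ < 1 → f j z = genFun (fun x => q (x, j)) z :=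
    fun j z hz => tendsto_nhds_unique ((hf j z hz.le).mono_left hU) (hqG j z hz)
  have hf0 : ∀ i, f i 0 = q (0, i) := fun i => by rw [hfq i 0 (by simp), genFun_zero]
  have hQ : Tendsto (fun n => ∑ i, (l.bind (stepN κ β n) (0, i)).toReal) atTop
      (𝓝 (∑ i, q (0, i))) := tendsto_finsetSum _ fun i _ => by
    have h1 := (Complex.continuous_re.tendsto _).comp (tendsto_zero_prob hf i)
    rw [hf0, Complex.ofReal_re] at h1
    exact h1
  refine ⟨q, hq0, hqs, hfq, (mass_eq hβ hirr hπ hα hρ hq0 hqs hq1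
    (le_of_tendsto_occupation hβ0 hβ hirr hπ hα hρ l hQ) fun j z hz => ?_).2⟩
  rw [← hfq j z hz, mul_limit_eq hβ0 hf j hz.le]
  refine Finset.sum_congr rfl fun i _ => ?_
  rw [hfq i z hz, hf0]

/-- A product vanishes at least to the order of its first factor. -/
lemma iteratedDeriv_eq_zero_of_eventuallyEq_mul {F G H : ℂ → ℂ} {ζ : ℂ} (hG : AnalyticAt ℂ G ζ)
    (hH : AnalyticAt ℂ H ζ) (hF : F =ᶠ[𝓝 ζ] fun z => G z * H z) {m : ℕ}
    (hm : m < analyticOrderNatAt G ζ) : iteratedDeriv m F ζ = 0 := by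
  have hGH : AnalyticAt ℂ (fun z => G z * H z) ζ := hG.mul hH
  rw [hF.iteratedDeriv_eq]
  have h1 : ((analyticOrderNatAt G ζ : ℕ) : ℕ∞) ≤ analyticOrderAt (fun z => G z * H z) ζ := by
    have h2 : analyticOrderAt (fun z => G z * H z) ζ =
      analyticOrderAt G ζ + analyticOrderAt H ζ := analyticOrderAt_mul hG hH
    rw [h2]
    exact (ENat.natCast_toNat_le_self _).trans le_self_add
  exact (natCast_le_analyticOrderAt_iff_iteratedDeriv_eq_zero hGH).1 h1 m hm

/-- Near `ζ` the numerator is `det M` times an analytic component of the limit, so it vanishes at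
least to the order of `det M`. -/
lemma iteratedDeriv_numerator (hβ0 : β 0 = 0)
    (hβ : Summable fun b : ℕ => (b : ℝ) * (β b).toReal)
    (hirr : (transitionMatrix κ).IsIrreducible) {π : Fin N → ℝ} (hπ : IsStationaryVector κ π)
    (hα : ∀ i j, Summable fun k : ℕ => (k : ℝ) * (κ i (k, j)).toReal) (hρ : load κ π < 1)
    (hf : ∀ (j : Fin N) (z : ℂ), ‖z‖ ≤ 1 →
      Tendsto (fun n => lawGF (l.bind (stepN κ β n)) j z) atTop (𝓝 (f j z)))
    {ζ : ℂ} (hζ : ‖ζ‖ < 1) {m : ℕ} (hm : m < zeroMult κ ζ) (i : Fin N) :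
    iteratedDeriv m (fun z => numerator κ β (fun l => f l 0) z i) ζ = 0 := by
  obtain ⟨q, hq0, hqs, hfq, -⟩ := exists_limit_mass hβ0 hβ hirr hπ hα hρ hf
  have hball : ζ ∈ Metric.ball (0 : ℂ) 1 := by simpa using hζ
  have hdet : (fun z => (Mmat κ z).det) = detFam κ 1 := funext (det_Mmat κ)
  refine iteratedDeriv_eq_zero_of_eventuallyEq_mul (H := genFun fun x => q (x, i))
    (hdet ▸ analyticOnNhd_detFam 1 ζ hball) ?_ ?_ hm
  · refine (differentiableOn_genFun (fun x => hq0 (x, i)) ?_).analyticAt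
      (Metric.isOpen_ball.mem_nhds hball)
    exact hqs.comp_injective fun x y h => (Prod.mk.inj h).1
  · filter_upwards [Metric.isOpen_ball.mem_nhds hball] with z hz
    have hz : ‖z‖ < 1 := by simpa using hz
    rw [numerator_eq_det_smul hβ0 hf hz.le, Pi.smul_apply, smul_eq_mul, hfq i z hz]

end Limit

lemma circleZeros_eq_empty {N : ℕ} {κ : Fin N → PMF (ℕ × Fin N)}
    (hirr : (transitionMatrix κ).IsIrreducible)
    (h : ∀ z : ℂ, ‖z‖ = 1 → z ≠ 1 → ∃ i j, ‖Agf κ i j z‖ < transitionMatrix κ i j) :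
    circleZeros κ = ∅ := by
  refine Set.eq_empty_of_forall_notMem fun ζ hζ => ?_
  obtain ⟨i, j, hij⟩ := h ζ hζ.1 hζ.2.1
  exact hij.ne (norm_Agf_eq_of_mem_circleZeros hirr hζ i j)

end

end SMQueue

theorem mainTheorem4 {N : ℕ} (κ : Fin N → PMF (ℕ × Fin N)) (β : PMF ℕ)
    -- batches are non-empty and have finite mean size
    (hβ0 : β 0 = 0)
    (hβ : Summable fun b : ℕ => (b : ℝ) * (β b).toReal)
    -- the chain `J` is irreducible, with stationary distribution `π`
    (hirr : (SMQueue.transitionMatrix κ).IsIrreducible)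
    (π : Fin N → ℝ) (hπ : SMQueue.IsStationaryVector κ π)
    -- the stability condition `ρ = E[A] < 1`
    (hα : ∀ i j, Summable fun k : ℕ => (k : ℝ) * (κ i (k, j)).toReal)
    (hρ : SMQueue.load κ π < 1)
    -- the queueing process
    {Ω : Type*} [MeasurableSpace Ω] (ℙ : Measure Ω) [IsProbabilityMeasure ℙ]
    (X A B : ℕ → Ω → ℕ) (J : ℕ → Ω → Fin N) (hX : SMQueue.IsQueue κ β ℙ X A B J) :
    -- existence of a steady state, and convergence to it in the aperiodic case
    (∃ μ : PMF (ℕ × Fin N), μ.bind (SMQueue.step κ β) = μ ∧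
      ((∀ s : ℕ × Fin N, ℙ {ω | X 0 ω = s.1 ∧ J 1 ω = s.2} = μ s) →
        ∀ (n : ℕ) (s : ℕ × Fin N), ℙ {ω | X n ω = s.1 ∧ J (n + 1) ω = s.2} = μ s) ∧
      (SMQueue.HasAperiodicState κ β → ∀ (j : Fin N) (z : ℂ), ‖z‖ ≤ 1 →
        Tendsto (fun n => SMQueue.jointGF ℙ X J n j z) atTop
          (𝓝 (∑' x : ℕ, ((μ (x, j)).toReal : ℂ) * z ^ x)))) ∧
    -- the zeros of `det M` in the closed unit disc
    ((SMQueue.Mmat κ 1).det = 0 ∧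
      (SMQueue.interiorZeros κ).Finite ∧ (SMQueue.circleZeros κ).Finite ∧
      (∑ᶠ ζ ∈ SMQueue.interiorZeros κ, SMQueue.zeroMult κ ζ) + (SMQueue.circleZeros κ).ncard
        = N - 1 ∧
      ((∀ z : ℂ, ‖z‖ = 1 → z ≠ 1 →
          ∃ i j, ‖SMQueue.Agf κ i j z‖ < SMQueue.transitionMatrix κ i j) →
        SMQueue.circleZeros κ = ∅ ∧
        ∑ᶠ ζ ∈ SMQueue.interiorZeros κ, SMQueue.zeroMult κ ζ = N - 1)) ∧
    -- the steady-state generating functions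
    ∀ f : Fin N → ℂ → ℂ,
      (∀ (j : Fin N) (z : ℂ), ‖z‖ ≤ 1 →
        Tendsto (fun n => SMQueue.jointGF ℙ X J n j z) atTop (𝓝 (f j z))) →
      (∀ z : ℂ, ‖z‖ ≤ 1 →
        (SMQueue.Mmat κ z)ᵀ *ᵥ (fun j => f j z) = SMQueue.bvec κ β (fun i => f i 0) z) ∧
      (∀ z : ℂ, ‖z‖ ≤ 1 → (SMQueue.Mmat κ z).det ≠ 0 →
        (fun j => f j z) =
          (((SMQueue.Mmat κ z)ᵀ).det)⁻¹ • SMQueue.numerator κ β (fun i => f i 0) z) ∧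
      (∑ i, f i 0 = (((1 - SMQueue.load κ π) / SMQueue.meanBatch β : ℝ) : ℂ)) ∧
      (∀ ζ ∈ SMQueue.interiorZeros κ, ∀ m < SMQueue.zeroMult κ ζ, ∀ i : Fin N,
        iteratedDeriv m (fun z => SMQueue.numerator κ β (fun l => f l 0) z i) ζ = 0) ∧
      (∀ ζ ∈ SMQueue.circleZeros κ, ∀ i : Fin N,
        SMQueue.numerator κ β (fun l => f l 0) ζ i = 0) := by
  obtain ⟨l, hl⟩ := hX.exists_initial_law
  have hset : ∀ n (s : ℕ × Fin N), {ω | X n ω = s.1 ∧ J (n + 1) ω = s.2} =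
      {ω | (X n ω, J (n + 1) ω) = s} := fun n s => by
    simp only [Prod.ext_iff]
  have := hπ.nonempty
  refine ⟨?_, ?_, fun f hf => ?_⟩
  · obtain ⟨μ, hμ⟩ := SMQueue.exists_stationary hβ0 hβ hirr hπ hα hρ
    refine ⟨μ, hμ, fun h0 n s => ?_, fun hap j z hz => ?_⟩
    · rw [hset, hX.measure_state (l := μ) (fun s => by rw [← h0 s, hset]),
        SMQueue.bind_stepN_of_stationary hμ]
    · simp only [hX.jointGF_eq hl _ j hz]
      exact SMQueue.tendsto_lawGF hβ0 hβ hirr hπ hα hρ hμ hap l j hz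
  · obtain ⟨h1, h2, h3⟩ := SMQueue.zeros_det_Mmat hα hirr hπ hρ
    refine ⟨SMQueue.det_Mmat_one, h1, h2, h3, fun h => ?_⟩
    have h4 := SMQueue.circleZeros_eq_empty hirr h
    rw [h4, Set.ncard_empty, add_zero] at h3
    exact ⟨h4, h3⟩
  · have hf' : ∀ (j : Fin N) (z : ℂ), ‖z‖ ≤ 1 → Tendsto
        (fun n => SMQueue.lawGF (l.bind (SMQueue.stepN κ β n)) j z) atTop (𝓝 (f j z)) :=
      fun j z hz => (hf j z hz).congr fun n => hX.jointGF_eq hl n j hz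
    refine ⟨fun z hz => SMQueue.transpose_Mmat_mulVec_limit hβ0 hf' hz, fun z hz hdet => ?_, ?_,
      fun ζ hζ m hm i => SMQueue.iteratedDeriv_numerator hβ0 hβ hirr hπ hα hρ hf' hζ.1 hm i,
      fun ζ hζ i => ?_⟩
    · rw [SMQueue.numerator_eq_det_smul hβ0 hf' hz, Matrix.det_transpose, inv_smul_smul₀ hdet]
    · obtain ⟨q, -, -, hfq, hmass⟩ := SMQueue.exists_limit_mass hβ0 hβ hirr hπ hα hρ hf'
      have hE := SMQueue.one_le_meanBatch hβ0 hβ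
      rw [← hmass, mul_div_cancel_left₀ _ (by positivity), Complex.ofReal_sum]
      refine Finset.sum_congr rfl fun i _ => ?_
      rw [hfq i 0 (by simp), SMQueue.genFun_zero]
    · rw [SMQueue.numerator_eq_det_smul hβ0 hf' hζ.1.le, hζ.2.2, zero_smul, Pi.zero_apply]
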